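/- **Model.** An *oracle random-access machine* has integer cells with addresses $0,1,2,\dots$ and real registers, all but finitely many equal to $0$. It runs a fixed deterministic program built from assignments of integer expressions ($+,-,\times$, integer division, indirect addressing), conditionals and loops. For $\varphi:\mathbb R^k\to\mathbb R$, an oracle call puts the exact value $\varphi(x)$ into a real register, where $x$ is a rational point whose $k$ numerators are in consecutive cells and whose common denominator is the value of an integer expression. Real numbers enter the machine only in this way; a real register may be increased by a rational multiple of a real register (numerator and denominator being values of integer expressions), and two real registers may be compared for branching. Time is counted with logarithmic cost: each integer operation, cell access and use of an operand costs one unit plus the bit lengths of the integers and addresses involved (an oracle call includes the cost of reading its $k$ numerators), a real operation costs one further unit. Space is the maximum over the run of the total bit length of the addresses and contents of the nonzero integer cells and of the addresses of the nonzero real registers, plus one unit for each nonzero cell or register, plus temporary memory charged at the cost of the current step. The output is the content of real register $0$ when the program halts. **Theorem 2.1.** There are a program and an absolute constant $C\in\mathbb N$ such that the following holds for every real $\varepsilon>0$ and every integer $k\ge 1$. There are a finite set $S\subset\mathbb R^k$ and weights $w(x)>0$, $x\in S$, depending only on $k$ and $\varepsilon$, such that for every semi-norm $\varphi$ on $\mathbb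 R^k$ the program, given $k$ and $\lceil 1/\varepsilon\rceil$ as input (in cells $0$ and $1$, everything else being $0$) and oracle access to $\varphi$, * halts within time $\max(2,1/\varepsilon)^{Ck}$ and uses space at most $C\,(k+1/\varepsilon)^{C}$; * queries $\varphi$ exactly at the points of $S$, and outputs $A=\sum_{x\in S}w(x)\,\varphi(x)$. Moreover $\varphi$ is integrable with respect to the standard Gaussian measure $\mathcal N^k$ on $\mathbb R^k$, and the output is a $(1+\varepsilon)$-factor approximation to its expectation: $$A\;\le\;\mathbb E_{X\sim\mathcal N^k}[\varphi(X)]\;\le\;(1+\varepsilon)\,A .$$ -/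

import Mathlib

/-!
A random-access machine with a real-valued oracle, under the logarithmic cost criterion.

The machine has integer cells (addressed by natural numbers) and real registers.  All discrete
work (loop control, addresses, coordinates of query points, weights) is done on the integer cells
and is charged by bit length.  A real number can enter the machine only as an answer of the oracle;
real registers can be combined linearly with rational coefficients held in integer cells,
and they can be compared, so that in general later queries may depend on earlier answers.
-/

namespace OracleRAM

/-- Length of the binary expansion of `|z|` (it is `0` for `z = 0`). -/
def bits (z : ℤ) : ℕ := Nat.size z.natAbs

/-- A configuration of the memory: finitely many non-zero integer cells and finitely many
non-zero real registers; everything else is `0`. -/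
structure State where
  cell : ℕ →₀ ℤ
  real : ℕ →₀ ℝ

namespace State

/-- Space taken by a configuration: every non-zero integer cell is charged the bit length of its
address and of its content, every non-zero real register the bit length of its address,
and each of them one more unit. -/
noncomputable def size (σ : State) : ℕ :=
  (σ.cell.sum fun a z => 1 + Nat.size a + bits z) + (σ.real.sum fun r _ => 1 + Nat.size r)

/-- Overwrite an integer cell. -/
noncomputable def setCell (σ : State) (a : ℕ) (z : ℤ) : State :=
  { σ with cell := σ.cell.update a z }

/-- Overwrite a real register. -/
noncomputable def setReal (σ : State) (r : ℕ) (t : ℝ) : State :=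
  { σ with real := σ.real.update r t }

end State

/-- Integer expressions; `cell e` is the content of the cell whose address is the value of `e`. -/
inductive Expr where
  | const (z : ℤ)
  | cell (e : Expr)
  | add (e₁ e₂ : Expr)
  | sub (e₁ e₂ : Expr)
  | mul (e₁ e₂ : Expr)
  | div (e₁ e₂ : Expr)

namespace Expr

/-- The value of an expression.  A negative address is read as `0`, division is integer division
with remainder (and gives `0` if the divisor is `0`). -/
def val (σ : State) : Expr → ℤ
  | const z => z
  | cell e => σ.cell (e.val σ).toNat
  | add e₁ e₂ => e₁.val σ + e₂.val σ
  | sub e₁ e₂ => e₁.val σ - e₂.val σ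
  | mul e₁ e₂ => e₁.val σ * e₂.val σ
  | div e₁ e₂ => e₁.val σ / e₂.val σ

/-- The value of an expression that is used as an address. -/
def addr (σ : State) (e : Expr) : ℕ := (e.val σ).toNat

/-- Logarithmic cost of the evaluation of an expression: every operation costs one unit plus the
bit lengths of its operands, and every access to a cell one unit plus the bit lengths of the
address and of the content. -/
def cost (σ : State) : Expr → ℕ
  | const z => 1 + bits z
  | cell e => e.cost σ + (1 + bits (e.val σ) + bits (σ.cell (e.val σ).toNat))
  | add e₁ e₂ => e₁.cost σ + e₂.cost σ + (1 + bits (e₁.val σ) + bits (e₂.val σ))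
  | sub e₁ e₂ => e₁.cost σ + e₂.cost σ + (1 + bits (e₁.val σ) + bits (e₂.val σ))
  | mul e₁ e₂ => e₁.cost σ + e₂.cost σ + (1 + bits (e₁.val σ) + bits (e₂.val σ))
  | div e₁ e₂ => e₁.cost σ + e₂.cost σ + (1 + bits (e₁.val σ) + bits (e₂.val σ))

end Expr

/-- Programs.
* `store a e` puts the value of `e` into the integer cell `a`;
* `query r a d` asks the oracle for its value at the rational point whose `i`-th coordinate is
  (content of cell `a + i`) / (value of `d`), and puts the answer into the real register `r`;
* `addScaled r s c d` adds `c / d` times the real register `s` to the real register `r`;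
* `ite e P Q` runs `P` if the value of `e` is positive and `Q` otherwise;
* `iteReal r s P Q` runs `P` if the real register `r` is at most the real register `s`, and `Q`
  otherwise;
* `loop e P` repeats `P` as long as the value of `e` is positive. -/
inductive Prog where
  | skip
  | store (a e : Expr)
  | query (r a d : Expr)
  | addScaled (r s c d : Expr)
  | seq (P Q : Prog)
  | ite (e : Expr) (P Q : Prog)
  | iteReal (r s : Expr) (P Q : Prog)
  | loop (e : Expr) (P : Prog)

/-- The point of `ℝ ^ k` with coordinates (content of cell `a + i`) / `d`, for `i < k`. -/
noncomputable def point (k : ℕ) (σ : State) (a : ℕ) (d : ℤ) : Fin k → ℝ :=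
  fun i => (σ.cell (a + i) : ℝ) / (d : ℝ)

/-- Cost of reading the `k` coordinates of a query point. -/
def pointCost (k : ℕ) (σ : State) (a : ℕ) : ℕ :=
  ∑ i : Fin k, (1 + Nat.size (a + i) + bits (σ.cell (a + i)))

/-- `Exec φ P σ σ' qs t s`: with the oracle `φ`, the program `P` started in the configuration `σ`
halts in the configuration `σ'`; `qs` lists the points at which the oracle has been queried,
`t` is the time used, and `s` the space used, that is the largest amount of memory occupied at
any moment of the run.  An elementary step of cost `t` is also granted `t` units of
temporary memory, which are charged.  There is no run if the program does not halt. -/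
inductive Exec {k : ℕ} (φ : (Fin k → ℝ) → ℝ) :
    Prog → State → State → List (Fin k → ℝ) → ℕ → ℕ → Prop where
  | skip (σ : State) : Exec φ .skip σ σ [] 1 (σ.size + 1)
  | store (σ σ' : State) (a e : Expr) (t : ℕ)
      (hσ : σ' = σ.setCell (a.addr σ) (e.val σ))
      (ht : t = 1 + a.cost σ + e.cost σ + bits (a.val σ) + bits (e.val σ)) :
      Exec φ (.store a e) σ σ' [] t (max (σ.size + t) σ'.size)
  | query (σ σ' : State) (r a d : Expr) (x : Fin k → ℝ) (t : ℕ)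
      (hx : x = point k σ (a.addr σ) (d.val σ))
      (hσ : σ' = σ.setReal (r.addr σ) (φ x))
      (ht : t = 1 + r.cost σ + a.cost σ + d.cost σ + bits (r.val σ) + bits (d.val σ)
        + pointCost k σ (a.addr σ)) :
      Exec φ (.query r a d) σ σ' [x] t (max (σ.size + t) σ'.size)
  | addScaled (σ σ' : State) (r s c d : Expr) (t : ℕ)
      (hσ : σ' = σ.setReal (r.addr σ)
        (σ.real (r.addr σ) + (c.val σ : ℝ) / (d.val σ : ℝ) * σ.real (s.addr σ)))
      (ht : t = 1 + r.cost σ + s.cost σ + c.cost σ + d.cost σ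
        + bits (r.val σ) + bits (s.val σ) + bits (c.val σ) + bits (d.val σ)) :
      Exec φ (.addScaled r s c d) σ σ' [] t (max (σ.size + t) σ'.size)
  | seq (σ σ₁ σ₂ : State) (P Q : Prog) (qs₁ qs₂ : List (Fin k → ℝ)) (t₁ t₂ s₁ s₂ : ℕ)
      (h₁ : Exec φ P σ σ₁ qs₁ t₁ s₁) (h₂ : Exec φ Q σ₁ σ₂ qs₂ t₂ s₂) :
      Exec φ (.seq P Q) σ σ₂ (qs₁ ++ qs₂) (t₁ + t₂) (max s₁ s₂)
  | iteTrue (σ σ' : State) (e : Expr) (P Q : Prog) (qs : List (Fin k → ℝ)) (t s : ℕ)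
      (he : 0 < e.val σ) (h : Exec φ P σ σ' qs t s) :
      Exec φ (.ite e P Q) σ σ' qs (1 + e.cost σ + t) (max (σ.size + (1 + e.cost σ)) s)
  | iteFalse (σ σ' : State) (e : Expr) (P Q : Prog) (qs : List (Fin k → ℝ)) (t s : ℕ)
      (he : ¬ 0 < e.val σ) (h : Exec φ Q σ σ' qs t s) :
      Exec φ (.ite e P Q) σ σ' qs (1 + e.cost σ + t) (max (σ.size + (1 + e.cost σ)) s)
  | iteRealTrue (σ σ' : State) (r r' : Expr) (P Q : Prog) (qs : List (Fin k → ℝ)) (c t s : ℕ)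
      (hr : σ.real (r.addr σ) ≤ σ.real (r'.addr σ))
      (hc : c = 1 + r.cost σ + r'.cost σ + bits (r.val σ) + bits (r'.val σ))
      (h : Exec φ P σ σ' qs t s) :
      Exec φ (.iteReal r r' P Q) σ σ' qs (c + t) (max (σ.size + c) s)
  | iteRealFalse (σ σ' : State) (r r' : Expr) (P Q : Prog) (qs : List (Fin k → ℝ)) (c t s : ℕ)
      (hr : ¬ σ.real (r.addr σ) ≤ σ.real (r'.addr σ))
      (hc : c = 1 + r.cost σ + r'.cost σ + bits (r.val σ) + bits (r'.val σ))
      (h : Exec φ Q σ σ' qs t s) :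
      Exec φ (.iteReal r r' P Q) σ σ' qs (c + t) (max (σ.size + c) s)
  | loopStop (σ : State) (e : Expr) (P : Prog) (he : ¬ 0 < e.val σ) :
      Exec φ (.loop e P) σ σ [] (1 + e.cost σ) (σ.size + (1 + e.cost σ))
  | loopStep (σ σ₁ σ₂ : State) (e : Expr) (P : Prog) (qs₁ qs₂ : List (Fin k → ℝ))
      (t₁ t₂ s₁ s₂ : ℕ) (he : 0 < e.val σ)
      (h₁ : Exec φ P σ σ₁ qs₁ t₁ s₁) (h₂ : Exec φ (.loop e P) σ₁ σ₂ qs₂ t₂ s₂) :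
      Exec φ (.loop e P) σ σ₂ (qs₁ ++ qs₂) (1 + e.cost σ + t₁ + t₂)
        (max (σ.size + (1 + e.cost σ)) (max s₁ s₂))

/-- The machine is deterministic: the outcome, the queries, the time and the space of a run are
determined by the oracle, the program and the initial configuration. -/
theorem Exec.deterministic {k : ℕ} {φ : (Fin k → ℝ) → ℝ} {P : Prog} {σ σ₁ σ₂ : State}
    {qs₁ qs₂ : List (Fin k → ℝ)} {t₁ t₂ s₁ s₂ : ℕ}
    (h₁ : Exec φ P σ σ₁ qs₁ t₁ s₁) (h₂ : Exec φ P σ σ₂ qs₂ t₂ s₂) :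
    σ₁ = σ₂ ∧ qs₁ = qs₂ ∧ t₁ = t₂ ∧ s₁ = s₂ := by
  induction h₁ generalizing σ₂ qs₂ t₂ s₂ with
  | skip σ => cases h₂; simp
  | store => cases h₂; subst_vars; simp
  | query => cases h₂; subst_vars; simp
  | addScaled => cases h₂; subst_vars; simp
  | seq _ _ _ _ _ _ _ _ _ _ _ _ _ ih₁ ih₂ =>
    cases h₂ with
    | seq _ _ _ _ _ _ _ _ _ _ _ g₁ g₂ =>
      obtain ⟨rfl, rfl, rfl, rfl⟩ := ih₁ g₁
      obtain ⟨rfl, rfl, rfl, rfl⟩ := ih₂ g₂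
      simp
  | iteTrue _ _ _ _ _ _ _ _ he _ ih =>
    cases h₂ with
    | iteTrue _ _ _ _ _ _ _ _ _ g =>
      obtain ⟨rfl, rfl, rfl, rfl⟩ := ih g
      simp
    | iteFalse _ _ _ _ _ _ _ _ he' _ => exact absurd he he'
  | iteFalse _ _ _ _ _ _ _ _ he _ ih =>
    cases h₂ with
    | iteTrue _ _ _ _ _ _ _ _ he' _ => exact absurd he' he
    | iteFalse _ _ _ _ _ _ _ _ _ g =>
      obtain ⟨rfl, rfl, rfl, rfl⟩ := ih g
      simp
  | iteRealTrue _ _ _ _ _ _ _ _ _ _ hr hc _ ih =>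
    cases h₂ with
    | iteRealTrue _ _ _ _ _ _ _ _ _ _ _ hc' g =>
      obtain ⟨rfl, rfl, rfl, rfl⟩ := ih g
      subst hc hc'
      simp
    | iteRealFalse _ _ _ _ _ _ _ _ _ _ hr' _ _ => exact absurd hr hr'
  | iteRealFalse _ _ _ _ _ _ _ _ _ _ hr hc _ ih =>
    cases h₂ with
    | iteRealTrue _ _ _ _ _ _ _ _ _ _ hr' _ _ => exact absurd hr' hr
    | iteRealFalse _ _ _ _ _ _ _ _ _ _ _ hc' g =>
      obtain ⟨rfl, rfl, rfl, rfl⟩ := ih g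
      subst hc hc'
      simp
  | loopStop _ _ _ he =>
    cases h₂ with
    | loopStop _ _ _ _ => simp
    | loopStep _ _ _ _ _ _ _ _ _ _ _ he' _ _ => exact absurd he' he
  | loopStep _ _ _ _ _ _ _ _ _ _ _ he _ _ ih₁ ih₂ =>
    cases h₂ with
    | loopStop _ _ _ he' => exact absurd he he'
    | loopStep _ _ _ _ _ _ _ _ _ _ _ _ g₁ g₂ =>
      obtain ⟨rfl, rfl, rfl, rfl⟩ := ih₁ g₁
      obtain ⟨rfl, rfl, rfl, rfl⟩ := ih₂ g₂
      simp

/-- The initial configuration: cell `0` contains the dimension `k`, cell `1` the integer accuracy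
parameter `n`, and all other cells and all real registers are `0`. -/
noncomputable def initial (k n : ℕ) : State where
  cell := Finsupp.single 0 (k : ℤ) + Finsupp.single 1 (n : ℤ)
  real := 0

/-- The output of a run is the content of the real register `0` when the program halts. -/
def State.output (σ : State) : ℝ := σ.real 0

end OracleRAM

/-- The standard Gaussian measure `𝓝 ^ k` on `ℝ ^ k`, a product of `k` copies of the univariate
Gaussian distribution with mean `0` and variance `1`. -/
noncomputable def stdNormal (k : ℕ) : MeasureTheory.Measure (Fin k → ℝ) :=
  MeasureTheory.Measure.pi fun _ => ProbabilityTheory.gaussianReal 0 1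

/-- `p` is an `α`-factor approximation to the quantity `X`. -/
def IsFactorApprox (α p X : ℝ) : Prop := p ≤ X ∧ X ≤ α * p

/-! ### Chebyshev's sum inequality and the cells of a rounded Gaussian variable -/

/-! Let n = ⌈1/ε⌉, δ = 1/(64n) and a = 2/δ². The output is a weighted mean of φ over the grid points
δz with z integral and |z|² ≤ N = 256nk/δ², where z has weight ((a-1)/a)^|z|² = exp(-l|z|²) with l =
-log(1 - δ²/2). These weights are rational, and l is close to δ²/2, the exponent of the Gaussian
density on δℤ.

The discrete and the continuous Gaussian laws are compared in the convex order, so that no error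
accumulates with the dimension. On the line the link is the Gaussian variable rounded to δℤ. The
mass of its cell at δz is exp(-δ²z²/2) times an integral of cosh(δzu) (`gridMass_eq`), so its ratio
to exp(-lz²) increases in |z| for l ≥ δ²/2 and decreases for l ≤ δ²/2 - δ⁴/8. Even convex functions
increase in |z| too, and Chebyshev's sum inequality compares the two means. Rounding itself costs a
dilation by 1 ± δ: the rounding error is at most δ/2 while E|X| ≥ 1/2, so convexity and Jensen
absorb it. Symmetrization removes evenness, and replacing one coordinate after another
(`integral_pi_le_of_convexOrder`) carries the comparison to ℝ^k. For a semi-norm a dilation is just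
a factor, which gives relative errors O(δ) uniformly in k.

Truncation to the ball is paid for by a wider discrete Gaussian with parameter l/4: off the ball
exp(-l|z|²) ≤ exp(-3lN/4) exp(-l|z|²/4), and the normalizing constants differ by at most 3^k, which
exp(-3lN/4) beats. The resulting two-sided error 1/(4n) becomes one-sided after scaling by
4n/(4n+1).

For the running time, the ball of squared radius kL has at most (6(L+1))^k lattice points
(`card_latticeBall_le`); here L is polynomial in n, so no factor k^k appears. For the space, the
points are produced by an odometer that keeps only the current point, its squared norm and running
sums. Each coordinate runs through 0, 1, -1, 2, -2, …, so its square never decreases; once a carry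
leaves the ball, everything skipped lies outside as well (`ballBefore_carryAt`). An extra coordinate
records overflow and stops the enumeration. -/

theorem tsum_mul_tsum_le_of_monovary {ι : Type*} {w G f : ι → ℝ} (hw : ∀ i, 0 ≤ w i)
    (hGf : ∀ i j, 0 ≤ (G i - G j) * (f i - f j)) (h1 : Summable w)
    (hG : Summable fun i => w i * G i) (hf : Summable fun i => w i * f i)
    (hGfs : Summable fun i => w i * G i * f i) :
    (∑' i, w i * G i) * (∑' i, w i * f i) ≤ (∑' i, w i) * ∑' i, w i * G i * f i := by
  have key : ∀ {u v : ι → ℝ}, Summable u → Summable v →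
      HasSum (fun p : ι × ι => u p.1 * v p.2) ((∑' i, u i) * ∑' i, v i) := by
    intro u v hu hv
    rw [tsum_mul_tsum_of_summable_norm hu.norm hv.norm]
    exact (summable_mul_of_summable_norm hu.norm hv.norm).hasSum
  -- The double sum of w i * w j * (G i - G j) * (f i - f j), nonnegative term by term, equals twice
  -- the difference of the two sides.
  have h := (((key hGfs h1).add (key h1 hGfs)).sub (key hG hf)).sub (key hf hG)
  have h0 := h.nonneg (fun p => by
    have := mul_nonneg (mul_nonneg (hw p.1) (hw p.2)) (hGf p.1 p.2)
    nlinarith [this])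
  nlinarith [h0]

theorem Real.sinh_le_mul_cosh {x : ℝ} (hx : 0 ≤ x) : Real.sinh x ≤ x * Real.cosh x := by
  have hd : ∀ y : ℝ, HasDerivAt (fun y => y * Real.cosh y - Real.sinh y) (y * Real.sinh y) y := by
    intro y
    have := ((hasDerivAt_id y).mul (Real.hasDerivAt_cosh y)).sub (Real.hasDerivAt_sinh y)
    exact this.congr_deriv (by simp)
  have hm : MonotoneOn (fun y => y * Real.cosh y - Real.sinh y) (Set.Ici 0) := by
    apply monotoneOn_of_deriv_nonneg (convex_Ici 0)
    · exact fun y _ => (hd y).continuousAt.continuousWithinAt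
    · exact fun y _ => (hd y).differentiableAt.differentiableWithinAt
    · intro y hy
      rw [(hd y).deriv]
      have hy' : 0 ≤ y := by simpa using (interior_subset hy : y ∈ Set.Ici (0:ℝ))
      exact mul_nonneg hy' (Real.sinh_nonneg_iff.2 hy')
  have := hm (Set.mem_Ici.2 le_rfl) (Set.mem_Ici.2 hx) hx
  simp at this
  linarith

/-- The derivative has the sign of sinh y - y cosh y. Hence the growth of the factor cosh(δzu) in a
cell mass is absorbed by a small extra Gaussian factor in z. -/
theorem Real.antitoneOn_cosh_mul_exp_neg_sq :
    AntitoneOn (fun x : ℝ => Real.cosh x * Real.exp (-(x ^ 2 / 2))) (Set.Ici 0) := by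
  have hd : ∀ y : ℝ, HasDerivAt (fun x : ℝ => Real.cosh x * Real.exp (-(x ^ 2 / 2)))
      (Real.exp (-(y ^ 2 / 2)) * (Real.sinh y - y * Real.cosh y)) y := by
    intro y
    have h2 : HasDerivAt (fun x : ℝ => -(x ^ 2 / 2)) (-y) y := by
      have := (((hasDerivAt_id y).pow 2).div_const 2).neg
      exact this.congr_deriv (by simp)
    have := (Real.hasDerivAt_cosh y).mul h2.exp
    exact this.congr_deriv (by ring)
  apply antitoneOn_of_deriv_nonpos (convex_Ici 0)
  · exact fun y _ => (hd y).continuousAt.continuousWithinAt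
  · exact fun y _ => (hd y).differentiableAt.differentiableWithinAt
  · intro y hy
    rw [(hd y).deriv]
    have hy' : 0 ≤ y := by simpa using (interior_subset hy : y ∈ Set.Ici (0:ℝ))
    exact mul_nonpos_of_nonneg_of_nonpos (Real.exp_pos _).le
      (by linarith [Real.sinh_le_mul_cosh hy'])

/-- The probability that a standard normal variable rounds to `δ z` on the grid `δ ℤ`. -/
noncomputable def gridMass (δ : ℝ) (z : ℤ) : ℝ :=
  (ProbabilityTheory.gaussianReal 0 1).real {x | ⌊x / δ + 1 / 2⌋ = z}

open MeasureTheory ProbabilityTheory in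
-- Averaging the density at δz + u and δz - u over the cell turns the cross term exp(-δzu) into a
-- hyperbolic cosine, which separates the lattice Gaussian from a slowly varying even factor.
theorem gridMass_eq {δ : ℝ} (hδ : 0 < δ) (z : ℤ) :
    gridMass δ z = Real.exp (-(δ ^ 2 * z ^ 2 / 2)) *
      ∫ u in (-(δ / 2))..(δ / 2), (√(2 * Real.pi))⁻¹ * Real.exp (-(u ^ 2 / 2)) *
        Real.cosh (δ * z * u) := by
  have hset : {x : ℝ | ⌊x / δ + 1 / 2⌋ = z} = Set.Ico (δ * z - δ / 2) (δ * z + δ / 2) := by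
    ext x
    simp only [Set.mem_ofPred_eq, Int.floor_eq_iff, Set.mem_Ico]
    constructor
    · rintro ⟨h1, h2⟩
      have e : x = x / δ * δ := by field_simp
      constructor <;> nlinarith
    · rintro ⟨h1, h2⟩
      have e : x = x / δ * δ := by field_simp
      constructor
      · by_contra! h
        nlinarith
      · by_contra! h
        nlinarith
  have h1 : gridMass δ z = ∫ x in (δ * z - δ / 2)..(δ * z + δ / 2), gaussianPDFReal 0 1 x := by
    rw [gridMass, hset, Measure.real, gaussianReal_apply_eq_integral _ one_ne_zero,
      ENNReal.toReal_ofReal, intervalIntegral.integral_of_le (by linarith),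
      integral_Ico_eq_integral_Ioc]
    exact setIntegral_nonneg measurableSet_Ico fun x _ => gaussianPDFReal_nonneg 0 1 x
  have h2 : gridMass δ z = ∫ u in (-(δ / 2))..(δ / 2), gaussianPDFReal 0 1 (δ * z + u) := by
    rw [h1, intervalIntegral.integral_comp_add_left]
    congr 1
  have h3 : gridMass δ z = ∫ u in (-(δ / 2))..(δ / 2), gaussianPDFReal 0 1 (δ * z + -u) := by
    rw [h2, intervalIntegral.integral_comp_neg (fun u => gaussianPDFReal 0 1 (δ * z + u)), neg_neg]
  have hc : Continuous (gaussianPDFReal 0 1) := by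
    unfold gaussianPDFReal; fun_prop
  have h4 : gridMass δ z = ∫ u in (-(δ / 2))..(δ / 2),
      (gaussianPDFReal 0 1 (δ * z + u) + gaussianPDFReal 0 1 (δ * z + -u)) / 2 := by
    rw [intervalIntegral.integral_div, intervalIntegral.integral_add, ← h2, ← h3]
    · ring
    · exact (hc.comp (by fun_prop)).intervalIntegrable _ _
    · exact (hc.comp (by fun_prop)).intervalIntegrable _ _
  rw [h4, ← intervalIntegral.integral_const_mul]
  apply intervalIntegral.integral_congr
  intro u _
  simp only [gaussianPDFReal, Real.cosh_eq]
  have e1 : -(δ * z + u - 0) ^ 2 / (2 * (1 : NNReal)) =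
      -(δ ^ 2 * z ^ 2 / 2) + -(u ^ 2 / 2) + -(δ * z * u) := by push_cast; ring
  have e2 : -(δ * z + -u - 0) ^ 2 / (2 * (1 : NNReal)) =
      -(δ ^ 2 * z ^ 2 / 2) + -(u ^ 2 / 2) + (δ * z * u) := by push_cast; ring
  rw [e1, e2]
  simp only [Real.exp_add]
  push_cast
  ring_nf

/-- Both factors that remain, exp((l - δ²/2)z²) and the integral of the cosh, grow with |z|. -/
theorem gridMass_ratio_mono {δ l : ℝ} (hδ : 0 < δ) (hl : δ ^ 2 / 2 ≤ l) {y z : ℤ}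
    (h : |y| ≤ |z|) :
    gridMass δ y * Real.exp (l * y ^ 2) ≤ gridMass δ z * Real.exp (l * z ^ 2) := by
  have hyz : (y : ℝ) ^ 2 ≤ (z : ℝ) ^ 2 := by
    have : |(y : ℝ)| ≤ |(z : ℝ)| := by exact_mod_cast h
    exact sq_le_sq.2 this
  have hI : ∀ z : ℤ, gridMass δ z * Real.exp (l * z ^ 2) = Real.exp ((l - δ ^ 2 / 2) * z ^ 2) *
      ∫ u in (-(δ / 2))..(δ / 2), (√(2 * Real.pi))⁻¹ * Real.exp (-(u ^ 2 / 2)) *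
        Real.cosh (δ * z * u) := by
    intro z
    rw [gridMass_eq hδ, mul_right_comm, ← Real.exp_add]
    ring_nf
  rw [hI, hI]
  apply mul_le_mul
  · apply Real.exp_le_exp.2
    nlinarith
  · apply intervalIntegral.integral_mono_on (by linarith)
    · exact Continuous.intervalIntegrable (by fun_prop) _ _
    · exact Continuous.intervalIntegrable (by fun_prop) _ _
    · intro u _
      apply mul_le_mul_of_nonneg_left _ (by positivity)
      rw [Real.cosh_le_cosh, abs_mul, abs_mul, abs_mul, abs_mul]
      have : |(y : ℝ)| ≤ |(z : ℝ)| := by exact_mod_cast h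
      gcongr
  · apply intervalIntegral.integral_nonneg (by linarith)
    intro u _
    have := Real.cosh_pos (δ * y * u)
    positivity
  · positivity

/-- The cosh is paired with exp(-(δzu)²/2), which makes it decreasing. The exponent left over is
-(δ²/2 - l - δ²u²/2)z², and |u| ≤ δ/2 makes the bracket nonnegative; this is the origin of δ⁴/8. -/
theorem gridMass_ratio_anti {δ l : ℝ} (hδ : 0 < δ) (hl : l ≤ δ ^ 2 / 2 - δ ^ 4 / 8) {y z : ℤ}
    (h : |y| ≤ |z|) :
    gridMass δ z * Real.exp (l * z ^ 2) ≤ gridMass δ y * Real.exp (l * y ^ 2) := by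
  have hyz' : |(y : ℝ)| ≤ |(z : ℝ)| := by exact_mod_cast h
  have hyz : (y : ℝ) ^ 2 ≤ (z : ℝ) ^ 2 := sq_le_sq.2 hyz'
  have hI : ∀ z : ℤ, gridMass δ z * Real.exp (l * z ^ 2) =
      ∫ u in (-(δ / 2))..(δ / 2), (√(2 * Real.pi))⁻¹ * Real.exp (-(u ^ 2 / 2)) *
        (Real.exp (-(δ ^ 2 / 2 - l - δ ^ 2 * u ^ 2 / 2) * z ^ 2) *
        (Real.cosh |δ * z * u| * Real.exp (-(|δ * z * u| ^ 2 / 2)))) := by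
    intro z
    rw [gridMass_eq hδ, mul_right_comm, ← Real.exp_add, ← intervalIntegral.integral_const_mul]
    apply intervalIntegral.integral_congr
    intro u _
    simp only [Real.cosh_abs, sq_abs]
    have : -(δ ^ 2 * (z:ℝ) ^ 2 / 2) + l * z ^ 2 =
      -(δ ^ 2 / 2 - l - δ ^ 2 * u ^ 2 / 2) * z ^ 2 + (-((δ * z * u) ^ 2 / 2)) := by ring
    rw [this, Real.exp_add]
    ring
  rw [hI, hI]
  apply intervalIntegral.integral_mono_on (by linarith)
  · exact Continuous.intervalIntegrable (by fun_prop) _ _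
  · exact Continuous.intervalIntegrable (by fun_prop) _ _
  · intro u hu
    apply mul_le_mul_of_nonneg_left _ (by positivity)
    apply mul_le_mul
    · apply Real.exp_le_exp.2
      have hu2 : u ^ 2 ≤ (δ / 2) ^ 2 := sq_le_sq' (by linarith [hu.1]) hu.2
      have : 0 ≤ δ ^ 2 / 2 - l - δ ^ 2 * u ^ 2 / 2 := by nlinarith [sq_nonneg δ]
      nlinarith
    · apply Real.antitoneOn_cosh_mul_exp_neg_sq (Set.mem_Ici.2 (abs_nonneg _))
        (Set.mem_Ici.2 (abs_nonneg _))
      rw [abs_mul, abs_mul, abs_mul, abs_mul]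
      gcongr
    · have := Real.cosh_pos |δ * z * u|
      positivity
    · positivity

/-! ### Convex order between the discrete and the continuous Gaussian distribution on the line -/

open MeasureTheory ProbabilityTheory Set

theorem summable_exp_neg_mul_int_sq {l : ℝ} (hl : 0 < l) :
    Summable fun z : ℤ => Real.exp (-(l * z ^ 2)) := by
  have hs : Summable fun n : ℕ => Real.exp (-l) ^ n :=
    summable_geometric_of_lt_one (Real.exp_pos _).le (by simpa using hl)
  have h : Summable fun n : ℕ => Real.exp (-(l * (n : ℝ) ^ 2)) := by
    refine hs.of_nonneg_of_le (fun n => (Real.exp_pos _).le) (fun n => ?_)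
    rw [← Real.exp_nat_mul]
    apply Real.exp_le_exp.2
    have : (n : ℝ) ≤ (n : ℝ) ^ 2 := by exact_mod_cast Nat.le_self_pow two_ne_zero n
    nlinarith
  rw [summable_int_iff_summable_nat_and_neg]
  constructor <;> simpa using h

theorem summable_abs_mul_exp_neg_mul_int_sq {l : ℝ} (hl : 0 < l) :
    Summable fun z : ℤ => Real.exp (-(l * z ^ 2)) * |(z : ℝ)| := by
  refine ((summable_exp_neg_mul_int_sq (half_pos hl)).mul_left (2 / l)).of_nonneg_of_le
    (fun z => by positivity) (fun z => ?_)
  have h1 : |(z : ℝ)| ≤ (z : ℝ) ^ 2 := by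
    rw [← sq_abs]
    have : |z| ≤ |z| ^ 2 := by
      rcases eq_or_lt_of_le (abs_nonneg z) with h | h
      · rw [← h]; simp
      · nlinarith
    exact_mod_cast this
  have h2 : l / 2 * |(z : ℝ)| ≤ Real.exp (l / 2 * z ^ 2) := by
    have := Real.add_one_le_exp (l / 2 * (z : ℝ) ^ 2)
    nlinarith
  have e : -(l * (z : ℝ) ^ 2) = -(l / 2 * z ^ 2) + -(l / 2 * z ^ 2) := by ring
  rw [e, Real.exp_add]
  have h3 : Real.exp (-(l / 2 * (z : ℝ) ^ 2)) * |(z : ℝ)| ≤ 2 / l := by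
    rw [Real.exp_neg, inv_mul_le_iff₀ (Real.exp_pos _), mul_div_assoc', le_div_iff₀ hl]
    nlinarith
  nlinarith [Real.exp_pos (-(l / 2 * (z : ℝ) ^ 2))]

/-- The normalizing constant of the discrete Gaussian distribution. -/
noncomputable def thetaSum (l : ℝ) : ℝ := ∑' z : ℤ, Real.exp (-(l * z ^ 2))

theorem thetaSum_pos {l : ℝ} (hl : 0 < l) : 0 < thetaSum l :=
  (summable_exp_neg_mul_int_sq hl).tsum_pos (fun _ => (Real.exp_pos _).le) 0 (Real.exp_pos _)

/-- Split by parity. The even integer 2z contributes exp(-lz²); the odd integer 2z + 1 contributes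
exp(-l(z + 1/2)²), which is at most the term of whichever of z and z + 1 is nearer to 0, hence at
most the sum of both. -/
theorem thetaSum_div_four_le {l : ℝ} (hl : 0 < l) : thetaSum (l / 4) ≤ 3 * thetaSum l := by
  have hs := summable_exp_neg_mul_int_sq (l := l / 4) (by positivity)
  have hl' := summable_exp_neg_mul_int_sq hl
  have e : ∀ p : ℤ × Fin 2, (((Int.divModEquiv 2).symm p : ℤ) : ℝ) = 2 * p.1 + (p.2 : ℕ) := by
    intro p
    simp [Int.divModEquiv]; ring
  rw [thetaSum, ← (Int.divModEquiv 2).symm.tsum_eq]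
  have hs2 : Summable fun p : ℤ × Fin 2 =>
      Real.exp (-(l / 4 * (((Int.divModEquiv 2).symm p : ℤ) : ℝ) ^ 2)) :=
    (Int.divModEquiv 2).symm.summable_iff.2 hs
  rw [Summable.tsum_prod hs2]
  simp only [Fin.sum_univ_two, tsum_fintype]
  have hsh : Summable fun z : ℤ => Real.exp (-(l * ((z + 1 : ℤ) : ℝ) ^ 2)) :=
    (Equiv.addRight (1 : ℤ)).summable_iff.2 hl'
  have esh : ∑' z : ℤ, Real.exp (-(l * ((z + 1 : ℤ) : ℝ) ^ 2)) = thetaSum l :=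
    (Equiv.addRight (1 : ℤ)).tsum_eq fun z : ℤ => Real.exp (-(l * (z : ℝ) ^ 2))
  have hle : ∀ z : ℤ, Real.exp (-(l / 4 * (((Int.divModEquiv 2).symm (z, 0) : ℤ) : ℝ) ^ 2)) +
      Real.exp (-(l / 4 * (((Int.divModEquiv 2).symm (z, 1) : ℤ) : ℝ) ^ 2)) ≤
      Real.exp (-(l * (z : ℝ) ^ 2)) + (Real.exp (-(l * (z : ℝ) ^ 2)) +
        Real.exp (-(l * ((z + 1 : ℤ) : ℝ) ^ 2))) := by
    intro z
    rw [e, e]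
    apply add_le_add
    · apply Real.exp_le_exp.2; simp; nlinarith
    · push_cast
      rcases le_or_gt 0 z with hz | hz
      · have hz' : (0 : ℝ) ≤ z := by exact_mod_cast hz
        have : Real.exp (-(l / 4 * (2 * (z : ℝ) + 1) ^ 2)) ≤ Real.exp (-(l * (z : ℝ) ^ 2)) := by
          apply Real.exp_le_exp.2
          nlinarith [mul_nonneg hl.le hz']
        simpa using this.trans (le_add_of_nonneg_right (Real.exp_pos _).le)
      · have hz' : (z : ℝ) ≤ -1 := by exact_mod_cast Int.le_sub_one_of_lt hz
        have : Real.exp (-(l / 4 * (2 * (z : ℝ) + 1) ^ 2)) ≤ Real.exp (-(l * ((z : ℝ) + 1) ^ 2)) := by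
          apply Real.exp_le_exp.2
          nlinarith
        simpa using this.trans (le_add_of_nonneg_left (Real.exp_pos _).le)
  have hsum := hl'.add (hl'.add hsh)
  have := Summable.tsum_le_tsum hle (hsum.of_nonneg_of_le (fun z => by positivity) hle) hsum
  refine this.trans (le_of_eq ?_)
  rw [hl'.tsum_add (hl'.add hsh), hl'.tsum_add hsh, esh]
  simp only [thetaSum]
  ring

/-- The discrete Gaussian distribution, with mass proportional to `exp (-l z²)` at `z : ℤ`. -/
noncomputable def discreteGaussian (l : ℝ) : Measure ℤ :=
  Measure.sum fun z : ℤ => ENNReal.ofReal (Real.exp (-(l * z ^ 2)) / thetaSum l) • Measure.dirac z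

theorem discreteGaussian_singleton (l : ℝ) (z : ℤ) :
    discreteGaussian l {z} = ENNReal.ofReal (Real.exp (-(l * z ^ 2)) / thetaSum l) := by
  rw [discreteGaussian, Measure.sum_apply _ (measurableSet_singleton z), tsum_eq_single z]
  · simp
  · intro b hb
    simp [hb]

theorem isProbabilityMeasure_discreteGaussian {l : ℝ} (hl : 0 < l) :
    IsProbabilityMeasure (discreteGaussian l) := by
  constructor
  rw [discreteGaussian, Measure.sum_apply _ MeasurableSet.univ]
  simp only [Measure.smul_apply, measure_univ, smul_eq_mul, mul_one]
  have := thetaSum_pos hl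
  rw [← ENNReal.ofReal_tsum_of_nonneg (fun z => by positivity)
    ((summable_exp_neg_mul_int_sq hl).div_const _), tsum_div_const, ← thetaSum, div_self this.ne',
    ENNReal.ofReal_one]

theorem integral_discreteGaussian {l : ℝ} (hl : 0 < l) (f : ℤ → ℝ) :
    ∫ z, f z ∂discreteGaussian l = (∑' z : ℤ, Real.exp (-(l * z ^ 2)) * f z) / thetaSum l := by
  rw [discreteGaussian, integral_sum_dirac (fun _ => ENNReal.ofReal_ne_top), ← tsum_div_const]
  congr 1 with z
  have := thetaSum_pos hl
  rw [ENNReal.toReal_ofReal (by positivity), smul_eq_mul]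
  ring

theorem integrable_cast_discreteGaussian {l : ℝ} (hl : 0 < l) :
    Integrable (fun z : ℤ => (z : ℝ)) (discreteGaussian l) := by
  rw [discreteGaussian, integrable_sum_dirac_iff fun _ => ENNReal.ofReal_ne_top]
  refine ((summable_abs_mul_exp_neg_mul_int_sq hl).div_const (thetaSum l)).congr fun z => ?_
  have := thetaSum_pos hl
  rw [ENNReal.toReal_ofReal (by positivity), Real.norm_eq_abs]
  ring

theorem LipschitzWith.norm_le_add {E : Type*} [SeminormedAddCommGroup E] {f : E → ℝ} {L : NNReal}
    (hf : LipschitzWith L f) (x : E) : ‖f x‖ ≤ ‖f 0‖ + L * ‖x‖ := by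
  have := hf.dist_le_mul x 0
  rw [dist_zero_right, Real.dist_eq] at this
  have h2 := abs_sub_abs_le_abs_sub (f x) (f 0)
  rw [Real.norm_eq_abs, Real.norm_eq_abs]
  linarith

theorem LipschitzWith.integrable_comp_of_integrable {α E : Type*} [MeasurableSpace α]
    [NormedAddCommGroup E] {μ : Measure α} [IsFiniteMeasure μ] {f : E → ℝ} {L : NNReal}
    (hf : LipschitzWith L f) {a : α → E} (ha : Integrable a μ) :
    Integrable (fun x => f (a x)) μ := by
  refine ((integrable_const ‖f 0‖).add (ha.norm.const_mul (L : ℝ))).mono'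
    (hf.continuous.comp_aestronglyMeasurable ha.1) (Filter.Eventually.of_forall fun x => ?_)
  exact hf.norm_le_add (a x)

theorem ConvexOn.le_of_abs_le_of_even {f : ℝ → ℝ} (hf : ConvexOn ℝ univ f)
    (he : ∀ x, f (-x) = f x) {x y : ℝ} (h : |x| ≤ |y|) : f x ≤ f y := by
  have h1 := hf.le_max_of_mem_Icc (mem_univ (-|y|)) (mem_univ |y|) (abs_le.1 h)
  have h2 : f |y| = f y := by rcases abs_choice y with e | e <;> rw [e]; exact he y
  rwa [he, max_self, h2] at h1

theorem integrable_id_gaussianReal : Integrable (fun x : ℝ => x) (gaussianReal 0 1) :=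
  (memLp_id_gaussianReal 1).integrable (by simp)

theorem integral_Ioi_mul_exp_neg_sq_div_two :
    ∫ x in Ioi (0 : ℝ), x * Real.exp (-(x ^ 2 / 2)) = 1 := by
  have h := integral_mul_cexp_neg_mul_sq (b := 1 / 2) (by norm_num)
  have e : ∀ x : ℝ, (x : ℂ) * Complex.exp (-(1 / 2) * (x : ℂ) ^ 2) =
      ((x * Real.exp (-(x ^ 2 / 2)) : ℝ) : ℂ) := by
    intro x
    push_cast
    ring_nf
  simp only [e] at h
  rw [integral_complex_ofReal] at h
  norm_num at h
  exact_mod_cast h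

/-- The exact value is √(2/π). The bound 1/2 is what makes a rounding error of half a cell
comparable to the variable itself. -/
theorem half_le_integral_abs_gaussianReal : 1 / 2 ≤ ∫ x, |x| ∂gaussianReal 0 1 := by
  rw [integral_gaussianReal_eq_integral_smul one_ne_zero]
  have e : ∀ x : ℝ, gaussianPDFReal 0 1 x • |x| =
      (fun t : ℝ => (√(2 * Real.pi))⁻¹ * (t * Real.exp (-(t ^ 2 / 2)))) |x| := by
    intro x
    simp only [gaussianPDFReal, sq_abs, smul_eq_mul]
    push_cast
    ring_nf
  simp only [e]
  rw [integral_comp_abs (f := fun t : ℝ => (√(2 * Real.pi))⁻¹ * (t * Real.exp (-(t ^ 2 / 2)))),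
    integral_const_mul, integral_Ioi_mul_exp_neg_sq_div_two]
  have hpi := Real.pi_lt_four
  have h4 : √(2 * Real.pi) ≤ 4 := by
    rw [Real.sqrt_le_left (by norm_num)]
    nlinarith
  have h0 : 0 < √(2 * Real.pi) := Real.sqrt_pos.2 (by positivity)
  have : 1 / 4 ≤ (√(2 * Real.pi))⁻¹ := by
    rw [one_div]
    exact inv_anti₀ h0 h4
  linarith

/-- Rounding to the grid `δ ℤ`. -/
noncomputable def gridRound (δ x : ℝ) : ℝ := δ * ⌊x / δ + 1 / 2⌋

theorem abs_sub_gridRound_le {δ : ℝ} (hδ : 0 < δ) (x : ℝ) : |x - gridRound δ x| ≤ δ / 2 := by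
  have h1 := Int.floor_le (x / δ + 1 / 2)
  have h2 := Int.lt_floor_add_one (x / δ + 1 / 2)
  have e : x = x / δ * δ := by field_simp
  rw [gridRound, abs_le]
  constructor <;> nlinarith

theorem measurable_gridIndex (δ : ℝ) : Measurable fun x : ℝ => ⌊x / δ + 1 / 2⌋ := by fun_prop

theorem measurable_gridRound (δ : ℝ) : Measurable (gridRound δ) := by
  unfold gridRound; fun_prop

theorem integrable_gridRound {δ : ℝ} (hδ : 0 < δ) :
    Integrable (gridRound δ) (gaussianReal 0 1) := by
  refine (integrable_id_gaussianReal.norm.add (integrable_const (δ / 2))).mono'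
    (measurable_gridRound δ).aestronglyMeasurable (Filter.Eventually.of_forall fun x => ?_)
  have := abs_sub_gridRound_le hδ x
  have h2 := abs_sub_abs_le_abs_sub (gridRound δ x) x
  rw [abs_sub_comm] at h2
  simp only [Pi.add_apply, Real.norm_eq_abs]
  linarith

theorem hasSum_gridMass_mul {δ : ℝ} {f : ℝ → ℝ}
    (hf : Integrable (fun x => f (gridRound δ x)) (gaussianReal 0 1)) :
    HasSum (fun z : ℤ => gridMass δ z * f (δ * z)) (∫ x, f (gridRound δ x) ∂gaussianReal 0 1) := by
  have hm := measurable_gridIndex δ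
  have hi : Integrable (fun z : ℤ => f (δ * z))
      ((gaussianReal 0 1).map fun x : ℝ => ⌊x / δ + 1 / 2⌋) :=
    (integrable_map_measure Measurable.of_discrete.aestronglyMeasurable hm.aemeasurable).2 hf
  have e1 : ∫ x, f (gridRound δ x) ∂gaussianReal 0 1 =
      ∫ z : ℤ, f (δ * z) ∂((gaussianReal 0 1).map fun x : ℝ => ⌊x / δ + 1 / 2⌋) := by
    rw [integral_map hm.aemeasurable Measurable.of_discrete.aestronglyMeasurable]
    rfl
  have e2 : ∀ z : ℤ, gridMass δ z =
      ((gaussianReal 0 1).map fun x : ℝ => ⌊x / δ + 1 / 2⌋).real {z} := by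
    intro z
    rw [map_measureReal_apply hm (measurableSet_singleton z)]
    rfl
  rw [e1]
  simp only [e2]
  rw [← Measure.sum_smul_dirac ((gaussianReal 0 1).map _)] at hi
  have := hasSum_integral_measure hi
  rw [Measure.sum_smul_dirac] at this
  simpa [integral_smul_measure, Measure.real] using this

theorem summable_exp_mul_of_integrable {l : ℝ} (hl : 0 < l) {g : ℤ → ℝ}
    (hg : Integrable g (discreteGaussian l)) :
    Summable fun z : ℤ => Real.exp (-(l * z ^ 2)) * g z := by
  rw [discreteGaussian, integrable_sum_dirac_iff fun _ => ENNReal.ofReal_ne_top] at hg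
  have hp := thetaSum_pos hl
  refine Summable.of_norm ((hg.mul_left (thetaSum l)).congr fun z => ?_)
  rw [ENNReal.toReal_ofReal (by positivity), norm_mul, Real.norm_eq_abs, Real.norm_eq_abs,
    abs_of_pos (Real.exp_pos _)]
  field_simp

theorem tsum_gridMass (δ : ℝ) : ∑' z : ℤ, gridMass δ z = 1 := by
  have := hasSum_gridMass_mul (δ := δ) (f := fun _ => 1) (integrable_const _)
  simpa using this.tsum_eq

theorem summable_gridMass (δ : ℝ) : Summable fun z : ℤ => gridMass δ z := by
  have := hasSum_gridMass_mul (δ := δ) (f := fun _ => 1) (integrable_const _)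
  simpa using this.summable

/-- Jensen is applied to |g| instead of g, whose mean may vanish; evenness gives f(|g|) = f(g) and
monotonicity of f in the absolute value. -/
theorem integral_even_abs_gaussianReal_ge {f : ℝ → ℝ} {L : NNReal} (hf : ConvexOn ℝ univ f)
    (hL : LipschitzWith L f) (he : ∀ x, f (-x) = f x) {g : ℝ → ℝ}
    (hg : Integrable g (gaussianReal 0 1)) {c : ℝ} (hc0 : 0 ≤ c)
    (hc : c ≤ ∫ x, |g x| ∂gaussianReal 0 1) :
    f c ≤ ∫ x, f (g x) ∂gaussianReal 0 1 := by
  have h1 : f c ≤ f (∫ x, |g x| ∂gaussianReal 0 1) :=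
    hf.le_of_abs_le_of_even he (by rwa [abs_of_nonneg hc0, abs_of_nonneg (hc0.trans hc)])
  have h2 := hf.map_integral_le (μ := gaussianReal 0 1) (f := fun x => |g x|)
    hL.continuous.continuousOn isClosed_univ (by simp) hg.abs
    (hL.integrable_comp_of_integrable hg.abs)
  have h3 : ∀ x, f |g x| = f (g x) := by
    intro x
    rcases abs_choice (g x) with e | e <;> rw [e]
    exact he _
  simp only [h3] at h2
  exact h1.trans h2

/-- The rounded point is a convex combination of (1 + δ)x and a rescaled rounding error of modulus
at most (1 + δ)/2. Since E|(1 + δ)X| ≥ (1 + δ)/2, the value of f at the error is at most the mean on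
the right. -/
theorem integral_gridRound_le_of_even {f : ℝ → ℝ} {L : NNReal} (hf : ConvexOn ℝ univ f)
    (hL : LipschitzWith L f) (he : ∀ x, f (-x) = f x) {δ : ℝ} (hδ : 0 < δ) :
    ∫ x, f (gridRound δ x) ∂gaussianReal 0 1 ≤ ∫ x, f ((1 + δ) * x) ∂gaussianReal 0 1 := by
  have hi1 := hL.integrable_comp_of_integrable (integrable_gridRound hδ)
  have hi2 := hL.integrable_comp_of_integrable (integrable_id_gaussianReal.const_mul (1 + δ))
  have hpt : ∀ x, f (gridRound δ x) ≤
      (1 + δ)⁻¹ * f ((1 + δ) * x) + δ / (1 + δ) * f ((1 + δ) / 2) := by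
    intro x
    have h1 := hf.2 (mem_univ ((1 + δ) * x)) (mem_univ (-((1 + δ) / δ * (x - gridRound δ x))))
      (by positivity : 0 ≤ (1 + δ)⁻¹) (by positivity : 0 ≤ δ / (1 + δ)) (by field_simp)
    have e : (1 + δ)⁻¹ • ((1 + δ) * x) + (δ / (1 + δ)) • (-((1 + δ) / δ * (x - gridRound δ x))) =
        gridRound δ x := by
      simp only [smul_eq_mul]
      field_simp
      ring
    rw [e, he] at h1
    have h2 : f ((1 + δ) / δ * (x - gridRound δ x)) ≤ f ((1 + δ) / 2) := by
      apply hf.le_of_abs_le_of_even he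
      rw [abs_mul, abs_of_pos (by positivity : 0 < (1 + δ) / δ),
        abs_of_pos (by positivity : 0 < (1 + δ) / 2)]
      calc (1 + δ) / δ * |x - gridRound δ x| ≤ (1 + δ) / δ * (δ / 2) := by
            gcongr; exact abs_sub_gridRound_le hδ x
        _ = (1 + δ) / 2 := by field_simp
    simp only [smul_eq_mul] at h1
    have := mul_le_mul_of_nonneg_left h2 (by positivity : 0 ≤ δ / (1 + δ))
    linarith
  have h1 := integral_mono hi1 ((hi2.const_mul (1 + δ)⁻¹).add
    (integrable_const (δ / (1 + δ) * f ((1 + δ) / 2)))) hpt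
  rw [integral_add' (hi2.const_mul _) (integrable_const _), integral_const_mul] at h1
  simp only [integral_const, probReal_univ, one_smul] at h1
  have h2 : f ((1 + δ) / 2) ≤ ∫ x, f ((1 + δ) * x) ∂gaussianReal 0 1 := by
    apply integral_even_abs_gaussianReal_ge hf hL he (integrable_id_gaussianReal.const_mul _)
      (by positivity)
    simp only [abs_mul, abs_of_pos (by positivity : 0 < 1 + δ)]
    rw [integral_const_mul]
    nlinarith [half_le_integral_abs_gaussianReal]
  have h3 := mul_le_mul_of_nonneg_left h2 (by positivity : 0 ≤ δ / (1 + δ))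
  have e : ∀ I : ℝ, (1 + δ)⁻¹ * I + δ / (1 + δ) * I = I := by intro I; field_simp
  linarith [e (∫ x, f ((1 + δ) * x) ∂gaussianReal 0 1)]

/-- Here (1 - δ)x is a convex combination of the rounded point and a rescaled rounding error of
modulus at most (1 - δ)/2, and the rounded variable has mean modulus at least 1/2 - δ/2. -/
theorem integral_le_gridRound_of_even {f : ℝ → ℝ} {L : NNReal} (hf : ConvexOn ℝ univ f)
    (hL : LipschitzWith L f) (he : ∀ x, f (-x) = f x) {δ : ℝ} (hδ : 0 < δ) (hδ1 : δ < 1) :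
    ∫ x, f ((1 - δ) * x) ∂gaussianReal 0 1 ≤ ∫ x, f (gridRound δ x) ∂gaussianReal 0 1 := by
  have hi1 := hL.integrable_comp_of_integrable (integrable_gridRound hδ)
  have hi2 := hL.integrable_comp_of_integrable (integrable_id_gaussianReal.const_mul (1 - δ))
  have hδ' : 0 < 1 - δ := by linarith
  have hpt : ∀ x, f ((1 - δ) * x) ≤ (1 - δ) * f (gridRound δ x) + δ * f ((1 - δ) / 2) := by
    intro x
    have h1 := hf.2 (mem_univ (gridRound δ x)) (mem_univ ((1 - δ) / δ * (x - gridRound δ x)))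
      hδ'.le hδ.le (by ring)
    have e : (1 - δ) • gridRound δ x + δ • ((1 - δ) / δ * (x - gridRound δ x)) = (1 - δ) * x := by
      simp only [smul_eq_mul]
      field_simp
      ring
    rw [e] at h1
    have h2 : f ((1 - δ) / δ * (x - gridRound δ x)) ≤ f ((1 - δ) / 2) := by
      apply hf.le_of_abs_le_of_even he
      rw [abs_mul, abs_of_pos (by positivity : 0 < (1 - δ) / δ),
        abs_of_pos (by positivity : 0 < (1 - δ) / 2)]
      calc (1 - δ) / δ * |x - gridRound δ x| ≤ (1 - δ) / δ * (δ / 2) := by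
            gcongr; exact abs_sub_gridRound_le hδ x
        _ = (1 - δ) / 2 := by field_simp
    simp only [smul_eq_mul] at h1
    have := mul_le_mul_of_nonneg_left h2 hδ.le
    linarith
  have h1 := integral_mono hi2 ((hi1.const_mul (1 - δ)).add
    (integrable_const (δ * f ((1 - δ) / 2)))) hpt
  rw [integral_add' (hi1.const_mul _) (integrable_const _), integral_const_mul] at h1
  simp only [integral_const, probReal_univ, one_smul] at h1
  have h2 : f ((1 - δ) / 2) ≤ ∫ x, f (gridRound δ x) ∂gaussianReal 0 1 := by
    apply integral_even_abs_gaussianReal_ge hf hL he (integrable_gridRound hδ)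
      (by positivity)
    have hpt2 : ∀ x, |x| - δ / 2 ≤ |gridRound δ x| := by
      intro x
      have := abs_sub_gridRound_le hδ x
      have h2 := abs_sub_abs_le_abs_sub x (gridRound δ x)
      linarith
    have h4 := integral_mono (integrable_id_gaussianReal.abs.sub (integrable_const (δ / 2)))
      (integrable_gridRound hδ).abs hpt2
    rw [integral_sub' integrable_id_gaussianReal.abs (integrable_const _)] at h4
    simp only [integral_const, probReal_univ, one_smul] at h4
    linarith [half_le_integral_abs_gaussianReal]
  nlinarith

/-- Chebyshev's sum inequality with weights exp(-lz²): the density of the rounded law against them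
and f(δz) are both increasing in |z|. -/
theorem integral_discreteGaussian_le_of_even {f : ℝ → ℝ} {L : NNReal} (hf : ConvexOn ℝ univ f)
    (hL : LipschitzWith L f) (he : ∀ x, f (-x) = f x) {δ l : ℝ} (hδ : 0 < δ)
    (hl : δ ^ 2 / 2 ≤ l) :
    ∫ z : ℤ, f (δ * z) ∂discreteGaussian l ≤ ∫ x, f (gridRound δ x) ∂gaussianReal 0 1 := by
  have hl0 : 0 < l := lt_of_lt_of_le (by positivity) hl
  have := isProbabilityMeasure_discreteGaussian hl0
  have hp := thetaSum_pos hl0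
  have hg := hasSum_gridMass_mul (hL.integrable_comp_of_integrable (integrable_gridRound hδ))
  have hs := summable_exp_mul_of_integrable hl0
    (hL.integrable_comp_of_integrable ((integrable_cast_discreteGaussian hl0).const_mul δ))
  have hwG : ∀ z : ℤ, Real.exp (-(l * z ^ 2)) * (gridMass δ z * Real.exp (l * z ^ 2)) =
      gridMass δ z := by
    intro z
    rw [mul_left_comm, ← Real.exp_add, neg_add_cancel, Real.exp_zero, mul_one]
  have key := tsum_mul_tsum_le_of_monovary (w := fun z : ℤ => Real.exp (-(l * z ^ 2)))
    (G := fun z : ℤ => gridMass δ z * Real.exp (l * z ^ 2)) (f := fun z : ℤ => f (δ * z))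
    (fun _ => (Real.exp_pos _).le) ?_ (summable_exp_neg_mul_int_sq hl0)
    (by simpa only [hwG] using summable_gridMass δ) hs (by simpa only [hwG] using hg.summable)
  · simp only [hwG] at key
    rw [tsum_gridMass, one_mul, hg.tsum_eq] at key
    rw [integral_discreteGaussian hl0, div_le_iff₀ hp, mul_comm]
    exact key
  · intro y z
    have hfm : ∀ {y z : ℤ}, |y| ≤ |z| → f (δ * y) ≤ f (δ * z) := by
      intro y z h
      apply hf.le_of_abs_le_of_even he
      rw [abs_mul, abs_mul]
      have : |(y : ℝ)| ≤ |(z : ℝ)| := by exact_mod_cast h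
      gcongr
    rcases le_total |y| |z| with h | h
    · exact mul_nonneg_of_nonpos_of_nonpos (by linarith [gridMass_ratio_mono hδ hl h])
        (by linarith [hfm h])
    · exact mul_nonneg (by linarith [gridMass_ratio_mono hδ hl h]) (by linarith [hfm h])

theorem integral_gridRound_le_discreteGaussian_of_even {f : ℝ → ℝ} {L : NNReal}
    (hf : ConvexOn ℝ univ f) (hL : LipschitzWith L f) (he : ∀ x, f (-x) = f x) {δ l : ℝ}
    (hδ : 0 < δ) (hl0 : 0 < l) (hl : l ≤ δ ^ 2 / 2 - δ ^ 4 / 8) :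
    ∫ x, f (gridRound δ x) ∂gaussianReal 0 1 ≤ ∫ z : ℤ, f (δ * z) ∂discreteGaussian l := by
  have := isProbabilityMeasure_discreteGaussian hl0
  have hp := thetaSum_pos hl0
  have hg := hasSum_gridMass_mul (hL.integrable_comp_of_integrable (integrable_gridRound hδ))
  have hs := summable_exp_mul_of_integrable hl0
    (hL.integrable_comp_of_integrable ((integrable_cast_discreteGaussian hl0).const_mul δ))
  have hwG : ∀ z : ℤ, Real.exp (-(l * z ^ 2)) * (-(gridMass δ z * Real.exp (l * z ^ 2))) =
      -gridMass δ z := by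
    intro z
    rw [mul_neg, mul_left_comm, ← Real.exp_add, neg_add_cancel, Real.exp_zero, mul_one]
  have key := tsum_mul_tsum_le_of_monovary (w := fun z : ℤ => Real.exp (-(l * z ^ 2)))
    (G := fun z : ℤ => -(gridMass δ z * Real.exp (l * z ^ 2))) (f := fun z : ℤ => f (δ * z))
    (fun _ => (Real.exp_pos _).le) ?_ (summable_exp_neg_mul_int_sq hl0)
    (by simpa only [hwG] using (summable_gridMass δ).neg) hs
    (by simpa only [hwG, neg_mul] using hg.summable.neg)
  · simp only [hwG, neg_mul, tsum_neg] at key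
    rw [tsum_gridMass, hg.tsum_eq] at key
    rw [integral_discreteGaussian hl0, le_div_iff₀ hp, mul_comm]
    unfold thetaSum
    linarith
  · intro y z
    have hfm : ∀ {y z : ℤ}, |y| ≤ |z| → f (δ * y) ≤ f (δ * z) := by
      intro y z h
      apply hf.le_of_abs_le_of_even he
      rw [abs_mul, abs_mul]
      have : |(y : ℝ)| ≤ |(z : ℝ)| := by exact_mod_cast h
      gcongr
    rcases le_total |y| |z| with h | h
    · exact mul_nonneg_of_nonpos_of_nonpos (by linarith [gridMass_ratio_anti hδ hl h])
        (by linarith [hfm h])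
    · exact mul_nonneg (by linarith [gridMass_ratio_anti hδ hl h]) (by linarith [hfm h])

/-! ### Reduction of convex functions to even convex functions -/

section Symmetrization

variable {f : ℝ → ℝ} {L : NNReal}

theorem ConvexOn.symmetrize (hf : ConvexOn ℝ univ f) :
    ConvexOn ℝ univ fun x => 1 / 2 * (f x + f (-x)) := by
  have h2 : ConvexOn ℝ univ fun x => f (-x) := by
    refine ⟨convex_univ, fun x _ y _ a b ha hb hab => ?_⟩
    have := hf.2 (mem_univ (-x)) (mem_univ (-y)) ha hb hab
    convert this using 2
    simp only [smul_eq_mul]; ring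
  exact (hf.add h2).smul (by norm_num)

theorem LipschitzWith.symmetrize (hL : LipschitzWith L f) :
    LipschitzWith L fun x => 1 / 2 * (f x + f (-x)) := by
  refine LipschitzWith.of_dist_le_mul fun x y => ?_
  have h1 := hL.dist_le_mul x y
  have h2 := hL.dist_le_mul (-x) (-y)
  rw [dist_neg_neg] at h2
  rw [Real.dist_eq] at h1 h2 ⊢
  have : 1 / 2 * (f x + f (-x)) - 1 / 2 * (f y + f (-y)) =
      1 / 2 * ((f x - f y) + (f (-x) - f (-y))) := by ring
  rw [this, abs_mul, abs_of_pos (by norm_num : (0:ℝ) < 1 / 2)]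
  linarith [abs_add_le (f x - f y) (f (-x) - f (-y))]

theorem integral_symmetrize_gaussianReal (hL : LipschitzWith L f) (c : ℝ) :
    ∫ x, 1 / 2 * (f (c * x) + f (-(c * x))) ∂gaussianReal 0 1 =
      ∫ x, f (c * x) ∂gaussianReal 0 1 := by
  have hi := hL.integrable_comp_of_integrable (integrable_id_gaussianReal.const_mul c)
  have hi' := hL.integrable_comp_of_integrable (integrable_id_gaussianReal.const_mul c).neg
  have e : ∫ x, f (c * x) ∂gaussianReal 0 1 = ∫ x, f (-(c * x)) ∂gaussianReal 0 1 := by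
    have hm : (gaussianReal 0 1).map (fun x => -x) = gaussianReal 0 1 := by
      rw [gaussianReal_map_neg, neg_zero]
    conv_lhs => rw [← hm]
    have hc : Continuous fun x => f (c * x) := hL.continuous.comp (continuous_const_mul c)
    rw [integral_map (by fun_prop) hc.aestronglyMeasurable]
    simp
  rw [integral_const_mul, integral_add hi (by simpa using hi'), ← e]
  ring

theorem integral_symmetrize_discreteGaussian (hL : LipschitzWith L f) {l : ℝ} (hl : 0 < l)
    (δ : ℝ) : ∫ z : ℤ, 1 / 2 * (f (δ * z) + f (-(δ * z))) ∂discreteGaussian l =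
      ∫ z : ℤ, f (δ * z) ∂discreteGaussian l := by
  have := isProbabilityMeasure_discreteGaussian hl
  have hi := hL.integrable_comp_of_integrable ((integrable_cast_discreteGaussian hl).const_mul δ)
  have hi' := hL.integrable_comp_of_integrable
    ((integrable_cast_discreteGaussian hl).const_mul δ).neg
  have e : ∫ z : ℤ, f (δ * z) ∂discreteGaussian l = ∫ z : ℤ, f (-(δ * z)) ∂discreteGaussian l := by
    rw [integral_discreteGaussian hl, integral_discreteGaussian hl]
    congr 1
    rw [← (Equiv.neg ℤ).tsum_eq]
    simp
  rw [integral_const_mul, integral_add hi (by simpa using hi'), ← e]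
  ring

/-- Both laws are symmetric, so f may be replaced by its even part; the rounded Gaussian variable
then links the two sides. -/
theorem integral_discreteGaussian_le (hf : ConvexOn ℝ univ f) (hL : LipschitzWith L f) {δ l : ℝ}
    (hδ : 0 < δ) (hl : δ ^ 2 / 2 ≤ l) :
    ∫ z : ℤ, f (δ * z) ∂discreteGaussian l ≤ ∫ x, f ((1 + δ) * x) ∂gaussianReal 0 1 := by
  have hl0 : 0 < l := lt_of_lt_of_le (by positivity) hl
  have he : ∀ x, 1 / 2 * (f (-x) + f (- -x)) = 1 / 2 * (f x + f (-x)) := by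
    intro x; rw [neg_neg]; ring
  rw [← integral_symmetrize_discreteGaussian hL hl0, ← integral_symmetrize_gaussianReal hL]
  exact (integral_discreteGaussian_le_of_even hf.symmetrize hL.symmetrize he hδ hl).trans
    (integral_gridRound_le_of_even hf.symmetrize hL.symmetrize he hδ)

theorem integral_le_discreteGaussian (hf : ConvexOn ℝ univ f) (hL : LipschitzWith L f) {δ l : ℝ}
    (hδ : 0 < δ) (hδ1 : δ < 1) (hl0 : 0 < l) (hl : l ≤ δ ^ 2 / 2 - δ ^ 4 / 8) :
    ∫ x, f ((1 - δ) * x) ∂gaussianReal 0 1 ≤ ∫ z : ℤ, f (δ * z) ∂discreteGaussian l := by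
  have he : ∀ x, 1 / 2 * (f (-x) + f (- -x)) = 1 / 2 * (f x + f (-x)) := by
    intro x; rw [neg_neg]; ring
  rw [← integral_symmetrize_discreteGaussian hL hl0, ← integral_symmetrize_gaussianReal hL]
  exact (integral_le_gridRound_of_even hf.symmetrize hL.symmetrize he hδ hδ1).trans
    (integral_gridRound_le_discreteGaussian_of_even hf.symmetrize hL.symmetrize he hδ hl0 hl)

end Symmetrization

/-! ### Tensorization of the convex order -/

section Tensor

variable {k : ℕ} {ψ : (Fin (k + 1) → ℝ) → ℝ} {L : NNReal}

theorem dist_cons_cons_le (s t : ℝ) (x y : Fin k → ℝ) :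
    dist (Fin.cons s x : Fin (k + 1) → ℝ) (Fin.cons t y) ≤ max (dist s t) (dist x y) := by
  rw [dist_pi_le_iff (le_max_of_le_left dist_nonneg)]
  intro i
  refine Fin.cases ?_ (fun j => ?_) i
  · simp
  · simpa using Or.inr (dist_le_pi_dist x y j)

theorem LipschitzWith.comp_cons_right (hL : LipschitzWith L ψ) (t : ℝ) :
    LipschitzWith L fun x : Fin k → ℝ => ψ (Fin.cons t x) := by
  refine LipschitzWith.of_dist_le_mul fun x y => (hL.dist_le_mul _ _).trans ?_
  have := dist_cons_cons_le t t x y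
  rw [dist_self, max_eq_right dist_nonneg] at this
  gcongr

theorem LipschitzWith.comp_cons_left (hL : LipschitzWith L ψ) (x : Fin k → ℝ) :
    LipschitzWith L fun t : ℝ => ψ (Fin.cons t x) := by
  refine LipschitzWith.of_dist_le_mul fun s t => (hL.dist_le_mul _ _).trans ?_
  have := dist_cons_cons_le s t x x
  rw [dist_self, max_eq_left dist_nonneg] at this
  gcongr

theorem smul_cons_add_smul_cons (p q s t : ℝ) (x y : Fin k → ℝ) :
    p • (Fin.cons s x : Fin (k + 1) → ℝ) + q • (Fin.cons t y : Fin (k + 1) → ℝ) =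
      Fin.cons (p • s + q • t) (p • x + q • y) := by
  ext i
  refine Fin.cases ?_ (fun j => ?_) i <;> simp

theorem ConvexOn.comp_cons_right (hψ : ConvexOn ℝ univ ψ) (t : ℝ) :
    ConvexOn ℝ univ fun x : Fin k → ℝ => ψ (Fin.cons t x) := by
  refine ⟨convex_univ, fun x _ y _ p q hp hq hpq => ?_⟩
  have := hψ.2 (mem_univ (Fin.cons t x : Fin (k + 1) → ℝ)) (mem_univ (Fin.cons t y)) hp hq hpq
  rwa [smul_cons_add_smul_cons, Convex.combo_self hpq] at this

theorem ConvexOn.comp_cons_left (hψ : ConvexOn ℝ univ ψ) (x : Fin k → ℝ) :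
    ConvexOn ℝ univ fun t : ℝ => ψ (Fin.cons t x) := by
  refine ⟨convex_univ, fun s _ t _ p q hp hq hpq => ?_⟩
  have := hψ.2 (mem_univ (Fin.cons s x : Fin (k + 1) → ℝ)) (mem_univ (Fin.cons t x)) hp hq hpq
  rwa [smul_cons_add_smul_cons, Convex.combo_self hpq] at this

variable {α : Type*} [MeasurableSpace α] {μ : Measure α} [IsProbabilityMeasure μ] {a : α → ℝ}

theorem integrable_pi_map {k : ℕ} (ha : Integrable a μ) :
    Integrable (fun x : Fin k → α => fun i => a (x i)) (Measure.pi fun _ => μ) :=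
  Integrable.of_eval fun _ => integrable_comp_eval ha

theorem LipschitzWith.integral_cons (hL : LipschitzWith L ψ) (ha : Integrable a μ) :
    LipschitzWith L fun x : Fin k → ℝ => ∫ t, ψ (Fin.cons (a t) x) ∂μ := by
  refine LipschitzWith.of_dist_le_mul fun x y => ?_
  rw [dist_eq_norm, ← integral_sub ((hL.comp_cons_left x).integrable_comp_of_integrable ha)
    ((hL.comp_cons_left y).integrable_comp_of_integrable ha)]
  refine (norm_integral_le_of_norm_le_const (C := L * dist x y)
    (Filter.Eventually.of_forall fun t => ?_)).trans (by simp)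
  rw [← dist_eq_norm]
  exact (hL.comp_cons_right (a t)).dist_le_mul x y

theorem ConvexOn.integral_cons (hψ : ConvexOn ℝ univ ψ) (hL : LipschitzWith L ψ)
    (ha : Integrable a μ) :
    ConvexOn ℝ univ fun x : Fin k → ℝ => ∫ t, ψ (Fin.cons (a t) x) ∂μ := by
  refine ⟨convex_univ, fun x _ y _ p q hp hq hpq => ?_⟩
  have hi := fun x => (hL.comp_cons_left x).integrable_comp_of_integrable ha
  simp only [smul_eq_mul]
  rw [← integral_const_mul, ← integral_const_mul,
    ← integral_add ((hi x).const_mul p) ((hi y).const_mul q)]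
  exact integral_mono (hi _) (((hi x).const_mul p).add ((hi y).const_mul q)) fun t =>
    (hψ.comp_cons_right (a t)).2 (mem_univ x) (mem_univ y) hp hq hpq

theorem integral_pi_succ_map (hL : LipschitzWith L ψ) (ha : Integrable a μ) :
    ∫ x : Fin (k + 1) → α, ψ (fun i => a (x i)) ∂(Measure.pi fun _ => μ) =
      ∫ y : Fin k → α, ∫ t, ψ (Fin.cons (a t) fun i => a (y i)) ∂μ ∂(Measure.pi fun _ => μ) := by
  have hmp := (measurePreserving_piFinSuccAbove (fun _ : Fin (k + 1) => μ) 0).symm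
  have hi := hL.integrable_comp_of_integrable (integrable_pi_map (k := k + 1) ha)
  have e : ∀ p : α × (Fin k → α),
      ψ (fun i => a ((MeasurableEquiv.piFinSuccAbove (fun _ => α) 0).symm p i)) =
        ψ (Fin.cons (a p.1) fun i => a (p.2 i)) := by
    intro p
    congr 1
    ext i
    refine Fin.cases ?_ (fun j => ?_) i <;> simp [MeasurableEquiv.piFinSuccAbove]
  rw [← hmp.integral_comp' (g := fun x : Fin (k + 1) → α => ψ fun i => a (x i))]
  have hi2 := (hmp.integrable_comp_emb
    (MeasurableEquiv.piFinSuccAbove (fun _ => α) 0).symm.measurableEmbedding).2 hi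
  simp only [Function.comp_def, e] at hi2 ⊢
  exact integral_prod_symm _ hi2

end Tensor

/-- Integrating out one coordinate against μ leaves a convex Lipschitz function of the others, so
the induction hypothesis replaces those by ν; the one-dimensional comparison, for each fixed value
of the others, then replaces the remaining coordinate. The Lipschitz condition supplies every
integrability needed. -/
theorem integral_pi_le_of_convexOrder {α β : Type*} [MeasurableSpace α] [MeasurableSpace β]
    {μ : Measure α} {ν : Measure β} [IsProbabilityMeasure μ] [IsProbabilityMeasure ν]
    {a : α → ℝ} {b : β → ℝ} (ha : Integrable a μ) (hb : Integrable b ν)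
    (h : ∀ (f : ℝ → ℝ) (L : NNReal), ConvexOn ℝ univ f → LipschitzWith L f →
      ∫ x, f (a x) ∂μ ≤ ∫ y, f (b y) ∂ν) (k : ℕ) {ψ : (Fin k → ℝ) → ℝ} {L : NNReal}
    (hψ : ConvexOn ℝ univ ψ) (hL : LipschitzWith L ψ) :
    ∫ x, ψ (fun i => a (x i)) ∂(Measure.pi fun _ => μ) ≤
      ∫ y, ψ (fun i => b (y i)) ∂(Measure.pi fun _ => ν) := by
  induction k with
  | zero =>
    have e1 : ∀ x : Fin 0 → α, (fun i => a (x i)) = (0 : Fin 0 → ℝ) :=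
      fun x => Subsingleton.elim _ _
    have e2 : ∀ x : Fin 0 → β, (fun i => b (x i)) = (0 : Fin 0 → ℝ) :=
      fun x => Subsingleton.elim _ _
    simp [e1, e2]
  | succ k ih =>
    rw [integral_pi_succ_map hL ha, integral_pi_succ_map hL hb]
    refine (ih (hψ.integral_cons hL ha) (hL.integral_cons ha)).trans ?_
    exact integral_mono
      ((hL.integral_cons ha).integrable_comp_of_integrable (integrable_pi_map hb))
      ((hL.integral_cons hb).integrable_comp_of_integrable (integrable_pi_map hb))
      fun y => h _ _ (hψ.comp_cons_left _) (hL.comp_cons_left _)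

/-! ### Semi-norms under the continuous and the discrete Gaussian measures -/

theorem Seminorm.exists_lipschitzWith {k : ℕ} (φ : Seminorm ℝ (Fin k → ℝ)) :
    ∃ L : NNReal, LipschitzWith L φ := by
  have h0 : 0 ≤ ∑ i, φ (Pi.single i 1) := Finset.sum_nonneg fun i _ => apply_nonneg φ _
  refine ⟨(∑ i, φ (Pi.single i 1)).toNNReal, LipschitzWith.of_dist_le_mul fun x y => ?_⟩
  have h1 : φ (x - y) ≤ ∑ i, φ (Pi.single i 1) * dist x y := by
    have e : x - y = ∑ i, (x - y) i • (Pi.single i 1 : Fin k → ℝ) := by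
      ext j
      simp [Finset.sum_apply, Pi.single_apply]
    calc φ (x - y) = φ (∑ i, (x - y) i • (Pi.single i 1 : Fin k → ℝ)) := by rw [← e]
      _ ≤ ∑ i, φ ((x - y) i • (Pi.single i 1 : Fin k → ℝ)) := 
          Finset.le_sum_of_subadditive φ (map_zero φ).le (map_add_le_add φ) _ _
      _ ≤ _ := by
        refine Finset.sum_le_sum fun i _ => ?_
        rw [map_smul_eq_mul, mul_comm, dist_eq_norm]
        gcongr
        exact norm_le_pi_norm (x - y) i
  rw [← Finset.sum_mul] at h1
  rw [Real.dist_eq, abs_sub_le_iff, Real.coe_toNNReal _ h0]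
  have h2 := map_sub_rev φ x y
  constructor
  · have : φ x ≤ φ (x - y) + φ y := by simpa using map_add_le_add φ (x - y) y
    linarith
  · have : φ y ≤ φ (y - x) + φ x := by simpa using map_add_le_add φ (y - x) x
    linarith

theorem integrable_seminorm_stdNormal {k : ℕ} (φ : Seminorm ℝ (Fin k → ℝ)) :
    Integrable (fun x => φ x) (stdNormal k) := by
  obtain ⟨L, hL⟩ := φ.exists_lipschitzWith
  rw [stdNormal]
  exact hL.integrable_comp_of_integrable (integrable_pi_map integrable_id_gaussianReal)

theorem integral_seminorm_mul_stdNormal {k : ℕ} (φ : Seminorm ℝ (Fin k → ℝ)) {c : ℝ}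
    (hc : 0 ≤ c) : ∫ x, φ (fun i => c * x i) ∂stdNormal k = c * ∫ x, φ x ∂stdNormal k := by
  rw [← integral_const_mul]
  congr 1 with x
  have : (fun i => c * x i) = c • x := rfl
  rw [this, map_smul_eq_mul, Real.norm_of_nonneg hc]

theorem integral_seminorm_mul_pi {k : ℕ} (φ : Seminorm ℝ (Fin k → ℝ))
    {μ : Measure ℤ} {c d : ℝ} (hc : 0 ≤ c) :
    ∫ z : Fin k → ℤ, φ (fun i => c * d * z i) ∂(Measure.pi fun _ => μ) =
      c * ∫ z : Fin k → ℤ, φ (fun i => d * z i) ∂(Measure.pi fun _ => μ) := by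
  rw [← integral_const_mul]
  congr 1 with z
  have : (fun i => c * d * (z i : ℝ)) = c • fun i => d * (z i : ℝ) := by ext i; simp [mul_assoc]
  rw [this, map_smul_eq_mul, Real.norm_of_nonneg hc]

/-- Homogeneity turns the dilation in the convex order into a factor that does not depend on the
dimension. -/
theorem integral_seminorm_discreteGaussian_le {k : ℕ} (φ : Seminorm ℝ (Fin k → ℝ)) {δ l : ℝ}
    (hδ : 0 < δ) (hl : δ ^ 2 / 2 ≤ l) :
    ∫ z : Fin k → ℤ, φ (fun i => δ * z i) ∂(Measure.pi fun _ => discreteGaussian l) ≤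
      (1 + δ) * ∫ x, φ x ∂stdNormal k := by
  have hl0 : 0 < l := lt_of_lt_of_le (by positivity) hl
  have := isProbabilityMeasure_discreteGaussian hl0
  obtain ⟨L, hL⟩ := φ.exists_lipschitzWith
  rw [← integral_seminorm_mul_stdNormal φ (by positivity)]
  exact integral_pi_le_of_convexOrder (a := fun z : ℤ => δ * z) (b := fun x : ℝ => (1 + δ) * x)
    ((integrable_cast_discreteGaussian hl0).const_mul δ) (integrable_id_gaussianReal.const_mul _)
    (fun f L hf hL => integral_discreteGaussian_le hf hL hδ hl) k φ.convexOn hL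

theorem le_integral_seminorm_discreteGaussian {k : ℕ} (φ : Seminorm ℝ (Fin k → ℝ)) {δ l : ℝ}
    (hδ : 0 < δ) (hδ1 : δ < 1) (hl0 : 0 < l) (hl : l ≤ δ ^ 2 / 2 - δ ^ 4 / 8) :
    (1 - δ) * ∫ x, φ x ∂stdNormal k ≤
      ∫ z : Fin k → ℤ, φ (fun i => δ * z i) ∂(Measure.pi fun _ => discreteGaussian l) := by
  have := isProbabilityMeasure_discreteGaussian hl0
  obtain ⟨L, hL⟩ := φ.exists_lipschitzWith
  rw [← integral_seminorm_mul_stdNormal φ (by linarith)]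
  exact integral_pi_le_of_convexOrder (a := fun x : ℝ => (1 - δ) * x) (b := fun z : ℤ => δ * z)
    (integrable_id_gaussianReal.const_mul _) ((integrable_cast_discreteGaussian hl0).const_mul δ)
    (fun f L hf hL => integral_le_discreteGaussian hf hL hδ hδ1 hl0 hl) k φ.convexOn hL

/-! ### Truncation of the lattice sum to a ball -/

section Truncation

variable {k : ℕ}

theorem hasSum_pi_discreteGaussian {l : ℝ} (hl : 0 < l) {g : (Fin k → ℤ) → ℝ}
    (hg : Integrable g (Measure.pi fun _ => discreteGaussian l)) :
    HasSum (fun z : Fin k → ℤ => Real.exp (-(l * ∑ i, (z i : ℝ) ^ 2)) * g z)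
      (thetaSum l ^ k * ∫ z, g z ∂(Measure.pi fun _ => discreteGaussian l)) := by
  have := isProbabilityMeasure_discreteGaussian hl
  have hp := thetaSum_pos hl
  rw [← Measure.sum_smul_dirac (Measure.pi _)] at hg
  have h := (hasSum_integral_measure hg).mul_left (thetaSum l ^ k)
  rw [Measure.sum_smul_dirac] at h
  refine h.congr_fun fun z => ?_
  rw [integral_smul_measure, integral_dirac, Measure.pi_singleton, smul_eq_mul, ENNReal.toReal_prod]
  simp only [discreteGaussian_singleton]
  rw [Finset.prod_congr rfl fun i _ => ENNReal.toReal_ofReal (by positivity),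
    Finset.prod_div_distrib, ← Real.exp_sum, Finset.mul_sum, Finset.sum_neg_distrib]
  simp only [Finset.prod_const, Finset.card_univ, Fintype.card_fin]
  field_simp

/-- Three quarters of the exponent give the small factor off S; the last quarter is kept as a wider
discrete Gaussian, under which g still has a controlled mean. -/
theorem tail_pi_discreteGaussian_le {l N : ℝ} (hl : 0 < l) {g : (Fin k → ℤ) → ℝ}
    (hg0 : ∀ z, 0 ≤ g z)
    (hg : Integrable g (Measure.pi fun _ => discreteGaussian l))
    (hg4 : Integrable g (Measure.pi fun _ => discreteGaussian (l / 4)))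
    {S : Finset (Fin k → ℤ)} (hS : ∀ z, z ∉ S → N ≤ ∑ i, (z i : ℝ) ^ 2) :
    thetaSum l ^ k * ∫ z, g z ∂(Measure.pi fun _ => discreteGaussian l) -
      ∑ z ∈ S, Real.exp (-(l * ∑ i, (z i : ℝ) ^ 2)) * g z ≤
    Real.exp (-(3 * l * N / 4)) * (thetaSum (l / 4) ^ k *
      ∫ z, g z ∂(Measure.pi fun _ => discreteGaussian (l / 4))) := by
  classical
  have h1 := hasSum_pi_discreteGaussian hl hg
  have h4 := (hasSum_pi_discreteGaussian (by positivity : 0 < l / 4) hg4).mul_left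
    (Real.exp (-(3 * l * N / 4)))
  have h2 : HasSum (fun z : Fin k → ℤ =>
      if z ∈ S then Real.exp (-(l * ∑ i, (z i : ℝ) ^ 2)) * g z else 0)
      (∑ z ∈ S, Real.exp (-(l * ∑ i, (z i : ℝ) ^ 2)) * g z) := by
    rw [← Finset.sum_congr rfl fun z hz => if_pos hz]
    exact hasSum_sum_of_ne_finset_zero fun z hz => if_neg hz
  refine hasSum_le (fun z => ?_) (h1.sub h2) h4
  by_cases hz : z ∈ S
  · rw [if_pos hz, sub_self]
    have := hg0 z
    positivity
  · rw [if_neg hz, sub_zero, ← mul_assoc, ← Real.exp_add]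
    apply mul_le_mul_of_nonneg_right _ (hg0 z)
    apply Real.exp_le_exp.2
    have := hS z hz
    nlinarith

theorem sum_le_pi_discreteGaussian {l : ℝ} (hl : 0 < l) {g : (Fin k → ℤ) → ℝ}
    (hg0 : ∀ z, 0 ≤ g z) (hg : Integrable g (Measure.pi fun _ => discreteGaussian l))
    (S : Finset (Fin k → ℤ)) :
    ∑ z ∈ S, Real.exp (-(l * ∑ i, (z i : ℝ) ^ 2)) * g z ≤
      thetaSum l ^ k * ∫ z, g z ∂(Measure.pi fun _ => discreteGaussian l) :=
  sum_le_hasSum S (fun z _ => mul_nonneg (Real.exp_pos _).le (hg0 z))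
    (hasSum_pi_discreteGaussian hl hg)

theorem exp_mul_three_pow_le {n k : ℕ} (hn : 0 < n) (hk : 0 < k) {x : ℝ}
    (hx : 96 * (n : ℝ) * k ≤ x) : Real.exp (-x) * 3 ^ k ≤ 1 / (64 * n) := by
  have hn1 : (1 : ℝ) ≤ n := by exact_mod_cast hn
  have hk1 : (1 : ℝ) ≤ k := by exact_mod_cast hk
  have h3 : (3 : ℝ) ^ k ≤ Real.exp (2 * k) := by
    rw [mul_comm, Real.exp_nat_mul]
    have := Real.add_one_le_exp (2 : ℝ)
    gcongr
    linarith
  calc Real.exp (-x) * 3 ^ k ≤ Real.exp (-x) * Real.exp (2 * k) := by gcongr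
    _ = Real.exp (-x + 2 * k) := (Real.exp_add _ _).symm
    _ ≤ Real.exp (-(64 * n)) := by
      apply Real.exp_le_exp.2
      nlinarith
    _ = (Real.exp (64 * n))⁻¹ := Real.exp_neg _
    _ ≤ 1 / (64 * n) := by
      rw [one_div]
      apply inv_anti₀ (by positivity)
      linarith [Real.add_one_le_exp (64 * (n : ℝ))]

/-- One l must serve both comparisons, which is impossible at the same mesh. It exceeds δ²/2 only by
O(δ⁴), while passing to the mesh δ(1 + δ) raises the upper limit by order δ³. -/
theorem neg_log_one_sub_bounds {δ : ℝ} (hδ : 0 < δ) (hδ1 : δ ≤ 1 / 64) :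
    δ ^ 2 / 2 ≤ -Real.log (1 - δ ^ 2 / 2) ∧
      -Real.log (1 - δ ^ 2 / 2) ≤ (δ * (1 + δ)) ^ 2 / 2 - (δ * (1 + δ)) ^ 4 / 8 := by
  have hpos : 0 < 1 - δ ^ 2 / 2 := by nlinarith
  constructor
  · linarith [Real.log_le_sub_one_of_pos hpos]
  · have h1 := Real.one_sub_inv_le_log_of_pos hpos
    have h2 : (1 - δ ^ 2 / 2)⁻¹ ≤ 1 + (δ ^ 2 / 2) * (1 + 2 * δ) := by
      rw [inv_le_iff_one_le_mul₀ hpos]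
      nlinarith [mul_pos hδ hδ, mul_pos (mul_pos hδ hδ) hδ, mul_pos (mul_pos hδ hδ) (mul_pos hδ hδ)]
    have h3 : (1 + δ) ^ 4 ≤ 4 := by
      have : 1 + δ ≤ 65 / 64 := by linarith
      calc (1 + δ) ^ 4 ≤ (65 / 64 : ℝ) ^ 4 := by gcongr
        _ ≤ 4 := by norm_num
    have h4 : (δ * (1 + δ)) ^ 4 ≤ δ ^ 4 * 4 := by rw [mul_pow]; gcongr
    nlinarith [mul_pos hδ hδ, mul_pos (mul_pos hδ hδ) hδ, mul_pos (mul_pos hδ hδ) (mul_pos hδ hδ)]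

theorem truncated_lattice_sum_bounds {n : ℕ} (hn : 0 < n) (hk : 0 < k)
    (φ : Seminorm ℝ (Fin k → ℝ)) {δ l N : ℝ} (hδ : δ = 1 / (64 * n))
    (hl : l = -Real.log (1 - δ ^ 2 / 2)) (hN : N * δ ^ 2 = 256 * n * k)
    {S : Finset (Fin k → ℤ)} (hS : ∀ z, z ∉ S → N ≤ ∑ i, (z i : ℝ) ^ 2) :
    (1 - 1 / (4 * n)) * (∫ x, φ x ∂stdNormal k) *
        (∑ z ∈ S, Real.exp (-(l * ∑ i, (z i : ℝ) ^ 2))) ≤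
      ∑ z ∈ S, Real.exp (-(l * ∑ i, (z i : ℝ) ^ 2)) * φ (fun i => δ * z i) ∧
    ∑ z ∈ S, Real.exp (-(l * ∑ i, (z i : ℝ) ^ 2)) * φ (fun i => δ * z i) ≤
      (1 + 1 / (4 * n)) * (∫ x, φ x ∂stdNormal k) *
        (∑ z ∈ S, Real.exp (-(l * ∑ i, (z i : ℝ) ^ 2))) := by
  have hn1 : (1 : ℝ) ≤ n := by exact_mod_cast hn
  have hτ : 1 / (4 * (n : ℝ)) = 16 * δ := by rw [hδ]; field_simp; norm_num
  have hδ0 : 0 < δ := by rw [hδ]; positivity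
  have hδ1 : δ ≤ 1 / 64 := by
    rw [hδ]
    apply one_div_le_one_div_of_le <;> linarith
  obtain ⟨hl1, hl2⟩ := neg_log_one_sub_bounds hδ0 hδ1
  rw [← hl] at hl1 hl2
  have hl0 : 0 < l := lt_of_lt_of_le (by positivity) hl1
  have hl4 : 0 < l / 4 := by positivity
  have := isProbabilityMeasure_discreteGaussian hl0
  have := isProbabilityMeasure_discreteGaussian hl4
  have hp := thetaSum_pos hl0
  have hp4 := thetaSum_pos hl4
  obtain ⟨L, hL⟩ := φ.exists_lipschitzWith
  have hint : ∀ {l' : ℝ}, 0 < l' → Integrable (fun z : Fin k → ℤ => φ fun i => δ * z i)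
      (Measure.pi fun _ => discreteGaussian l') := by
    intro l' hl'
    have := isProbabilityMeasure_discreteGaussian hl'
    exact hL.integrable_comp_of_integrable
      (integrable_pi_map ((integrable_cast_discreteGaussian hl').const_mul δ))
  have hφ0 : ∀ z : Fin k → ℤ, 0 ≤ φ fun i => δ * z i := fun z => apply_nonneg φ _
  set E := ∫ x, φ x ∂stdNormal k with hE
  have hE0 : 0 ≤ E := integral_nonneg fun x => apply_nonneg φ x
  set I := ∫ z : Fin k → ℤ, φ (fun i => δ * z i) ∂(Measure.pi fun _ => discreteGaussian l) with hI
  set J := ∫ z : Fin k → ℤ, φ (fun i => δ * z i) ∂(Measure.pi fun _ => discreteGaussian (l / 4))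
    with hJ
  have hIup : I ≤ (1 + δ) * E := integral_seminorm_discreteGaussian_le φ hδ0 hl1
  have hIlow : (1 - 3 * δ) * E ≤ I := by
    -- The lower comparison holds at the coarser mesh δ(1 + δ); homogeneity converts the change of
    -- mesh into the factor 1 + δ.
    have h := le_integral_seminorm_discreteGaussian φ (δ := δ * (1 + δ)) (by positivity)
      (by nlinarith) hl0 hl2
    rw [mul_comm δ, integral_seminorm_mul_pi φ (by positivity), ← hI, ← hE] at h
    have h2 : (1 - 3 * δ) * (1 + δ) * E ≤ (1 - (1 + δ) * δ) * E := by
      apply mul_le_mul_of_nonneg_right _ hE0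
      nlinarith
    have h3 : 0 ≤ (1 + δ) * (I - (1 - 3 * δ) * E) := by linarith
    have := nonneg_of_mul_nonneg_right h3 (by positivity)
    linarith
  -- The parameter l/4 is admissible for the mesh δ/2, because (δ/2)²/2 ≤ l/4. Returning to the mesh
  -- δ doubles the semi-norm.
  have hJup : J ≤ 4 * E := by
    have h := integral_seminorm_discreteGaussian_le φ (δ := δ / 2) (l := l / 4) (by positivity)
      (by nlinarith)
    have e : J = 2 * ∫ z : Fin k → ℤ, φ (fun i => δ / 2 * z i)
        ∂(Measure.pi fun _ => discreteGaussian (l / 4)) := by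
      rw [← integral_seminorm_mul_pi φ (by norm_num)]
      simp only [mul_div_cancel₀ δ (two_ne_zero : (2 : ℝ) ≠ 0), hJ]
    rw [e]
    nlinarith
  -- From l ≥ δ²/2 and Nδ² = 256nk follows 3lN/4 ≥ 96nk, which beats 3^k and leaves at most 1/(64n)
  -- = δ.
  have hη : Real.exp (-(3 * l * N / 4)) * thetaSum (l / 4) ^ k ≤ δ * thetaSum l ^ k := by
    have h1 : thetaSum (l / 4) ^ k ≤ 3 ^ k * thetaSum l ^ k := by
      rw [← mul_pow]
      exact pow_le_pow_left₀ hp4.le (thetaSum_div_four_le hl0) k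
    have h2 : 96 * (n : ℝ) * k ≤ 3 * l * N / 4 := by
      have hN0 : 0 ≤ N := by
        have h : 0 ≤ N * δ ^ 2 := by rw [hN]; positivity
        exact nonneg_of_mul_nonneg_left h (by positivity)
      nlinarith [mul_le_mul_of_nonneg_left hl1 hN0]
    have h3 := exp_mul_three_pow_le hn hk h2
    rw [← hδ] at h3
    calc Real.exp (-(3 * l * N / 4)) * thetaSum (l / 4) ^ k ≤
        Real.exp (-(3 * l * N / 4)) * (3 ^ k * thetaSum l ^ k) := by gcongr
      _ = Real.exp (-(3 * l * N / 4)) * 3 ^ k * thetaSum l ^ k := by ring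
      _ ≤ δ * thetaSum l ^ k := by gcongr
  have hT1 := tail_pi_discreteGaussian_le hl0 hφ0 (hint hl0) (hint hl4) hS
  have hT2 := sum_le_pi_discreteGaussian hl0 hφ0 (hint hl0) S
  have hW1 := tail_pi_discreteGaussian_le (g := fun _ => 1) hl0 (fun _ => zero_le_one)
    (integrable_const _) (integrable_const _) hS
  have hW2 := sum_le_pi_discreteGaussian (g := fun _ => 1) hl0 (fun _ => zero_le_one)
    (integrable_const _) S
  simp only [integral_const, probReal_univ, one_smul, mul_one] at hW1 hW2
  rw [← hI] at hT1 hT2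
  rw [← hJ, ← mul_assoc] at hT1
  set T := ∑ z ∈ S, Real.exp (-(l * ∑ i, (z i : ℝ) ^ 2)) * φ (fun i => δ * z i)
  set W := ∑ z ∈ S, Real.exp (-(l * ∑ i, (z i : ℝ) ^ 2))
  have hΘ : 0 < thetaSum l ^ k := by positivity
  set Θ := thetaSum l ^ k
  have hJ0 : 0 ≤ J := integral_nonneg hφ0
  have hηJ : Real.exp (-(3 * l * N / 4)) * thetaSum (l / 4) ^ k * J ≤ δ * Θ * (4 * E) := by
    apply mul_le_mul hη hJup hJ0 (by positivity)
  have hEΘ : 0 ≤ E * Θ := by positivity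
  rw [hτ]
  -- Lower bound: T ≥ (1 - 3δ - 4δ)EΘ and W ≤ Θ. Upper bound: T ≤ (1 + δ)EΘ and W ≥ (1 - δ)Θ, with
  -- (1 + 16δ)(1 - δ) ≥ 1 + δ.
  constructor
  · have h1 : (1 - 16 * δ) * E * W ≤ (1 - 16 * δ) * E * Θ := by
      apply mul_le_mul_of_nonneg_left hW2
      apply mul_nonneg _ hE0
      linarith
    have h2 : Θ * ((1 - 3 * δ) * E) ≤ Θ * I := by gcongr
    nlinarith
  · have h1 : (1 + 16 * δ) * E * (Θ - δ * Θ) ≤ (1 + 16 * δ) * E * W := by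
      apply mul_le_mul_of_nonneg_left _ (by positivity)
      linarith
    have h2 : Θ * I ≤ Θ * ((1 + δ) * E) := by gcongr
    have h3 : 0 ≤ (E * Θ) * (δ * (14 - 16 * δ)) := by
      apply mul_nonneg hEΘ
      apply mul_nonneg hδ0.le
      linarith
    nlinarith

end Truncation

/-! ### Lattice points of a ball and their colexicographic enumeration -/

/-- The integer points of the ball of squared radius `N`. -/
noncomputable def latticeBall (k N : ℕ) : Finset (Fin k → ℤ) :=
  (Fintype.piFinset fun _ => Finset.Icc (-(N : ℤ)) N).filter fun z => ∑ i, z i ^ 2 ≤ N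

theorem mem_latticeBall {k N : ℕ} {z : Fin k → ℤ} :
    z ∈ latticeBall k N ↔ ∑ i, z i ^ 2 ≤ (N : ℤ) := by
  simp only [latticeBall, Finset.mem_filter, Fintype.mem_piFinset, Finset.mem_Icc,
    and_iff_right_iff_imp]
  intro h i
  have h1 : z i ^ 2 ≤ N :=
    (Finset.single_le_sum (f := fun i => z i ^ 2) (fun i _ => sq_nonneg _) (Finset.mem_univ i)).trans h
  constructor <;> nlinarith [sq_nonneg (z i - 1), sq_nonneg (z i + 1), sq_nonneg (z i)]

theorem sum_Icc_pow_sq_le {s : ℝ} (h0 : 0 < s) (h1 : s < 1) (N : ℕ) :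
    ∑ z ∈ Finset.Icc (-(N : ℤ)) N, s ^ (z ^ 2).natAbs ≤ 2 * (1 - s)⁻¹ := by
  have hgeo : ∑ i ∈ Finset.range (N + 1), s ^ i ≤ (1 - s)⁻¹ := by
    rw [← tsum_geometric_of_lt_one h0.le h1]
    exact (summable_geometric_of_lt_one h0.le h1).sum_le_tsum _ fun i _ => by positivity
  have hsub : Finset.Icc (-(N : ℤ)) N ⊆ (Finset.range (N + 1)).image (fun i : ℕ => (i : ℤ)) ∪
      (Finset.range (N + 1)).image (fun i : ℕ => -(i : ℤ)) := by
    intro z hz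
    rw [Finset.mem_Icc] at hz
    simp only [Finset.mem_union, Finset.mem_image, Finset.mem_range]
    rcases le_total 0 z with h | h
    · exact Or.inl ⟨z.toNat, by omega, by omega⟩
    · exact Or.inr ⟨(-z).toNat, by omega, by omega⟩
  have hterm : ∀ i : ℕ, s ^ (((i : ℤ) ^ 2).natAbs) ≤ s ^ i := by
    intro i
    apply pow_le_pow_of_le_one h0.le h1.le
    rw [Int.natAbs_pow, Int.natAbs_natCast]
    exact Nat.le_self_pow two_ne_zero i
  refine (Finset.sum_le_sum_of_subset_of_nonneg hsub fun _ _ _ => by positivity).trans ?_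
  refine ((le_add_of_nonneg_right (Finset.sum_nonneg fun _ _ => by positivity)).trans
      (Finset.sum_union_inter).le).trans ?_
  calc
    _ = ∑ i ∈ Finset.range (N + 1), s ^ (((i : ℤ) ^ 2).natAbs) +
        ∑ i ∈ Finset.range (N + 1), s ^ (((i : ℤ) ^ 2).natAbs) := by
      rw [Finset.sum_image (by intro a _ b _ h; simpa using h),
        Finset.sum_image (by intro a _ b _ h; simpa using h)]
      simp only [neg_sq]
    _ ≤ (1 - s)⁻¹ + (1 - s)⁻¹ := by
      apply add_le_add <;> exact (Finset.sum_le_sum fun i _ => hterm i).trans hgeo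
    _ = _ := by ring

/-- Weight z by s^|z|² with s = L/(L + 1). Over the box the sum factorizes, each factor being at
most two geometric series, 2(L + 1); on the ball every weight is at least s^(kL) ≥ 3^(-k). -/
theorem card_latticeBall_le (k : ℕ) {L : ℕ} (hL : 0 < L) :
    (latticeBall k (k * L)).card ≤ (6 * (L + 1)) ^ k := by
  have hL0 : (0 : ℝ) < L := by exact_mod_cast hL
  set s : ℝ := L / (L + 1) with hs
  have h0 : 0 < s := by positivity
  have h1 : s < 1 := by rw [hs, div_lt_one (by positivity)]; linarith
  have hinv : (1 - s)⁻¹ = L + 1 := by rw [hs]; field_simp; ring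
  have hsL : (3 : ℝ)⁻¹ ≤ s ^ L := by
    have e : s = (1 + 1 / (L : ℝ))⁻¹ := by rw [hs]; field_simp
    rw [e, inv_pow]
    apply inv_anti₀ (by positivity)
    calc (1 + 1 / (L : ℝ)) ^ L ≤ Real.exp (1 / L) ^ L := by
          apply pow_le_pow_left₀ (by positivity)
          linarith [Real.add_one_le_exp (1 / (L : ℝ))]
      _ = Real.exp 1 := by rw [← Real.exp_nat_mul]; congr 1; field_simp
      _ ≤ 3 := by linarith [Real.exp_one_lt_d9]
  have hbox : ∑ z ∈ Fintype.piFinset fun _ : Fin k => Finset.Icc (-((k * L : ℕ) : ℤ)) (k * L : ℕ),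
      s ^ (∑ i, z i ^ 2).natAbs ≤ (2 * ((L : ℝ) + 1)) ^ k := by
    have e : ∀ z : Fin k → ℤ, s ^ (∑ i, z i ^ 2).natAbs = ∏ i, s ^ (z i ^ 2).natAbs := by
      intro z
      rw [Finset.prod_pow_eq_pow_sum]
      congr 1
      zify
      rw [abs_of_nonneg (Finset.sum_nonneg fun i _ => sq_nonneg _)]
      exact Finset.sum_congr rfl fun i _ => (abs_of_nonneg (sq_nonneg _)).symm
    simp only [e]
    rw [← Finset.prod_univ_sum (fun _ : Fin k => Finset.Icc (-((k * L : ℕ) : ℤ)) (k * L : ℕ))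
      (fun _ z => s ^ (z ^ 2).natAbs)]
    rw [Finset.prod_const, Finset.card_univ, Fintype.card_fin]
    apply pow_le_pow_left₀ (Finset.sum_nonneg fun _ _ => by positivity)
    rw [← hinv]
    exact sum_Icc_pow_sq_le h0 h1 _
  have hball : ((latticeBall k (k * L)).card : ℝ) * (3⁻¹) ^ k ≤ (2 * ((L : ℝ) + 1)) ^ k := by
    refine le_trans ?_ hbox
    rw [← nsmul_eq_mul, ← Finset.sum_const]
    refine le_trans (Finset.sum_le_sum fun z hz => ?_)
      (Finset.sum_le_sum_of_subset_of_nonneg (Finset.filter_subset _ _)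
        fun _ _ _ => by positivity)
    replace hz := mem_latticeBall.1 hz
    calc (3⁻¹ : ℝ) ^ k ≤ (s ^ L) ^ k := pow_le_pow_left₀ (by norm_num) hsL k
      _ = s ^ (k * L) := by rw [← pow_mul, mul_comm]
      _ ≤ _ := by
        apply pow_le_pow_of_le_one h0.le h1.le
        have : 0 ≤ ∑ i, z i ^ 2 := Finset.sum_nonneg fun i _ => sq_nonneg _
        omega
  have : ((latticeBall k (k * L)).card : ℝ) ≤ (6 * ((L : ℝ) + 1)) ^ k := by
    rw [inv_pow, ← div_eq_mul_inv, div_le_iff₀ (by positivity), ← mul_pow] at hball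
    refine hball.trans (le_of_eq ?_)
    ring
  exact_mod_cast this

/-- The position of an integer in the list `0, 1, -1, 2, -2, …`. -/
def zigzagRank (z : ℤ) : ℕ := if 0 < z then 2 * z.natAbs - 1 else 2 * z.natAbs

/-- The successor of an integer in the list `0, 1, -1, 2, -2, …`. -/
def zigzagNext (z : ℤ) : ℤ := if 0 < z then -z else 1 - z

theorem zigzagRank_next (z : ℤ) : zigzagRank (zigzagNext z) = zigzagRank z + 1 := by
  unfold zigzagRank zigzagNext
  split_ifs <;> omega

theorem zigzagRank_injective : Function.Injective zigzagRank := by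
  intro y z h
  unfold zigzagRank at h
  split_ifs at h <;> omega

/-- This is why the zigzag order is used: once a coordinate pushes the point out of the ball, every
later value does so too. -/
theorem sq_le_sq_of_zigzagRank_le {y z : ℤ} (h : zigzagRank y ≤ zigzagRank z) :
    y ^ 2 ≤ z ^ 2 := by
  rw [← Int.natAbs_le_iff_sq_le]
  unfold zigzagRank at h
  split_ifs at h <;> omega

/-- Extension of a vector by zeros. -/
def extendZero {k : ℕ} (y : Fin k → ℤ) (i : ℕ) : ℤ := if h : i < k then y ⟨i, h⟩ else 0

theorem extendZero_of_ge {k : ℕ} (y : Fin k → ℤ) {i : ℕ} (h : k ≤ i) : extendZero y i = 0 :=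
  dif_neg (by omega)

theorem sum_range_extendZero_sq {k : ℕ} (y : Fin k → ℤ) :
    ∑ i ∈ Finset.range (k + 1), extendZero y i ^ 2 = ∑ i, y i ^ 2 := by
  rw [Finset.sum_range_succ, extendZero_of_ge y le_rfl, Finset.sum_range]
  simp [extendZero]

/-- Colexicographic order of integer sequences with respect to the zigzag order. -/
def ColexLT (y z : ℕ → ℤ) : Prop :=
  ∃ j, zigzagRank (y j) < zigzagRank (z j) ∧ ∀ i, j < i → y i = z i

open Classical in
/-- The points of the lattice ball that precede `z`. -/
noncomputable def ballBefore (k N : ℕ) (z : ℕ → ℤ) : Finset (Fin k → ℤ) :=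
  (latticeBall k N).filter fun y => ColexLT (extendZero y) z

theorem mem_ballBefore {k N : ℕ} {z : ℕ → ℤ} {y : Fin k → ℤ} :
    y ∈ ballBefore k N z ↔ y ∈ latticeBall k N ∧ ColexLT (extendZero y) z := by
  simp [ballBefore]

theorem ballBefore_zero (k N : ℕ) : ballBefore k N 0 = ∅ := by
  rw [Finset.eq_empty_iff_forall_notMem]
  intro y hy
  obtain ⟨-, j, hj, -⟩ := mem_ballBefore.1 hy
  simp [zigzagRank] at hj

theorem notMem_ballBefore_self {k N : ℕ} (z : Fin k → ℤ) :
    z ∉ ballBefore k N (extendZero z) := by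
  intro h
  obtain ⟨-, j, hj, -⟩ := mem_ballBefore.1 h
  exact lt_irrefl _ hj

/-- Increment coordinate `i` and reset the coordinates before it. -/
def carryAt (z : ℕ → ℤ) (i j : ℕ) : ℤ :=
  if j < i then 0 else if j = i then zigzagNext (z i) else z j

theorem carryAt_lt {z : ℕ → ℤ} {i j : ℕ} (h : j < i) : carryAt z i j = 0 := if_pos h

theorem carryAt_self (z : ℕ → ℤ) (i : ℕ) : carryAt z i i = zigzagNext (z i) := by simp [carryAt]

theorem carryAt_gt {z : ℕ → ℤ} {i j : ℕ} (h : i < j) : carryAt z i j = z j := by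
  simp [carryAt, h.not_gt, h.ne']

/-- Two finitely supported sequences that differ have a last difference. -/
theorem exists_last_ne {y z : ℕ → ℤ} {m : ℕ} (h : ∀ i, m ≤ i → y i = z i) (hne : y ≠ z) :
    ∃ j < m, y j ≠ z j ∧ ∀ i, j < i → y i = z i := by
  classical
  induction m with
  | zero => exact absurd (funext fun i => h i (Nat.zero_le i)) hne
  | succ m ih =>
    by_cases hm : y m = z m
    · obtain ⟨j, hj, h1, h2⟩ := ih fun i hi => by
        rcases eq_or_lt_of_le hi with rfl | hi
        · exact hm
        · exact h i hi
      exact ⟨j, by omega, h1, h2⟩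
    · exact ⟨m, by omega, hm, fun i hi => h i hi⟩

/-- The carries rejected before i skip no point of the ball, so exactly the point z is added to the
visited ones. -/
theorem ballBefore_carryAt {k N : ℕ} {z : Fin k → ℤ} (hz : z ∈ latticeBall k N) {i : ℕ}
    (hmin : ∀ j < i, (N : ℤ) < ∑ m ∈ Finset.range (k + 1), carryAt (extendZero z) j m ^ 2) :
    ballBefore k N (carryAt (extendZero z) i) = insert z (ballBefore k N (extendZero z)) := by
  ext y
  simp only [Finset.mem_insert, mem_ballBefore]
  constructor
  · rintro ⟨hy, j, hj, hgt⟩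
    by_cases hyz : y = z
    · exact Or.inl hyz
    refine Or.inr ⟨hy, ?_⟩
    rcases lt_trichotomy j i with hji | rfl | hji
    · rw [carryAt_lt hji] at hj
      simp [zigzagRank] at hj
    · rw [carryAt_self, zigzagRank_next] at hj
      have hgt' : ∀ m, j < m → extendZero y m = extendZero z m := fun m hm => by
        rw [hgt m hm, carryAt_gt hm]
      rcases Nat.lt_succ_iff_lt_or_eq.1 hj with hlt | heq
      · exact ⟨j, hlt, hgt'⟩
      · have hge : ∀ m, j ≤ m → extendZero y m = extendZero z m := fun m hm => by
          rcases eq_or_lt_of_le hm with rfl | hm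
          · exact zigzagRank_injective heq
          · exact hgt' m hm
        have hne : extendZero y ≠ extendZero z := by
          intro h
          apply hyz
          ext m
          have := congrFun h m
          simpa [extendZero] using this
        obtain ⟨l, hl, hne, hagree⟩ := exists_last_ne hge hne
        refine ⟨l, ?_, hagree⟩
        by_contra hcon
        have hlt : zigzagRank (extendZero z l) < zigzagRank (extendZero y l) :=
          lt_of_le_of_ne (not_lt.1 hcon) fun h => hne (zigzagRank_injective h).symm
        -- A skipped y agrees with z beyond its last difference l < i and comes after z there.
        -- Coordinate by coordinate its squares dominate those of the carry at l, which already lies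
        -- outside the ball.
        have hover := hmin l hl
        have hyN := mem_latticeBall.1 hy
        rw [← sum_range_extendZero_sq] at hyN
        refine absurd (hover.trans_le ((Finset.sum_le_sum fun m _ => ?_).trans hyN)) (lt_irrefl _)
        rcases lt_trichotomy m l with hm | rfl | hm
        · rw [carryAt_lt hm]; positivity
        · rw [carryAt_self]
          apply sq_le_sq_of_zigzagRank_le
          rw [zigzagRank_next]
          exact hlt
        · rw [carryAt_gt hm, hagree m hm]
    · exact ⟨j, by rwa [carryAt_gt hji] at hj, fun m hm => by
        rw [hgt m hm, carryAt_gt (hji.trans hm)]⟩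
  · have key : ∀ m, i < m → ∀ y : ℕ → ℤ, y m = extendZero z m →
        y m = carryAt (extendZero z) i m := fun m hm y h => by rw [h, carryAt_gt hm]
    rintro (rfl | ⟨hy, j, hj, hgt⟩)
    · refine ⟨hz, i, ?_, fun m hm => key m hm _ rfl⟩
      rw [carryAt_self, zigzagRank_next]
      exact Nat.lt_succ_self _
    · refine ⟨hy, ?_⟩
      rcases lt_trichotomy j i with hji | rfl | hji
      · refine ⟨i, ?_, fun m hm => key m hm _ (hgt m (hji.trans hm))⟩
        rw [carryAt_self, zigzagRank_next, hgt i hji]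
        exact Nat.lt_succ_self _
      · refine ⟨j, ?_, fun m hm => key m hm _ (hgt m hm)⟩
        rw [carryAt_self, zigzagRank_next]
        exact hj.trans (Nat.lt_succ_self _)
      · exact ⟨j, by rwa [carryAt_gt hji], fun m hm => key m (hji.trans hm) _ (hgt m hm)⟩

/-- A carry into the extra coordinate k makes it nonzero, whereas it is 0 for every vector extended
by zeros. -/
theorem ballBefore_carryAt_last {k N : ℕ} (z : Fin k → ℤ) :
    ballBefore k N (carryAt (extendZero z) k) = latticeBall k N := by
  ext y
  rw [mem_ballBefore, and_iff_left_iff_imp]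
  intro _
  refine ⟨k, ?_, fun i hi => ?_⟩
  · rw [carryAt_self, zigzagRank_next, extendZero_of_ge y le_rfl]
    simp [zigzagRank]
  · rw [carryAt_gt hi, extendZero_of_ge y hi.le, extendZero_of_ge z hi.le]

/-! ### Resource bounds for runs of the machine -/

namespace OracleRAM

theorem bits_le_iff {z : ℤ} {n : ℕ} : bits z ≤ n ↔ z.natAbs < 2 ^ n := Nat.size_le

theorem natAbs_lt_two_pow_bits (z : ℤ) : z.natAbs < 2 ^ bits z := Nat.lt_size_self _

theorem size_le_self (n : ℕ) : Nat.size n ≤ n := Nat.size_le.2 Nat.lt_two_pow_self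

theorem bits_add_le (x y : ℤ) : bits (x + y) ≤ bits x + bits y + 1 := by
  rw [bits_le_iff]
  have h1 := natAbs_lt_two_pow_bits x
  have h2 := natAbs_lt_two_pow_bits y
  have h3 : 2 ^ bits x ≤ 2 ^ (bits x + bits y) := Nat.pow_le_pow_right two_pos (by omega)
  have h4 : 2 ^ bits y ≤ 2 ^ (bits x + bits y) := Nat.pow_le_pow_right two_pos (by omega)
  have := Int.natAbs_add_le x y
  rw [pow_succ]
  omega

theorem bits_neg (x : ℤ) : bits (-x) = bits x := by simp [bits]

theorem bits_sub_le (x y : ℤ) : bits (x - y) ≤ bits x + bits y + 1 := by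
  have := bits_add_le x (-y)
  rwa [bits_neg, ← sub_eq_add_neg] at this

theorem bits_mul_le (x y : ℤ) : bits (x * y) ≤ bits x + bits y := by
  rw [bits_le_iff, Int.natAbs_mul, pow_add]
  exact Nat.mul_lt_mul'' (natAbs_lt_two_pow_bits x) (natAbs_lt_two_pow_bits y)

theorem bits_div_le (x y : ℤ) : bits (x / y) ≤ bits x :=
  Nat.size_le_size (Int.natAbs_ediv_le_natAbs x y)

namespace Expr

/-- A measure for the size of an expression, with constants counted by their absolute value. -/
def weight : Expr → ℕ
  | const z => 1 + z.natAbs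
  | cell e => 1 + e.weight
  | add e₁ e₂ => 1 + e₁.weight + e₂.weight
  | sub e₁ e₂ => 1 + e₁.weight + e₂.weight
  | mul e₁ e₂ => 1 + e₁.weight + e₂.weight
  | div e₁ e₂ => 1 + e₁.weight + e₂.weight

variable {σ : State} {B : ℕ}

theorem bits_val_le (hσ : ∀ a, bits (σ.cell a) ≤ B) (hB : 1 ≤ B) (e : Expr) :
    bits (e.val σ) ≤ e.weight * B := by
  induction e with
  | const z =>
    have : bits z ≤ z.natAbs := size_le_self _
    simp only [val, weight]
    nlinarith
  | cell e ih =>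
    simp only [val, weight]
    nlinarith [hσ (e.val σ).toNat]
  | add e₁ e₂ ih₁ ih₂ =>
    simp only [val, weight]
    nlinarith [bits_add_le (e₁.val σ) (e₂.val σ)]
  | sub e₁ e₂ ih₁ ih₂ =>
    simp only [val, weight]
    nlinarith [bits_sub_le (e₁.val σ) (e₂.val σ)]
  | mul e₁ e₂ ih₁ ih₂ =>
    simp only [val, weight]
    nlinarith [bits_mul_le (e₁.val σ) (e₂.val σ)]
  | div e₁ e₂ ih₁ ih₂ =>
    simp only [val, weight]
    nlinarith [bits_div_le (e₁.val σ) (e₂.val σ)]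

theorem cost_le (hσ : ∀ a, bits (σ.cell a) ≤ B) (hB : 1 ≤ B) (e : Expr) :
    e.cost σ ≤ 3 * e.weight ^ 2 * B := by
  have aux : ∀ (c₁ c₂ w₁ w₂ b₁ b₂ : ℕ), c₁ ≤ 3 * w₁ ^ 2 * B → c₂ ≤ 3 * w₂ ^ 2 * B →
      b₁ ≤ w₁ * B → b₂ ≤ w₂ * B →
      c₁ + c₂ + (1 + b₁ + b₂) ≤ 3 * (1 + w₁ + w₂) ^ 2 * B := by
    intro c₁ c₂ w₁ w₂ b₁ b₂ h1 h2 h3 h4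
    have : 3 * (1 + w₁ + w₂) ^ 2 * B = 3 * w₁ ^ 2 * B + 3 * w₂ ^ 2 * B + 3 * B + 6 * (w₁ * B) +
      6 * (w₂ * B) + 6 * (w₁ * w₂ * B) := by ring
    rw [this]
    omega
  induction e with
  | const z =>
    have : bits z ≤ z.natAbs := size_le_self _
    simp only [cost, weight]
    nlinarith [Nat.zero_le (z.natAbs ^ 2 * B), Nat.zero_le (z.natAbs * B)]
  | cell e ih =>
    simp only [cost, weight]
    have h1 := bits_val_le hσ hB e
    have h2 := hσ (e.val σ).toNat
    have : 3 * (1 + e.weight) ^ 2 * B = 3 * e.weight ^ 2 * B + 6 * (e.weight * B) + 3 * B := by ring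
    rw [this]
    omega
  | add e₁ e₂ ih₁ ih₂ => exact aux _ _ _ _ _ _ ih₁ ih₂ (bits_val_le hσ hB e₁) (bits_val_le hσ hB e₂)
  | sub e₁ e₂ ih₁ ih₂ => exact aux _ _ _ _ _ _ ih₁ ih₂ (bits_val_le hσ hB e₁) (bits_val_le hσ hB e₂)
  | mul e₁ e₂ ih₁ ih₂ => exact aux _ _ _ _ _ _ ih₁ ih₂ (bits_val_le hσ hB e₁) (bits_val_le hσ hB e₂)
  | div e₁ e₂ ih₁ ih₂ => exact aux _ _ _ _ _ _ ih₁ ih₂ (bits_val_le hσ hB e₁) (bits_val_le hσ hB e₂)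

/-- The threshold 400 exceeds the weight of every expression in the program; the constant 256 alone
has weight 257. -/
theorem bits_val_le_of_weight (hσ : ∀ a, bits (σ.cell a) ≤ B) (hB : 1 ≤ B) {e : Expr}
    (he : e.weight ≤ 400) : bits (e.val σ) ≤ 400 * B :=
  (bits_val_le hσ hB e).trans (Nat.mul_le_mul_right B he)

theorem cost_le_of_weight (hσ : ∀ a, bits (σ.cell a) ≤ B) (hB : 1 ≤ B) {e : Expr}
    (he : e.weight ≤ 400) : e.cost σ ≤ 480000 * B :=
  (cost_le hσ hB e).trans (Nat.mul_le_mul_right B (by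
    calc 3 * e.weight ^ 2 ≤ 3 * 400 ^ 2 := by gcongr
      _ = 480000 := by norm_num))

end Expr

/-- All cells in use have addresses at most `10 + k` and contents of at most `B` bits,
and only the first three real registers are in use. -/
structure Fits (k B : ℕ) (σ : State) : Prop where
  pos : 1 ≤ B
  bits_cell : ∀ a, bits (σ.cell a) ≤ B
  cell_eq : ∀ a, 11 + k ≤ a → σ.cell a = 0
  real_eq : ∀ r, 3 ≤ r → σ.real r = 0

/-- A bound for the cost of one step. -/
def stepBound (k B : ℕ) : ℕ := 3000000 * B + k * (11 + k + B)

/-- A bound for the space. -/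
def spaceBound (k B : ℕ) : ℕ := (11 + k) * (12 + k + B) + 12 + stepBound k B

theorem Fits.size_le {k B : ℕ} {σ : State} (h : Fits k B σ) :
    σ.size ≤ (11 + k) * (12 + k + B) + 12 := by
  have h1 : (σ.cell.sum fun a z => 1 + Nat.size a + bits z) ≤ (11 + k) * (12 + k + B) := by
    have hsub : σ.cell.support ⊆ Finset.range (11 + k) := by
      intro a ha
      rw [Finset.mem_range]
      by_contra hcon
      exact Finsupp.mem_support_iff.1 ha (h.cell_eq a (by omega))
    calc _ ≤ σ.cell.support.card • (12 + k + B) := by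
          refine Finset.sum_le_card_nsmul _ _ _ fun a ha => ?_
          have h1 := Finset.mem_range.1 (hsub ha)
          have h2 := h.bits_cell a
          have h3 := size_le_self a
          dsimp only
          omega
      _ ≤ _ := by
        rw [smul_eq_mul]
        exact Nat.mul_le_mul_right _ ((Finset.card_le_card hsub).trans (by simp))
  have h2 : (σ.real.sum fun r _ => 1 + Nat.size r) ≤ 12 := by
    have hsub : σ.real.support ⊆ Finset.range 3 := by
      intro a ha
      rw [Finset.mem_range]
      by_contra hcon
      exact Finsupp.mem_support_iff.1 ha (h.real_eq a (by omega))
    calc _ ≤ σ.real.support.card • 4 := by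
          refine Finset.sum_le_card_nsmul _ _ _ fun a ha => ?_
          have h1 := Finset.mem_range.1 (hsub ha)
          have h3 := size_le_self a
          dsimp only
          omega
      _ ≤ 3 * 4 := by
        rw [smul_eq_mul]
        exact Nat.mul_le_mul_right _ ((Finset.card_le_card hsub).trans (by simp))
  exact Nat.add_le_add h1 h2

@[simp] theorem State.setCell_cell (σ : State) (a : ℕ) (z : ℤ) (b : ℕ) :
    (σ.setCell a z).cell b = if b = a then z else σ.cell b := by
  simp [State.setCell, Finsupp.coe_update, Function.update_apply]

@[simp] theorem State.setCell_real (σ : State) (a : ℕ) (z : ℤ) :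
    (σ.setCell a z).real = σ.real := rfl

@[simp] theorem State.setReal_real (σ : State) (r : ℕ) (t : ℝ) (b : ℕ) :
    (σ.setReal r t).real b = if b = r then t else σ.real b := by
  simp [State.setReal, Finsupp.coe_update, Function.update_apply]

@[simp] theorem State.setReal_cell (σ : State) (r : ℕ) (t : ℝ) :
    (σ.setReal r t).cell = σ.cell := rfl

theorem Fits.setCell {k B : ℕ} {σ : State} (h : Fits k B σ) {a : ℕ} {z : ℤ} (ha : a < 11 + k)
    (hz : bits z ≤ B) : Fits k B (σ.setCell a z) where
  pos := h.pos
  bits_cell b := by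
    rw [State.setCell_cell]
    split_ifs
    exacts [hz, h.bits_cell b]
  cell_eq b hb := by
    rw [State.setCell_cell, if_neg (by omega)]
    exact h.cell_eq b hb
  real_eq := h.real_eq

theorem Fits.setReal {k B : ℕ} {σ : State} (h : Fits k B σ) {r : ℕ} {t : ℝ} (hr : r < 3) :
    Fits k B (σ.setReal r t) where
  pos := h.pos
  bits_cell := h.bits_cell
  cell_eq := h.cell_eq
  real_eq b hb := by
    rw [State.setReal_real, if_neg (by omega)]
    exact h.real_eq b hb

variable {k : ℕ} {φ : (Fin k → ℝ) → ℝ} {B : ℕ}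

/-- `Reach φ B P σ n Q`: the program `P` started in `σ` halts after at most `n` steps, each of cost
at most `stepBound k B`, within space `spaceBound k B`, and the final configuration and the list
of queries satisfy `Q`. -/
def Reach (φ : (Fin k → ℝ) → ℝ) (B : ℕ) (P : Prog) (σ : State) (n : ℕ)
    (Q : State → List (Fin k → ℝ) → Prop) : Prop :=
  ∃ σ' qs t s, Exec φ P σ σ' qs t s ∧ t ≤ n * stepBound k B ∧ s ≤ spaceBound k B ∧ Q σ' qs

theorem Reach.mono {P : Prog} {σ : State} {n n' : ℕ} {Q Q' : State → List (Fin k → ℝ) → Prop}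
    (h : Reach φ B P σ n Q) (hn : n ≤ n') (hQ : ∀ σ' qs, Q σ' qs → Q' σ' qs) :
    Reach φ B P σ n' Q' := by
  obtain ⟨σ', qs, t, s, h1, h2, h3, h4⟩ := h
  exact ⟨σ', qs, t, s, h1, h2.trans (Nat.mul_le_mul_right _ hn), h3, hQ _ _ h4⟩

theorem Fits.max_le {σ σ' : State} {t : ℕ} (h : Fits k B σ) (h' : Fits k B σ')
    (ht : t ≤ stepBound k B) : max (σ.size + t) σ'.size ≤ spaceBound k B := by
  have h1 := h.size_le
  have h2 := h'.size_le
  unfold spaceBound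
  omega

theorem Reach.store {σ : State} {a e : Expr} {Q : State → List (Fin k → ℝ) → Prop}
    (hσ : Fits k B σ) (ha : a.weight ≤ 400) (he : e.weight ≤ 400)
    (haddr : a.addr σ < 11 + k) (hval : bits (e.val σ) ≤ B)
    (hQ : Q (σ.setCell (a.addr σ) (e.val σ)) []) : Reach φ B (.store a e) σ 1 Q := by
  have ht : 1 + a.cost σ + e.cost σ + bits (a.val σ) + bits (e.val σ) ≤ stepBound k B := by
    have h1 := Expr.cost_le_of_weight hσ.bits_cell hσ.pos ha
    have h2 := Expr.cost_le_of_weight hσ.bits_cell hσ.pos he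
    have h3 := Expr.bits_val_le_of_weight hσ.bits_cell hσ.pos ha
    have := hσ.pos
    unfold stepBound
    omega
  exact ⟨_, _, _, _, .store σ _ a e _ rfl rfl, by rwa [one_mul],
    hσ.max_le (hσ.setCell haddr hval) ht, hQ⟩

theorem Reach.query {σ : State} {r a d : Expr} {Q : State → List (Fin k → ℝ) → Prop}
    (hσ : Fits k B σ) (hr : r.weight ≤ 400) (ha : a.weight ≤ 400) (hd : d.weight ≤ 400)
    (hraddr : r.addr σ < 3) (haddr : a.addr σ ≤ 10)
    (hQ : Q (σ.setReal (r.addr σ) (φ (point k σ (a.addr σ) (d.val σ))))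
      [point k σ (a.addr σ) (d.val σ)]) : Reach φ B (.query r a d) σ 1 Q := by
  have ht : 1 + r.cost σ + a.cost σ + d.cost σ + bits (r.val σ) + bits (d.val σ)
      + pointCost k σ (a.addr σ) ≤ stepBound k B := by
    have h1 := Expr.cost_le_of_weight hσ.bits_cell hσ.pos hr
    have h2 := Expr.cost_le_of_weight hσ.bits_cell hσ.pos ha
    have h3 := Expr.cost_le_of_weight hσ.bits_cell hσ.pos hd
    have h4 := Expr.bits_val_le_of_weight hσ.bits_cell hσ.pos hr
    have h5 := Expr.bits_val_le_of_weight hσ.bits_cell hσ.pos hd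
    have h6 : pointCost k σ (a.addr σ) ≤ k * (11 + k + B) := by
      have := Finset.sum_le_card_nsmul (Finset.univ : Finset (Fin k))
        (fun i => 1 + Nat.size (a.addr σ + i) + bits (σ.cell (a.addr σ + i))) (11 + k + B)
        fun i _ => by
          have h1 := size_le_self (a.addr σ + i)
          have h2 := hσ.bits_cell (a.addr σ + i)
          omega
      simpa [pointCost] using this
    have := hσ.pos
    unfold stepBound
    omega
  exact ⟨_, _, _, _, .query σ _ r a d _ _ rfl rfl rfl, by rwa [one_mul],
    hσ.max_le (hσ.setReal hraddr) ht, hQ⟩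

theorem Reach.addScaled {σ : State} {r s c d : Expr} {Q : State → List (Fin k → ℝ) → Prop}
    (hσ : Fits k B σ) (hr : r.weight ≤ 400) (hs : s.weight ≤ 400) (hc : c.weight ≤ 400)
    (hd : d.weight ≤ 400) (hraddr : r.addr σ < 3)
    (hQ : Q (σ.setReal (r.addr σ)
      (σ.real (r.addr σ) + (c.val σ : ℝ) / (d.val σ : ℝ) * σ.real (s.addr σ))) []) :
    Reach φ B (.addScaled r s c d) σ 1 Q := by
  have ht : 1 + r.cost σ + s.cost σ + c.cost σ + d.cost σ
      + bits (r.val σ) + bits (s.val σ) + bits (c.val σ) + bits (d.val σ) ≤ stepBound k B := by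
    have h1 := Expr.cost_le_of_weight hσ.bits_cell hσ.pos hr
    have h2 := Expr.cost_le_of_weight hσ.bits_cell hσ.pos hs
    have h3 := Expr.cost_le_of_weight hσ.bits_cell hσ.pos hc
    have h4 := Expr.cost_le_of_weight hσ.bits_cell hσ.pos hd
    have h5 := Expr.bits_val_le_of_weight hσ.bits_cell hσ.pos hr
    have h6 := Expr.bits_val_le_of_weight hσ.bits_cell hσ.pos hs
    have h7 := Expr.bits_val_le_of_weight hσ.bits_cell hσ.pos hc
    have h8 := Expr.bits_val_le_of_weight hσ.bits_cell hσ.pos hd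
    have := hσ.pos
    unfold stepBound
    omega
  exact ⟨_, _, _, _, .addScaled σ _ r s c d _ rfl rfl, by rwa [one_mul],
    hσ.max_le (hσ.setReal hraddr) ht, hQ⟩

theorem Reach.seq {P₁ P₂ : Prog} {σ : State} {n₁ n₂ : ℕ}
    {Q₁ Q : State → List (Fin k → ℝ) → Prop} (h₁ : Reach φ B P₁ σ n₁ Q₁)
    (h₂ : ∀ σ₁ qs₁, Q₁ σ₁ qs₁ → Reach φ B P₂ σ₁ n₂ fun σ₂ qs₂ => Q σ₂ (qs₁ ++ qs₂)) :
    Reach φ B (.seq P₁ P₂) σ (n₁ + n₂) Q := by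
  obtain ⟨σ₁, qs₁, t₁, s₁, e₁, ht₁, hs₁, hQ₁⟩ := h₁
  obtain ⟨σ₂, qs₂, t₂, s₂, e₂, ht₂, hs₂, hQ₂⟩ := h₂ σ₁ qs₁ hQ₁
  exact ⟨_, _, _, _, .seq _ _ _ _ _ _ _ _ _ _ _ e₁ e₂, by rw [add_mul]; omega,
    max_le hs₁ hs₂, hQ₂⟩

theorem Fits.test_le {σ : State} (h : Fits k B σ) {e : Expr} (he : e.weight ≤ 400) :
    1 + e.cost σ ≤ stepBound k B ∧ σ.size + (1 + e.cost σ) ≤ spaceBound k B := by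
  have h1 := Expr.cost_le_of_weight h.bits_cell h.pos he
  have h2 := h.pos
  have h3 := h.size_le
  unfold spaceBound stepBound
  omega

theorem Reach.ite {P₁ P₂ : Prog} {σ : State} {e : Expr} {n : ℕ}
    {Q : State → List (Fin k → ℝ) → Prop} (hσ : Fits k B σ) (he : e.weight ≤ 400)
    (h₁ : 0 < e.val σ → Reach φ B P₁ σ n Q) (h₂ : ¬ 0 < e.val σ → Reach φ B P₂ σ n Q) :
    Reach φ B (.ite e P₁ P₂) σ (1 + n) Q := by
  obtain ⟨hc, hs⟩ := hσ.test_le he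
  by_cases h : 0 < e.val σ
  · obtain ⟨σ', qs, t, s, e', ht', hs', hQ⟩ := h₁ h
    exact ⟨_, _, _, _, .iteTrue _ _ _ _ _ _ _ _ h e', by rw [add_mul]; omega, max_le hs hs', hQ⟩
  · obtain ⟨σ', qs, t, s, e', ht', hs', hQ⟩ := h₂ h
    exact ⟨_, _, _, _, .iteFalse _ _ _ _ _ _ _ _ h e', by rw [add_mul]; omega, max_le hs hs', hQ⟩

theorem Reach.loop_stop {P : Prog} {σ : State} {e : Expr}
    {Q : State → List (Fin k → ℝ) → Prop} (hσ : Fits k B σ) (he : e.weight ≤ 400)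
    (h : ¬ 0 < e.val σ) (hQ : Q σ []) : Reach φ B (.loop e P) σ 1 Q := by
  obtain ⟨hc, hs⟩ := hσ.test_le he
  exact ⟨_, _, _, _, .loopStop _ _ _ h, by omega, hs, hQ⟩

theorem Reach.loop_step {P : Prog} {σ : State} {e : Expr} {n₁ n₂ : ℕ}
    {Q₁ Q : State → List (Fin k → ℝ) → Prop} (hσ : Fits k B σ) (he : e.weight ≤ 400)
    (h : 0 < e.val σ) (h₁ : Reach φ B P σ n₁ Q₁)
    (h₂ : ∀ σ₁ qs₁, Q₁ σ₁ qs₁ → Reach φ B (.loop e P) σ₁ n₂ fun σ₂ qs₂ => Q σ₂ (qs₁ ++ qs₂)) :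
    Reach φ B (.loop e P) σ (1 + n₁ + n₂) Q := by
  obtain ⟨hc, hs⟩ := hσ.test_le he
  obtain ⟨σ₁, qs₁, t₁, s₁, e₁, ht₁, hs₁, hQ₁⟩ := h₁
  obtain ⟨σ₂, qs₂, t₂, s₂, e₂, ht₂, hs₂, hQ₂⟩ := h₂ σ₁ qs₁ hQ₁
  exact ⟨_, _, _, _, .loopStep _ _ _ _ _ _ _ _ _ _ _ h e₁ e₂, by rw [add_mul, add_mul]; omega,
    max_le hs (max_le hs₁ hs₂), hQ₂⟩

/-! ### The program -/

theorem Reach.store_eq {k : ℕ} {φ : (Fin k → ℝ) → ℝ} {B : ℕ} {σ : State} {a e : Expr} {i : ℕ}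
    {v : ℤ} {Q : State → List (Fin k → ℝ) → Prop}
    (hσ : Fits k B σ) (ha : a.weight ≤ 400) (he : e.weight ≤ 400) (hi : a.addr σ = i)
    (hv : e.val σ = v) (haddr : i < 11 + k) (hval : bits v ≤ B)
    (hQ : Q (σ.setCell i v) []) : Reach φ B (.store a e) σ 1 Q := by
  subst hi hv
  exact Reach.store hσ ha he haddr hval hQ

namespace GridProgram

/-- The content of the cell with a fixed address. -/
abbrev var (i : ℤ) : Expr := .cell (.const i)

/-- The content of the cell to which cell `9` points. -/
abbrev pointed : Expr := .cell (var 9)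

/-- Compute the grid fineness, the squared radius and the denominator of the ratio of weights. -/
def setup : Prog :=
  .seq (.store (.const 2) (.mul (.const 64) (var 1)))
  (.seq (.store (.const 3) (.mul (.mul (.const 256) (.mul (var 1) (var 0))) (.mul (var 2) (var 2))))
    (.store (.const 4) (.mul (.const 2) (.mul (var 2) (var 2)))))

/-- One factor of the weight. -/
def weightBody : Prog :=
  .seq (.ite (.sub (var 5) (var 7)) (.store (.const 6) (.mul (var 6) (.sub (var 4) (.const 1))))
    (.store (.const 6) (.mul (var 6) (var 4))))
    (.store (.const 7) (.add (var 7) (.const 1)))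

/-- Compute the weight of the current point into cell `6`. -/
def computeWeight : Prog :=
  .seq (.store (.const 6) (.const 1))
  (.seq (.store (.const 7) (.const 0)) (.loop (.sub (var 3) (var 7)) weightBody))

/-- Replace the coordinate pointed to by its zigzag successor. -/
def increment : Prog :=
  .ite pointed (.store (var 9) (.sub (.const 0) pointed))
    (.seq (.store (.const 5) (.add (var 5) (.sub (.const 1) (.mul (.const 2) pointed))))
      (.store (var 9) (.sub (.const 1) pointed)))

/-- Reset the coordinate pointed to and increment the next one. -/
def carry : Prog :=
  .seq (.store (.const 5) (.sub (var 5) (.mul pointed pointed)))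
  (.seq (.store (var 9) (.const 0))
  (.seq (.store (.const 9) (.add (var 9) (.const 1))) increment))

/-- Move to the next lattice point. -/
def advance : Prog :=
  .seq (.store (.const 9) (.const 10))
  (.seq increment (.loop (.sub (var 5) (var 3)) carry))

/-- Process the current lattice point and move on. -/
def body : Prog :=
  .seq computeWeight
  (.seq (.store (.const 8) (.add (var 8) (var 6)))
  (.seq (.query (.const 2) (.const 10) (var 2))
  (.seq (.addScaled (.const 1) (.const 2) (var 6) (.const 1)) advance)))

/-- The mainGuard of the main loop: the overflow coordinate is still zero. -/
abbrev mainGuard : Expr := .sub (.const 1) (.cell (.add (.const 10) (var 0)))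

/-- The output is the normalized weighted sum, slightly scaled down. -/
def output : Prog :=
  .addScaled (.const 0) (.const 1) (.mul (.const 4) (var 1))
    (.mul (.add (.mul (.const 4) (var 1)) (.const 1)) (var 8))

end GridProgram

open GridProgram

/-- The weighted sum over the grid points of a ball. -/
def gridProgram : Prog := .seq setup (.seq (.loop mainGuard body) output)

/-- The meaning of the memory cells during a run of the program. -/
structure Rep (k B : ℕ) (σ : State) (n M N a s w j W p : ℤ) (z : ℕ → ℤ) (acc : ℝ) : Prop where
  fits : Fits k B σ
  c0 : σ.cell 0 = k
  c1 : σ.cell 1 = n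
  c2 : σ.cell 2 = M
  c3 : σ.cell 3 = N
  c4 : σ.cell 4 = a
  c5 : σ.cell 5 = s
  c6 : σ.cell 6 = w
  c7 : σ.cell 7 = j
  c8 : σ.cell 8 = W
  c9 : σ.cell 9 = p
  cz : ∀ i, σ.cell (10 + i) = z i
  r0 : σ.real 0 = 0
  r1 : σ.real 1 = acc

/-! ### Effect of single writes on the memory invariant -/

namespace Rep

variable {k B : ℕ} {σ : State} {n M N a s w j W p : ℤ} {z : ℕ → ℤ} {acc : ℝ}

theorem set2 (h : Rep k B σ n M N a s w j W p z acc) {x : ℤ} (hx : bits x ≤ B) :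
    Rep k B (σ.setCell 2 x) n x N a s w j W p z acc := by
  constructor
  · exact h.fits.setCell (by omega) hx
  all_goals simp [h.c0, h.c1, h.c3, h.c4, h.c5, h.c6, h.c7, h.c8, h.c9, h.r0, h.r1]
  · intro i; rw [if_neg (by omega), h.cz]

theorem set3 (h : Rep k B σ n M N a s w j W p z acc) {x : ℤ} (hx : bits x ≤ B) :
    Rep k B (σ.setCell 3 x) n M x a s w j W p z acc := by
  constructor
  · exact h.fits.setCell (by omega) hx
  all_goals simp [h.c0, h.c1, h.c2, h.c4, h.c5, h.c6, h.c7, h.c8, h.c9, h.r0, h.r1]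
  · intro i; rw [if_neg (by omega), h.cz]

theorem set4 (h : Rep k B σ n M N a s w j W p z acc) {x : ℤ} (hx : bits x ≤ B) :
    Rep k B (σ.setCell 4 x) n M N x s w j W p z acc := by
  constructor
  · exact h.fits.setCell (by omega) hx
  all_goals simp [h.c0, h.c1, h.c2, h.c3, h.c5, h.c6, h.c7, h.c8, h.c9, h.r0, h.r1]
  · intro i; rw [if_neg (by omega), h.cz]

theorem set5 (h : Rep k B σ n M N a s w j W p z acc) {x : ℤ} (hx : bits x ≤ B) :
    Rep k B (σ.setCell 5 x) n M N a x w j W p z acc := by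
  constructor
  · exact h.fits.setCell (by omega) hx
  all_goals simp [h.c0, h.c1, h.c2, h.c3, h.c4, h.c6, h.c7, h.c8, h.c9, h.r0, h.r1]
  · intro i; rw [if_neg (by omega), h.cz]

theorem set6 (h : Rep k B σ n M N a s w j W p z acc) {x : ℤ} (hx : bits x ≤ B) :
    Rep k B (σ.setCell 6 x) n M N a s x j W p z acc := by
  constructor
  · exact h.fits.setCell (by omega) hx
  all_goals simp [h.c0, h.c1, h.c2, h.c3, h.c4, h.c5, h.c7, h.c8, h.c9, h.r0, h.r1]
  · intro i; rw [if_neg (by omega), h.cz]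

theorem set7 (h : Rep k B σ n M N a s w j W p z acc) {x : ℤ} (hx : bits x ≤ B) :
    Rep k B (σ.setCell 7 x) n M N a s w x W p z acc := by
  constructor
  · exact h.fits.setCell (by omega) hx
  all_goals simp [h.c0, h.c1, h.c2, h.c3, h.c4, h.c5, h.c6, h.c8, h.c9, h.r0, h.r1]
  · intro i; rw [if_neg (by omega), h.cz]

theorem set8 (h : Rep k B σ n M N a s w j W p z acc) {x : ℤ} (hx : bits x ≤ B) :
    Rep k B (σ.setCell 8 x) n M N a s w j x p z acc := by
  constructor
  · exact h.fits.setCell (by omega) hx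
  all_goals simp [h.c0, h.c1, h.c2, h.c3, h.c4, h.c5, h.c6, h.c7, h.c9, h.r0, h.r1]
  · intro i; rw [if_neg (by omega), h.cz]

theorem set9 (h : Rep k B σ n M N a s w j W p z acc) {x : ℤ} (hx : bits x ≤ B) :
    Rep k B (σ.setCell 9 x) n M N a s w j W x z acc := by
  constructor
  · exact h.fits.setCell (by omega) hx
  all_goals simp [h.c0, h.c1, h.c2, h.c3, h.c4, h.c5, h.c6, h.c7, h.c8, h.r0, h.r1]
  · intro i; rw [if_neg (by omega), h.cz]

theorem setZ (h : Rep k B σ n M N a s w j W p z acc) {i : ℕ} (hi : i ≤ k) {x : ℤ}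
    (hx : bits x ≤ B) :
    Rep k B (σ.setCell (10 + i) x) n M N a s w j W p (Function.update z i x) acc := by
  have hne : ∀ m < 10, m ≠ 10 + i := fun m hm => by omega
  constructor
  · exact h.fits.setCell (by omega) hx
  all_goals simp only [State.setCell_cell, State.setCell_real]
  · rw [if_neg (hne 0 (by omega)), h.c0]
  · rw [if_neg (hne 1 (by omega)), h.c1]
  · rw [if_neg (hne 2 (by omega)), h.c2]
  · rw [if_neg (hne 3 (by omega)), h.c3]
  · rw [if_neg (hne 4 (by omega)), h.c4]
  · rw [if_neg (hne 5 (by omega)), h.c5]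
  · rw [if_neg (hne 6 (by omega)), h.c6]
  · rw [if_neg (hne 7 (by omega)), h.c7]
  · rw [if_neg (hne 8 (by omega)), h.c8]
  · rw [if_neg (hne 9 (by omega)), h.c9]
  · intro m
    rw [Function.update_apply, h.cz]
    simp
  · exact h.r0
  · exact h.r1

theorem setReal1 (h : Rep k B σ n M N a s w j W p z acc) (x : ℝ) :
    Rep k B (σ.setReal 1 x) n M N a s w j W p z x := by
  constructor
  · exact h.fits.setReal (by omega)
  all_goals simp [h.c0, h.c1, h.c2, h.c3, h.c4, h.c5, h.c6, h.c7, h.c8, h.c9, h.r0, h.cz]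

theorem setReal2 (h : Rep k B σ n M N a s w j W p z acc) (x : ℝ) :
    Rep k B (σ.setReal 2 x) n M N a s w j W p z acc := by
  constructor
  · exact h.fits.setReal (by omega)
  all_goals simp [h.c0, h.c1, h.c2, h.c3, h.c4, h.c5, h.c6, h.c7, h.c8, h.c9, h.r0, h.r1, h.cz]

theorem addr_var9 (h : Rep k B σ n M N a s w j W p z acc) {i : ℕ} (hp : p = 10 + i) :
    (var 9).addr σ = 10 + i := by
  simp [Expr.addr, Expr.val, h.c9, hp]; omega

theorem val_pointed (h : Rep k B σ n M N a s w j W p z acc) {i : ℕ} (hp : p = 10 + i) :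
    pointed.val σ = z i := by
  have := h.addr_var9 hp
  rw [Expr.addr] at this
  rw [pointed, Expr.val, this, h.cz]

end Rep

/-! ### Correctness and step counts of the subprograms -/

section Specification

variable {k B : ℕ} {φ : (Fin k → ℝ) → ℝ} {σ : State} {n M N a s w j W p : ℤ} {z : ℕ → ℤ} {acc : ℝ}

/-- A positive entry only changes its sign, so cell 5, the squared norm, needs no update; otherwise
it changes by (1 - z)² - z² = 1 - 2z. -/
theorem reach_increment (h : Rep k B σ n M N a s w j W p z acc) {i : ℕ} (hp : p = 10 + i)
    (hi : i ≤ k) (hz : bits (zigzagNext (z i)) ≤ B)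
    (hs : bits (s - z i ^ 2 + zigzagNext (z i) ^ 2) ≤ B) :
    Reach φ B increment σ 3 fun σ' qs => qs = [] ∧
      Rep k B σ' n M N a (s - z i ^ 2 + zigzagNext (z i) ^ 2) w j W p
        (Function.update z i (zigzagNext (z i))) acc := by
  have hzi := h.val_pointed hp
  refine Reach.ite (n := 2) h.fits (by decide) (fun hpos => ?_) (fun hpos => ?_)
  · rw [hzi] at hpos
    have e : zigzagNext (z i) = -z i := if_pos hpos
    rw [e] at hz hs ⊢
    refine (Reach.store_eq (v := -z i) h.fits (by decide) (by decide) (h.addr_var9 hp)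
      ?_ (by omega) hz ⟨rfl, ?_⟩).mono one_le_two fun _ _ h => h
    · rw [Expr.val, hzi]; simp [Expr.val]
    · have := h.setZ hi hz
      simpa using this
  · rw [hzi] at hpos
    have e : zigzagNext (z i) = 1 - z i := if_neg hpos
    rw [e] at hz hs ⊢
    have hv : s - z i ^ 2 + (1 - z i) ^ 2 = s + (1 - 2 * z i) := by ring
    rw [hv] at hs ⊢
    refine Reach.seq (n₁ := 1) (n₂ := 1) (Q₁ := fun σ' qs => qs = [] ∧
      Rep k B σ' n M N a (s + (1 - 2 * z i)) w j W p z acc)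
      (Reach.store_eq (i := 5) (v := s + (1 - 2 * z i)) h.fits (by decide) (by decide) rfl
        ?_ (by omega) hs ⟨rfl, h.set5 hs⟩) ?_
    · simp only [Expr.val] at hzi ⊢
      simp only [hzi]
      simp [h.c5]
    · rintro σ₁ _ ⟨rfl, h₁⟩
      refine Reach.store_eq (v := 1 - z i) h₁.fits (by decide) (by decide) (h₁.addr_var9 hp)
        ?_ (by omega) hz ⟨rfl, h₁.setZ hi hz⟩
      rw [Expr.val, h₁.val_pointed hp]; simp [Expr.val]

/-- The squared norm of the first `k + 1` entries. -/
def sqNorm (k : ℕ) (z : ℕ → ℤ) : ℤ := ∑ m ∈ Finset.range (k + 1), z m ^ 2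

theorem sqNorm_nonneg (k : ℕ) (z : ℕ → ℤ) : 0 ≤ sqNorm k z :=
  Finset.sum_nonneg fun _ _ => sq_nonneg _

theorem sqNorm_update {i : ℕ} (hi : i ≤ k) (z : ℕ → ℤ) (x : ℤ) :
    sqNorm k (Function.update z i x) = sqNorm k z - z i ^ 2 + x ^ 2 := by
  have hmem : i ∈ Finset.range (k + 1) := Finset.mem_range.2 (by omega)
  rw [sqNorm, sqNorm, ← Finset.add_sum_erase _ _ hmem, ← Finset.add_sum_erase _ _ hmem,
    Function.update_self, Finset.sum_congr rfl fun m hm => by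
      rw [Function.update_of_ne (Finset.ne_of_mem_erase hm)]]
  ring

theorem carryAt_zero (z : ℕ → ℤ) : carryAt z 0 = Function.update z 0 (zigzagNext (z 0)) := by
  ext m
  rcases Nat.eq_zero_or_pos m with rfl | hm
  · simp [carryAt]
  · rw [carryAt_gt hm, Function.update_of_ne hm.ne']

theorem carryAt_succ (z : ℕ → ℤ) (i : ℕ) : carryAt z (i + 1) =
    Function.update (Function.update (carryAt z i) i 0) (i + 1) (zigzagNext (z (i + 1))) := by
  ext m
  rcases lt_trichotomy m (i + 1) with hm | rfl | hm
  · rw [carryAt_lt hm, Function.update_of_ne hm.ne]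
    rcases Nat.lt_succ_iff_lt_or_eq.1 hm with hm | rfl
    · rw [Function.update_of_ne hm.ne, carryAt_lt hm]
    · rw [Function.update_self]
  · rw [carryAt_self, Function.update_self]
  · rw [carryAt_gt hm, Function.update_of_ne hm.ne', Function.update_of_ne (by omega),
      carryAt_gt (by omega)]

theorem zigzagNext_sq_le (x : ℤ) : zigzagNext x ^ 2 ≤ (|x| + 1) ^ 2 := by
  rw [sq_le_sq]
  unfold zigzagNext
  rcases abs_cases x with ⟨h, h'⟩ | ⟨h, h'⟩ <;> rw [h, abs_le, abs_of_nonneg (by omega)] <;>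
    split_ifs <;> constructor <;> omega

/-- Rejected carries leave the ball, yet their squared norm passes through cell 5. Only coordinate i
can grow, from z to modulus at most |z| + 1, and |z| ≤ z² bounds the gain. -/
theorem sqNorm_carryAt_le {i : ℕ} (hi : i ≤ k) (hN : sqNorm k z ≤ N) :
    sqNorm k (carryAt z i) ≤ 4 * N + 1 := by
  have hmem : i ∈ Finset.range (k + 1) := Finset.mem_range.2 (by omega)
  have h1 : sqNorm k (carryAt z i) ≤ sqNorm k z + zigzagNext (z i) ^ 2 := by
    rw [sqNorm, sqNorm, ← Finset.add_sum_erase _ _ hmem, carryAt_self, add_comm]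
    gcongr
    refine (Finset.sum_le_sum fun m hm => ?_).trans
      (Finset.sum_le_sum_of_subset_of_nonneg (Finset.erase_subset i _) fun m _ _ => sq_nonneg (z m))
    rcases lt_or_gt_of_ne (Finset.ne_of_mem_erase hm) with hlt | hlt
    · rw [carryAt_lt hlt]; positivity
    · rw [carryAt_gt hlt]
  have h2 : z i ^ 2 ≤ sqNorm k z := by
    rw [sqNorm]
    exact Finset.single_le_sum (f := fun m => z m ^ 2) (fun m _ => sq_nonneg _) hmem
  have h3 := zigzagNext_sq_le (z i)
  have h4 : |z i| ≤ z i ^ 2 := by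
    rw [← sq_abs]
    nlinarith [abs_nonneg (z i), sq_nonneg (|z i| - 1),
      (by rcases eq_or_lt_of_le (abs_nonneg (z i)) with h | h
          · rw [← h]; simp
          · nlinarith : |z i| ≤ |z i| ^ 2)]
  have h5 := sq_abs (z i)
  nlinarith

end Specification

theorem bits_le_of_abs_lt {x : ℤ} {B : ℕ} (h : |x| < 2 ^ B) : bits x ≤ B := by
  rw [bits_le_iff]
  zify
  exact h

section Specification

variable {k B : ℕ} {φ : (Fin k → ℝ) → ℝ} {σ : State} {n M N a s w j W p : ℤ} {z : ℕ → ℤ} {acc : ℝ}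

theorem abs_le_sqNorm {i : ℕ} (hi : i ≤ k) (z : ℕ → ℤ) : |z i| ≤ sqNorm k z := by
  have hmem : i ∈ Finset.range (k + 1) := Finset.mem_range.2 (by omega)
  have h2 : z i ^ 2 ≤ sqNorm k z :=
    Finset.single_le_sum (f := fun m => z m ^ 2) (fun m _ => sq_nonneg _) hmem
  refine le_trans ?_ h2
  rw [abs_le]
  constructor <;> nlinarith [sq_nonneg (z i - 1), sq_nonneg (z i + 1), sq_nonneg (z i)]

/-- With N ≥ 1 the carry loop therefore stops at the overflow coordinate at the latest. -/
theorem sqNorm_carryAt_last (hz : z k = 0) : sqNorm k (carryAt z k) = 1 := by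
  rw [sqNorm, Finset.sum_range_succ, carryAt_self, hz,
    Finset.sum_eq_zero fun m hm => by rw [carryAt_lt (Finset.mem_range.1 hm)]; rfl]
  rfl

/-- Downward induction from i = k, where the loop must stop. The record that all earlier carries
left the ball is what `ballBefore_carryAt` requires. Each pass takes one test and six steps. -/
theorem reach_carry_loop (hN : 1 ≤ N) (hzN : sqNorm k z ≤ N) (hzk : z k = 0)
    (hB : 4 * N + 1 < 2 ^ B) (hBk : 10 + (k : ℤ) < 2 ^ B) {i : ℕ} (hi : i ≤ k) :
    ∀ {σ : State}, Rep k B σ n M N a (sqNorm k (carryAt z i)) w j W (10 + i) (carryAt z i) acc →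
    (∀ m < i, N < sqNorm k (carryAt z m)) →
    Reach φ B (.loop (.sub (var 5) (var 3)) carry) σ (7 * (k - i) + 1) fun σ' qs => qs = [] ∧
      ∃ i' ≤ k, (∀ m < i', N < sqNorm k (carryAt z m)) ∧ sqNorm k (carryAt z i') ≤ N ∧
        ∃ p, Rep k B σ' n M N a (sqNorm k (carryAt z i')) w j W p (carryAt z i') acc := by
  induction hi using Nat.decreasingInduction with
  | self =>
    intro σ h hmin
    have h1 := sqNorm_carryAt_last hzk
    refine (Reach.loop_stop h.fits (by decide) ?_ ⟨rfl, k, le_rfl, hmin, by omega, _, h⟩).mono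
      (by omega) fun _ _ h => h
    simp [Expr.val, h.c5, h.c3]
    omega
  | of_succ i hi ih =>
    intro σ h hmin
    by_cases hover : N < sqNorm k (carryAt z i)
    · have hc := sqNorm_carryAt_le hi.le hzN
      have hc' := sqNorm_carryAt_le (i := i + 1) hi hzN
      have hu := sqNorm_update hi.le (carryAt z i) 0
      have hu2 := sqNorm_update (i := i + 1) hi (Function.update (carryAt z i) i 0)
        (zigzagNext (z (i + 1)))
      rw [← carryAt_succ] at hu2
      have hzi : Function.update (carryAt z i) i 0 (i + 1) = z (i + 1) := by
        rw [Function.update_of_ne (by omega), carryAt_gt (by omega)]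
      have hnn := sqNorm_nonneg k (Function.update (carryAt z i) i 0)
      have hnn' := sqNorm_nonneg k (carryAt z (i + 1))
      have hsq := sq_nonneg (carryAt z i i)
      have hb1 : bits (sqNorm k (Function.update (carryAt z i) i 0)) ≤ B := by
        apply bits_le_of_abs_lt
        rw [abs_of_nonneg hnn]
        omega
      have hb2 : bits (10 + ((i + 1 : ℕ) : ℤ)) ≤ B := by
        apply bits_le_of_abs_lt
        rw [abs_of_nonneg (by positivity)]
        omega
      have hb3 : bits (zigzagNext (z (i + 1))) ≤ B := by
        apply bits_le_of_abs_lt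
        have := abs_le_sqNorm (i := i + 1) hi (carryAt z (i + 1))
        rw [carryAt_self] at this
        omega
      have hb4 : bits (sqNorm k (carryAt z (i + 1))) ≤ B := by
        apply bits_le_of_abs_lt
        rw [abs_of_nonneg hnn']
        omega
      refine (Reach.loop_step (n₁ := 6) (n₂ := 7 * (k - (i + 1)) + 1) h.fits (by decide) ?_
        (Q₁ := fun σ' qs => qs = [] ∧ Rep k B σ' n M N a (sqNorm k (carryAt z (i + 1))) w j W
          (10 + ((i + 1 : ℕ) : ℤ)) (carryAt z (i + 1)) acc) ?_ ?_).mono (by omega) fun _ _ h => h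
      · simp [Expr.val, h.c5, h.c3]
        omega
      · refine Reach.seq (n₁ := 1) (n₂ := 5) (Q₁ := fun σ' qs => qs = [] ∧
          Rep k B σ' n M N a (sqNorm k (Function.update (carryAt z i) i 0)) w j W (10 + i)
            (carryAt z i) acc) (Reach.store_eq (i := 5) h.fits (by decide) (by decide) rfl
            ?_ (by omega) hb1 ⟨rfl, h.set5 hb1⟩) ?_
        · have hp := h.val_pointed rfl
          have e : (Expr.sub (var 5) (.mul pointed pointed)).val σ =
            (var 5).val σ - pointed.val σ * pointed.val σ := rfl
          rw [e, hp, hu]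
          simp [Expr.val, h.c5]
          ring
        rintro σ₁ _ ⟨rfl, h₁⟩
        refine Reach.seq (n₁ := 1) (n₂ := 4) (Q₁ := fun σ' qs => qs = [] ∧
          Rep k B σ' n M N a (sqNorm k (Function.update (carryAt z i) i 0)) w j W (10 + i)
            (Function.update (carryAt z i) i 0) acc) (Reach.store_eq (v := 0) h₁.fits (by decide)
            (by decide) (h₁.addr_var9 rfl) rfl (by omega) (by simp [bits])
            ⟨rfl, h₁.setZ hi.le (by simp [bits])⟩) ?_
        rintro σ₂ _ ⟨rfl, h₂⟩
        refine Reach.seq (n₁ := 1) (n₂ := 3) (Q₁ := fun σ' qs => qs = [] ∧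
          Rep k B σ' n M N a (sqNorm k (Function.update (carryAt z i) i 0)) w j W
            (10 + ((i + 1 : ℕ) : ℤ)) (Function.update (carryAt z i) i 0) acc)
            (Reach.store_eq (i := 9) h₂.fits (by decide)
            (by decide) rfl ?_ (by omega) hb2 ⟨rfl, h₂.set9 hb2⟩) ?_
        · simp [Expr.val, h₂.c9]
          ring
        rintro σ₃ _ ⟨rfl, h₃⟩
        have := reach_increment (φ := φ) h₃ (i := i + 1) rfl hi (by rwa [hzi])
          (by rw [hzi]; rw [hzi] at hu2; rwa [← hu2])
        rw [hzi] at this hu2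
        rw [← hu2, ← carryAt_succ] at this
        simpa using this
      · rintro σ₁ _ ⟨rfl, h₁⟩
        exact ih h₁ fun m hm => by
          rcases Nat.lt_succ_iff_lt_or_eq.1 hm with hm | rfl
          · exact hmin m hm
          · exact hover
    · refine (Reach.loop_stop h.fits (by decide) ?_
        ⟨rfl, i, hi.le, hmin, not_lt.1 hover, _, h⟩).mono (by omega) fun _ _ h => h
      simp [Expr.val, h.c5, h.c3]
      omega

theorem reach_advance (h : Rep k B σ n M N a (sqNorm k z) w j W p z acc)
    (hN : 1 ≤ N) (hzN : sqNorm k z ≤ N) (hzk : z k = 0)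
    (hB : 4 * N + 1 < 2 ^ B) (hBk : 10 + (k : ℤ) < 2 ^ B) :
    Reach φ B advance σ (7 * k + 5) fun σ' qs => qs = [] ∧
      ∃ i ≤ k, (∀ m < i, N < sqNorm k (carryAt z m)) ∧ sqNorm k (carryAt z i) ≤ N ∧
        ∃ p, Rep k B σ' n M N a (sqNorm k (carryAt z i)) w j W p (carryAt z i) acc := by
  have hc := sqNorm_carryAt_le (Nat.zero_le k) hzN
  have hu := sqNorm_update (Nat.zero_le k) z (zigzagNext (z 0))
  rw [← carryAt_zero] at hu
  have hnn := sqNorm_nonneg k (carryAt z 0)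
  have hb1 : bits 10 ≤ B := by
    apply bits_le_of_abs_lt
    rw [abs_of_nonneg (by positivity)]
    omega
  have hb3 : bits (zigzagNext (z 0)) ≤ B := by
    apply bits_le_of_abs_lt
    have := abs_le_sqNorm (Nat.zero_le k) (carryAt z 0)
    rw [carryAt_self] at this
    omega
  have hb4 : bits (sqNorm k (carryAt z 0)) ≤ B := by
    apply bits_le_of_abs_lt
    rw [abs_of_nonneg hnn]
    omega
  refine (Reach.seq (n₁ := 1) (n₂ := 3 + (7 * (k - 0) + 1)) (Q₁ := fun σ' qs => qs = [] ∧
    Rep k B σ' n M N a (sqNorm k z) w j W 10 z acc) (Reach.store_eq (i := 9) (v := 10) h.fits (by decide)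
      (by decide) rfl rfl (by omega) hb1 ⟨rfl, h.set9 hb1⟩) ?_).mono (by omega) fun _ _ h => h
  rintro σ₁ _ ⟨rfl, h₁⟩
  refine Reach.seq (reach_increment h₁ (i := 0) rfl (Nat.zero_le k) hb3 (by rwa [← hu])) ?_
  rintro σ₂ _ ⟨rfl, h₂⟩
  rw [← hu, ← carryAt_zero] at h₂
  exact reach_carry_loop hN hzN hzk hB hBk (Nat.zero_le k) h₂ fun m hm => absurd hm (by omega)

/-- After j passes the first min j s factors are a - 1 and the other ones a (j - s is truncated
subtraction); the partial product stays below a^N, which bounds its bit length. -/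
theorem reach_weight_loop {a N s B : ℕ} (ha : 1 ≤ a) (hB : a ^ N < 2 ^ B) (hBN : N < 2 ^ B)
    {j : ℕ} (hj : j ≤ N) :
    ∀ {σ : State}, Rep k B σ n M N a s (((a - 1) ^ min j s * a ^ (j - s) : ℕ) : ℤ) j W p z acc →
    Reach φ B (.loop (.sub (var 3) (var 7)) weightBody) σ (4 * (N - j) + 1) fun σ' qs => qs = [] ∧
      Rep k B σ' n M N a s (((a - 1) ^ min N s * a ^ (N - s) : ℕ) : ℤ) N W p z acc := by
  induction hj using Nat.decreasingInduction with
  | self =>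
    intro σ h
    refine (Reach.loop_stop h.fits (by decide) ?_ ⟨rfl, h⟩).mono (by omega) fun _ _ h => h
    simp [Expr.val, h.c3, h.c7]
  | of_succ j hj ih =>
    intro σ h
    have hb1 : bits (((a - 1) ^ min (j + 1) s * a ^ (j + 1 - s) : ℕ) : ℤ) ≤ B := by
      rw [bits_le_iff, Int.natAbs_natCast]
      refine lt_of_le_of_lt ?_ hB
      calc (a - 1) ^ min (j + 1) s * a ^ (j + 1 - s) ≤ a ^ min (j + 1) s * a ^ (j + 1 - s) := by
            gcongr; omega
        _ = a ^ (j + 1) := by rw [← pow_add]; congr 1; omega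
        _ ≤ a ^ N := Nat.pow_le_pow_right ha hj
    have hb2 : bits ((j + 1 : ℕ) : ℤ) ≤ B := by
      rw [bits_le_iff, Int.natAbs_natCast]
      omega
    refine (Reach.loop_step (n₁ := 3) (n₂ := 4 * (N - (j + 1)) + 1) h.fits (by decide) ?_
      (Q₁ := fun σ' qs => qs = [] ∧ Rep k B σ' n M N a s
        (((a - 1) ^ min (j + 1) s * a ^ (j + 1 - s) : ℕ) : ℤ) ((j + 1 : ℕ) : ℤ) W p z acc)
      ?_ ?_).mono (by omega) fun _ _ h => h
    · simp [Expr.val, h.c3, h.c7]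
      omega
    · refine Reach.seq (n₁ := 1 + 1) (n₂ := 1) (Q₁ := fun σ' qs => qs = [] ∧ Rep k B σ' n M N a s
        (((a - 1) ^ min (j + 1) s * a ^ (j + 1 - s) : ℕ) : ℤ) j W p z acc)
        (Reach.ite h.fits (by decide) (fun hpos => ?_) (fun hpos => ?_)) ?_
      · simp [Expr.val, h.c5, h.c7] at hpos
        refine Reach.store_eq (i := 6) h.fits (by decide) (by decide) rfl ?_ (by omega) hb1
          ⟨rfl, h.set6 hb1⟩
        simp only [Expr.val, Int.toNat, h.c6, h.c4]
        rw [min_eq_left (by omega : j ≤ s), min_eq_left (by omega : j + 1 ≤ s),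
          Nat.sub_eq_zero_of_le (by omega : j ≤ s), Nat.sub_eq_zero_of_le (by omega : j + 1 ≤ s)]
        push_cast [ha]
        ring
      · simp [Expr.val, h.c5, h.c7] at hpos
        refine Reach.store_eq (i := 6) h.fits (by decide) (by decide) rfl ?_ (by omega) hb1
          ⟨rfl, h.set6 hb1⟩
        simp only [Expr.val, Int.toNat, h.c6, h.c4]
        rw [min_eq_right (by omega : s ≤ j), min_eq_right (by omega : s ≤ j + 1),
          Nat.succ_sub (by omega : s ≤ j), pow_succ]
        push_cast
        ring
      · rintro σ₁ _ ⟨rfl, h₁⟩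
        refine Reach.store_eq (i := 7) h₁.fits (by decide) (by decide) rfl ?_ (by omega) hb2
          ⟨rfl, h₁.set7 hb2⟩
        simp [Expr.val, h₁.c7]
    · rintro σ₁ _ ⟨rfl, h₁⟩
      exact ih h₁

theorem reach_computeWeight {a N s B : ℕ} (h : Rep k B σ n M N a s w j W p z acc)
    (ha : 1 ≤ a) (hB : a ^ N < 2 ^ B) (hBN : N < 2 ^ B) (hs : s ≤ N) :
    Reach φ B computeWeight σ (4 * N + 3) fun σ' qs => qs = [] ∧
      Rep k B σ' n M N a s (((a - 1) ^ s * a ^ (N - s) : ℕ) : ℤ) N W p z acc := by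
  have hb1 : bits 1 ≤ B := h.fits.pos
  have hb0 : bits 0 ≤ B := Nat.zero_le B
  refine (Reach.seq (n₁ := 1) (n₂ := 1 + (4 * (N - 0) + 1)) (Q₁ := fun σ' qs => qs = [] ∧
    Rep k B σ' n M N a s 1 j W p z acc) (Reach.store_eq (i := 6) (v := 1) h.fits (by decide)
      (by decide) rfl rfl (by omega) hb1 ⟨rfl, h.set6 hb1⟩) ?_).mono (by omega) fun _ _ h => h
  rintro σ₁ _ ⟨rfl, h₁⟩
  refine Reach.seq (n₁ := 1) (Q₁ := fun σ' qs => qs = [] ∧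
    Rep k B σ' n M N a s 1 0 W p z acc) (Reach.store_eq (i := 7) (v := 0) h₁.fits (by decide)
      (by decide) rfl rfl (by omega) hb0 ⟨rfl, h₁.set7 hb0⟩) ?_
  rintro σ₂ _ ⟨rfl, h₂⟩
  refine (reach_weight_loop ha hB hBN (Nat.zero_le N) (by simpa using h₂)).mono le_rfl ?_
  rintro σ₃ qs ⟨rfl, h₃⟩
  rw [min_eq_right hs] at h₃
  exact ⟨rfl, h₃⟩

end Specification

/-- The integer weight of a lattice point. -/
def gridWeight {k : ℕ} (a N : ℕ) (y : Fin k → ℤ) : ℤ :=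
  (((a - 1) ^ (∑ i, y i ^ 2).toNat * a ^ (N - (∑ i, y i ^ 2).toNat) : ℕ) : ℤ)

/-- The grid point with numerators `y` and denominator `M`. -/
noncomputable def gridPoint {k : ℕ} (M : ℕ) (y : Fin k → ℤ) : Fin k → ℝ := fun i => y i / M

theorem gridWeight_nonneg {k : ℕ} (a N : ℕ) (y : Fin k → ℤ) : 0 ≤ gridWeight a N y :=
  Int.natCast_nonneg _

theorem gridWeight_le {k a N : ℕ} (ha : 1 ≤ a) {y : Fin k → ℤ} (hy : y ∈ latticeBall k N) :
    gridWeight a N y ≤ (a : ℤ) ^ N := by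
  have h := mem_latticeBall.1 hy
  have : (a - 1) ^ (∑ i, y i ^ 2).toNat * a ^ (N - (∑ i, y i ^ 2).toNat) ≤ a ^ N := by
    calc _ ≤ a ^ (∑ i, y i ^ 2).toNat * a ^ (N - (∑ i, y i ^ 2).toNat) := by
          gcongr; omega
      _ = a ^ N := by rw [← pow_add]; congr 1; omega
  rw [gridWeight]
  exact_mod_cast this

theorem sqNorm_extendZero {k : ℕ} (y : Fin k → ℤ) : sqNorm k (extendZero y) = ∑ i, y i ^ 2 :=
  sum_range_extendZero_sq y

/-! ### The main loop and the whole program -/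

section Specification

variable {k B n M N a : ℕ} {φ : (Fin k → ℝ) → ℝ}

/-- A condition under which all numbers that occur in a run have at most `B` bits. -/
structure BitBound (k B n M N a : ℕ) : Prop where
  one_le_radius : 1 ≤ N
  one_le_den : 1 ≤ a
  total : (latticeBall k N).card * a ^ N < 2 ^ B
  radius : 4 * N + 1 < 2 ^ B
  addr : 10 + k < 2 ^ B
  input : n < 2 ^ B
  fineness : M < 2 ^ B
  den : a < 2 ^ B

theorem BitBound.pow_lt (h : BitBound k B n M N a) : a ^ N < 2 ^ B := by
  refine lt_of_le_of_lt ?_ h.total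
  have : 0 < (latticeBall k N).card := Finset.card_pos.2 ⟨0, mem_latticeBall.2 (by simp)⟩
  exact Nat.le_mul_of_pos_left _ this

theorem BitBound.bits_sum (h : BitBound k B n M N a) {S : Finset (Fin k → ℤ)}
    (hS : S ⊆ latticeBall k N) : bits (∑ y ∈ S, gridWeight a N y) ≤ B := by
  apply bits_le_of_abs_lt
  rw [abs_of_nonneg (Finset.sum_nonneg fun y _ => gridWeight_nonneg a N y)]
  calc ∑ y ∈ S, gridWeight a N y ≤ S.card • (a : ℤ) ^ N :=
        Finset.sum_le_card_nsmul _ _ _ fun y hy => gridWeight_le h.one_le_den (hS hy)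
    _ ≤ (latticeBall k N).card • (a : ℤ) ^ N :=
        nsmul_le_nsmul_left (by positivity) (Finset.card_le_card hS)
    _ < 2 ^ B := by
      rw [nsmul_eq_mul]
      exact_mod_cast h.total

/-- The state of the memory when the lattice points of `S` have been processed. -/
def AfterPoints (φ : (Fin k → ℝ) → ℝ) (B n M N a : ℕ) (σ : State) (S : Finset (Fin k → ℤ))
    (z : ℕ → ℤ) : Prop :=
  ∃ w j p, Rep k B σ n M N a (sqNorm k z) w j (∑ y ∈ S, gridWeight a N y) p z
    (∑ y ∈ S, gridWeight a N y * φ (gridPoint M y))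

theorem reach_body (hB : BitBound k B n M N a) {z : Fin k → ℤ} (hz : z ∈ latticeBall k N)
    {σ : State}
    (h : AfterPoints φ B n M N a σ (ballBefore k N (extendZero z)) (extendZero z)) :
    Reach φ B body σ (4 * N + 7 * k + 11) fun σ' qs => qs = [gridPoint M z] ∧
      ∃ i ≤ k, (∀ m < i, (N : ℤ) < sqNorm k (carryAt (extendZero z) m)) ∧
        sqNorm k (carryAt (extendZero z) i) ≤ N ∧
        AfterPoints φ B n M N a σ' (insert z (ballBefore k N (extendZero z)))
          (carryAt (extendZero z) i) := by
  obtain ⟨w, j, p, h⟩ := h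
  have hzN : sqNorm k (extendZero z) ≤ N := by rw [sqNorm_extendZero]; exact mem_latticeBall.1 hz
  have hnn := sqNorm_nonneg k (extendZero z)
  have hrad := hB.radius
  have hs : sqNorm k (extendZero z) = ((sqNorm k (extendZero z)).toNat : ℤ) := by omega
  have hw : gridWeight a N z = (((a - 1) ^ (sqNorm k (extendZero z)).toNat *
      a ^ (N - (sqNorm k (extendZero z)).toNat) : ℕ) : ℤ) := by
    rw [sqNorm_extendZero]; rfl
  have hsub : insert z (ballBefore k N (extendZero z)) ⊆ latticeBall k N := by
    intro y hy
    rcases Finset.mem_insert.1 hy with rfl | hy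
    exacts [hz, (mem_ballBefore.1 hy).1]
  have hbW := hB.bits_sum hsub
  have hW := Finset.sum_insert (f := gridWeight a N) (notMem_ballBefore_self (N := N) z)
  have hA := Finset.sum_insert (f := fun y => (gridWeight a N y : ℝ) * φ (gridPoint M y))
    (notMem_ballBefore_self (N := N) z)
  rw [hs] at h
  refine (Reach.seq (n₂ := 1 + (1 + (1 + (7 * k + 5)))) (reach_computeWeight h hB.one_le_den
    hB.pow_lt (by omega) (by omega)) ?_).mono (by omega) fun _ _ h => h
  rintro σ₁ _ ⟨rfl, h₁⟩
  rw [← hw, ← hs] at h₁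
  refine Reach.seq (Q₁ := fun σ' qs => qs = [] ∧
    Rep k B σ' n M N a (sqNorm k (extendZero z)) (gridWeight a N z) N
      (∑ y ∈ insert z (ballBefore k N (extendZero z)), gridWeight a N y) p (extendZero z)
      (∑ y ∈ ballBefore k N (extendZero z), gridWeight a N y * φ (gridPoint M y)))
    (Reach.store_eq (i := 8) h₁.fits (by decide) (by decide) rfl ?_ (by omega) hbW
      ⟨rfl, h₁.set8 hbW⟩) ?_
  · simp only [Expr.val, Int.toNat, h₁.c8, h₁.c6]
    rw [hW, add_comm]
  rintro σ₂ _ ⟨rfl, h₂⟩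
  have hpt : point k σ₂ 10 M = gridPoint M z := by
    ext i
    rw [point, gridPoint, h₂.cz, extendZero, dif_pos i.isLt]
    simp
  refine Reach.seq (Q₁ := fun σ' qs => qs = [gridPoint M z] ∧ σ'.real 2 = φ (gridPoint M z) ∧
    Rep k B σ' n M N a (sqNorm k (extendZero z)) (gridWeight a N z) N
      (∑ y ∈ insert z (ballBefore k N (extendZero z)), gridWeight a N y) p (extendZero z)
      (∑ y ∈ ballBefore k N (extendZero z), gridWeight a N y * φ (gridPoint M y)))
    (Reach.query h₂.fits (by decide) (by decide) (by decide) (show 2 < 3 by decide)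
      (show 10 ≤ 10 by decide) ?_) ?_
  · have e1 : (Expr.const 2).addr σ₂ = 2 := rfl
    have e2 : (Expr.const 10).addr σ₂ = 10 := rfl
    have e3 : (var 2).val σ₂ = M := h₂.c2
    rw [e1, e2, e3, hpt]
    exact ⟨rfl, by simp, h₂.setReal2 _⟩
  rintro σ₃ _ ⟨rfl, h2, h₃⟩
  refine Reach.seq (Q₁ := fun σ' qs => qs = [] ∧
    Rep k B σ' n M N a (sqNorm k (extendZero z)) (gridWeight a N z) N
      (∑ y ∈ insert z (ballBefore k N (extendZero z)), gridWeight a N y) p (extendZero z)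
      (∑ y ∈ insert z (ballBefore k N (extendZero z)), gridWeight a N y * φ (gridPoint M y)))
    (Reach.addScaled h₃.fits (by decide) (by decide) (by decide) (by decide)
      (show 1 < 3 by decide) ?_) ?_
  · refine ⟨rfl, ?_⟩
    have e1 : (Expr.const 1).addr σ₃ = 1 := rfl
    have e2 : (Expr.const 2).addr σ₃ = 2 := rfl
    have e3 : (var 6).val σ₃ = gridWeight a N z := h₃.c6
    have e4 : (Expr.const 1).val σ₃ = 1 := rfl
    rw [e1, e2, e3, e4, h₃.r1, h2, hA]
    convert h₃.setReal1 _ using 1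
    push_cast
    ring
  rintro σ₄ _ ⟨rfl, h₄⟩
  refine (reach_advance h₄ (by exact_mod_cast hB.one_le_radius) hzN (extendZero_of_ge z le_rfl)
    (by exact_mod_cast hB.radius) (by exact_mod_cast hB.addr)).mono le_rfl ?_
  rintro σ₅ qs ⟨rfl, i, hi, hmin, hle, p', h₅⟩
  exact ⟨rfl, i, hi, hmin, hle, _, _, p', h₅⟩

theorem mainGuard_val {σ : State} {S : Finset (Fin k → ℤ)} {z : ℕ → ℤ}
    (h : AfterPoints φ B n M N a σ S z) : mainGuard.val σ = 1 - z k := by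
  obtain ⟨w, j, p, h⟩ := h
  simp only [Expr.val]
  have : (10 + σ.cell (Int.toNat 0)).toNat = 10 + k := by
    have := h.c0
    simp only [Int.toNat_zero, this]
    omega
  rw [this, h.cz]

/-- Strong induction on the number of unvisited points of the ball: one pass removes exactly the
current point from them. -/
theorem reach_mainLoop (hB : BitBound k B n M N a) {z : Fin k → ℤ} (hz : z ∈ latticeBall k N)
    {σ : State}
    (h : AfterPoints φ B n M N a σ (ballBefore k N (extendZero z)) (extendZero z)) :
    Reach φ B (.loop mainGuard body) σ
      ((4 * N + 7 * k + 12) * (latticeBall k N \ ballBefore k N (extendZero z)).card + 1)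
      fun σ' qs => (∀ x, x ∈ qs ↔
        ∃ y ∈ latticeBall k N \ ballBefore k N (extendZero z), gridPoint M y = x) ∧
        ∃ z', AfterPoints φ B n M N a σ' (latticeBall k N) z' := by
  induction hr : (latticeBall k N \ ballBefore k N (extendZero z)).card using Nat.strong_induction_on
    generalizing z σ with
  | _ r ih =>
    have hmem : z ∈ latticeBall k N \ ballBefore k N (extendZero z) :=
      Finset.mem_sdiff.2 ⟨hz, notMem_ballBefore_self z⟩
    have hcard := Finset.card_erase_add_one hmem
    rw [← Finset.sdiff_insert] at hcard
    set R := (latticeBall k N \ insert z (ballBefore k N (extendZero z))).card with hR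
    have hg := mainGuard_val h
    rw [extendZero_of_ge z le_rfl] at hg
    have hfits : Fits k B σ := by obtain ⟨_, _, _, h⟩ := h; exact h.fits
    refine (Reach.loop_step (n₂ := (4 * N + 7 * k + 12) * R + 1) hfits (by decide) (by omega)
      (reach_body hB hz h) ?_).mono (by rw [← hr, ← hcard]; ring_nf; omega) fun _ _ h => h
    rintro σ₁ _ ⟨rfl, i, hi, hmin, hle, h₁⟩
    have hfits₁ : Fits k B σ₁ := by obtain ⟨_, _, _, h⟩ := h₁; exact h.fits
    have hbefore := ballBefore_carryAt hz hmin
    have hsplit : ∀ (T : Finset (Fin k → ℤ)) (x : Fin k → ℝ) (qs : List (Fin k → ℝ)),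
        T = latticeBall k N \ insert z (ballBefore k N (extendZero z)) →
        (x ∈ qs ↔ ∃ y ∈ T, gridPoint M y = x) →
        (x ∈ [gridPoint M z] ++ qs ↔
          ∃ y ∈ latticeBall k N \ ballBefore k N (extendZero z), gridPoint M y = x) := by
      rintro T x qs rfl hT
      rw [List.mem_append, List.mem_singleton, hT, ← Finset.insert_erase hmem,
        ← Finset.sdiff_insert, Finset.exists_mem_insert]
      exact or_congr eq_comm Iff.rfl
    -- If the carry reached coordinate k, the whole ball has been visited and the guard equals 1 - 1
    -- = 0. Otherwise the overflow coordinate is still 0 and the new point lies in the ball.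
    rcases eq_or_lt_of_le hi with rfl | hi
    · have hfull := ballBefore_carryAt_last (N := N) z
      rw [hbefore] at hfull
      have hg₁ := mainGuard_val h₁
      rw [carryAt_self, extendZero_of_ge z le_rfl] at hg₁
      refine (Reach.loop_stop hfits₁ (by decide) (by rw [hg₁]; decide) ?_).mono (by omega)
        fun _ _ h => h
      rw [hfull] at h₁
      refine ⟨fun x => hsplit ∅ x [] ?_ (by simp), _, h₁⟩
      rw [hfull, Finset.sdiff_self]
    · have hext : carryAt (extendZero z) i =
          extendZero fun m : Fin k => carryAt (extendZero z) i m := by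
        ext m
        rw [extendZero]
        split_ifs with hm
        · rfl
        · rw [carryAt_gt (by omega), extendZero_of_ge z (by omega)]
      rw [← hbefore] at h₁ hR hsplit
      rw [hext] at h₁ hR hsplit hle
      set z' : Fin k → ℤ := fun m : Fin k => carryAt (extendZero z) i m
      have hz' : z' ∈ latticeBall k N := by
        rw [mem_latticeBall, ← sqNorm_extendZero]
        exact hle
      refine (ih R (by omega) hz' h₁ hR.symm).mono le_rfl ?_
      rintro σ₂ qs ⟨h1, h2⟩
      exact ⟨fun x => hsplit _ x qs rfl (h1 x), h2⟩

theorem initial_fits (hB : BitBound k B n M N a) : Fits k B (initial k n) := by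
  have hBpos : 1 ≤ B := by
    by_contra hcon
    have : B = 0 := by omega
    have := hB.radius
    subst B
    omega
  have hcell : ∀ b, (initial k n).cell b = if b = 0 then (k : ℤ) else if b = 1 then n else 0 := by
    intro b
    rw [initial]
    rcases b with _ | _ | b <;> simp
  refine ⟨hBpos, fun b => ?_, fun b hb => ?_, fun r _ => rfl⟩
  · rw [hcell, bits_le_iff]
    have := hB.addr
    have := hB.input
    split_ifs <;> simp <;> omega
  · rw [hcell, if_neg (by omega), if_neg (by omega)]

theorem reach_setup (hM : M = 64 * n) (hN : N = 256 * (n * k) * (M * M)) (ha : a = 2 * (M * M))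
    (hB : BitBound k B n M N a) :
    Reach φ B setup (initial k n) 3 fun σ' qs => qs = [] ∧
      Rep k B σ' n M N a 0 0 0 0 0 0 0 := by
  have h : Rep k B (initial k n) n 0 0 0 0 0 0 0 0 0 0 := by
    refine ⟨initial_fits hB, ?_, ?_, ?_, ?_, ?_, ?_, ?_, ?_, ?_, ?_, fun i => ?_, rfl, rfl⟩ <;>
      simp [initial, Finsupp.single_apply]
    omega
  have hbM : bits (M : ℤ) ≤ B := by rw [bits_le_iff]; exact hB.fineness
  have hbN : bits (N : ℤ) ≤ B := by
    rw [bits_le_iff, Int.natAbs_natCast]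
    have := hB.radius
    omega
  have hba : bits (a : ℤ) ≤ B := by rw [bits_le_iff]; exact hB.den
  refine Reach.seq (n₁ := 1) (n₂ := 1 + 1) (Q₁ := fun σ' qs => qs = [] ∧
    Rep k B σ' n M 0 0 0 0 0 0 0 0 0) (Reach.store_eq (i := 2) h.fits (by decide) (by decide) rfl
      ?_ (by omega) hbM ⟨rfl, h.set2 hbM⟩) ?_
  · simp only [Expr.val, Int.toNat, h.c1, hM]
    push_cast
    rfl
  rintro σ₁ _ ⟨rfl, h₁⟩
  refine Reach.seq (Q₁ := fun σ' qs => qs = [] ∧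
    Rep k B σ' n M N 0 0 0 0 0 0 0 0) (Reach.store_eq (i := 3) h₁.fits (by decide) (by decide) rfl
      ?_ (by omega) hbN ⟨rfl, h₁.set3 hbN⟩) ?_
  · simp only [Expr.val, Int.toNat, h₁.c0, h₁.c1, h₁.c2, hN]
    push_cast
    rfl
  rintro σ₂ _ ⟨rfl, h₂⟩
  refine Reach.store_eq (i := 4) h₂.fits (by decide) (by decide) rfl
      ?_ (by omega) hba ⟨rfl, h₂.set4 hba⟩
  simp only [Expr.val, Int.toNat, h₂.c2, ha]
  push_cast
  rfl

theorem reach_gridProgram (hM : M = 64 * n) (hN : N = 256 * (n * k) * (M * M))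
    (ha : a = 2 * (M * M)) (hB : BitBound k B n M N a) :
    Reach φ B gridProgram (initial k n)
      ((4 * N + 7 * k + 12) * (latticeBall k N).card + 5) fun σ' qs =>
      (∀ x, x ∈ qs ↔ x ∈ (latticeBall k N).image (gridPoint M)) ∧
        σ'.output = 4 * n / ((4 * n + 1) * (∑ y ∈ latticeBall k N, gridWeight a N y : ℤ)) *
          ∑ y ∈ latticeBall k N, gridWeight a N y * φ (gridPoint M y) := by
  refine (Reach.seq (n₂ := (4 * N + 7 * k + 12) * (latticeBall k N).card + 1 + 1)
    (reach_setup hM hN ha hB) ?_).mono (by omega) fun _ _ h => h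
  rintro σ₁ _ ⟨rfl, h₁⟩
  have hext : extendZero (0 : Fin k → ℤ) = 0 := by
    ext i
    simp [extendZero]
  have hbefore : ballBefore k N (extendZero (0 : Fin k → ℤ)) = ∅ := by
    rw [hext, ballBefore_zero]
  have h₁' : AfterPoints φ B n M N a σ₁ (ballBefore k N (extendZero (0 : Fin k → ℤ)))
      (extendZero (0 : Fin k → ℤ)) := by
    refine ⟨0, 0, 0, ?_⟩
    rw [hbefore, Finset.sum_empty, Finset.sum_empty, hext]
    convert h₁ using 1
    simp [sqNorm]
  have hmain := reach_mainLoop hB (mem_latticeBall.2 (by simp)) h₁'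
  rw [hbefore, Finset.sdiff_empty] at hmain
  refine Reach.seq hmain ?_
  rintro σ₂ qs ⟨hqs, z', w, j, p, h₂⟩
  refine Reach.addScaled h₂.fits (by decide) (by decide) (by decide) (by decide)
    (show 0 < 3 by decide) ?_
  refine ⟨fun x => ?_, ?_⟩
  · rw [List.nil_append, List.append_nil, hqs, Finset.mem_image]
  · have e1 : (Expr.const 0).addr σ₂ = 0 := rfl
    have e2 : (Expr.const 1).addr σ₂ = 1 := rfl
    have e3 : (Expr.mul (.const 4) (var 1)).val σ₂ = 4 * n := by
      simp only [Expr.val, Int.toNat, h₂.c1]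
    have e4 : (Expr.mul (.add (.mul (.const 4) (var 1)) (.const 1)) (var 8)).val σ₂ =
        (4 * n + 1) * ∑ y ∈ latticeBall k N, gridWeight a N y := by
      simp only [Expr.val, Int.toNat, h₂.c1, h₂.c8]
    rw [State.output, State.setReal_real, e1, e2, e3, e4, if_pos rfl, h₂.r0, h₂.r1, zero_add]
    push_cast
    ring

end Specification

end OracleRAM

/-! ### From the integer run to the approximation and the resource bounds -/

open OracleRAM

/-- Since exp(-l) = (a - 1)/a, the integer weight is the Gaussian one with denominators cleared by
a^N, a factor that cancels in the quotient T/W. -/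
theorem gridWeight_eq_exp {k a N : ℕ} (ha : 2 ≤ a) {l : ℝ} (hl : l = -Real.log (1 - 1 / a))
    {y : Fin k → ℤ} (hy : y ∈ latticeBall k N) :
    (gridWeight a N y : ℝ) = (a : ℝ) ^ N * Real.exp (-(l * ∑ i, (y i : ℝ) ^ 2)) := by
  have h := mem_latticeBall.1 hy
  have h0 : 0 ≤ ∑ i, y i ^ 2 := Finset.sum_nonneg fun i _ => sq_nonneg _
  obtain ⟨m, hm⟩ := Int.eq_ofNat_of_zero_le h0
  have hmN : m ≤ N := by omega
  have hmr : ∑ i, (y i : ℝ) ^ 2 = m := by exact_mod_cast hm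
  have ha0 : (0 : ℝ) < a := by positivity
  have ha2 : (2 : ℝ) ≤ a := by exact_mod_cast ha
  have hpos : 0 < 1 - 1 / (a : ℝ) := by
    rw [sub_pos, div_lt_one ha0]
    linarith
  rw [gridWeight, hm, hmr, hl, neg_mul, neg_neg, mul_comm (Real.log _), Real.exp_nat_mul,
    Real.exp_log hpos]
  simp only [Int.toNat_natCast]
  push_cast [show 1 ≤ a by omega]
  have e : (a : ℝ) ^ N = a ^ m * a ^ (N - m) := by rw [← pow_add]; congr 1; omega
  rw [e, show (1 - 1 / (a : ℝ)) = (a - 1) / a by field_simp, div_pow]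
  field_simp

/-- The weighted sum over the grid is a relative approximation of the Gaussian mean. -/
theorem gridSum_bounds {k n M N a : ℕ} (hk : 0 < k) (hn : 0 < n) (hM : M = 64 * n)
    (hN : N = 256 * (n * k) * (M * M)) (ha : a = 2 * (M * M)) (φ : Seminorm ℝ (Fin k → ℝ)) :
    (1 - 1 / (4 * n)) * (∫ x, φ x ∂stdNormal k) *
        (∑ y ∈ latticeBall k N, gridWeight a N y : ℤ) ≤
      ∑ y ∈ latticeBall k N, gridWeight a N y * φ (gridPoint M y) ∧
    ∑ y ∈ latticeBall k N, gridWeight a N y * φ (gridPoint M y) ≤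
      (1 + 1 / (4 * n)) * (∫ x, φ x ∂stdNormal k) *
        (∑ y ∈ latticeBall k N, gridWeight a N y : ℤ) := by
  have hn0 : (0 : ℝ) < n := by exact_mod_cast hn
  have hM1 : 1 ≤ M * M := Nat.mul_pos (by omega) (by omega)
  have ha2 : 2 ≤ a := by omega
  have hMr : (M : ℝ) = 64 * n := by rw [hM]; push_cast; rfl
  have hM0 : (0 : ℝ) < M := by rw [hMr]; positivity
  set δ : ℝ := 1 / (64 * n) with hδ
  have hδM : δ = 1 / M := by rw [hδ, hMr]
  have hδ2 : δ ^ 2 / 2 = 1 / a := by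
    rw [hδM, ha]
    push_cast
    field_simp
  set l : ℝ := -Real.log (1 - δ ^ 2 / 2) with hl
  have hb := truncated_lattice_sum_bounds hn hk φ (N := N) (S := latticeBall k N) hδ hl
    (by rw [hN, hδM]; push_cast; field_simp) (fun z hz => by
      rw [mem_latticeBall, not_le] at hz
      exact_mod_cast hz.le)
  have hw := fun y hy => gridWeight_eq_exp (k := k) (N := N) (y := y) ha2 (hδ2 ▸ hl) hy
  have hpt : ∀ y : Fin k → ℤ, (fun i => δ * (y i : ℝ)) = gridPoint M y := by
    intro y
    ext i
    rw [gridPoint, hδM]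
    ring
  simp only [hpt] at hb
  have hW : ((∑ y ∈ latticeBall k N, gridWeight a N y : ℤ) : ℝ) =
      (a : ℝ) ^ N * ∑ y ∈ latticeBall k N, Real.exp (-(l * ∑ i, (y i : ℝ) ^ 2)) := by
    push_cast
    rw [Finset.mul_sum]
    exact Finset.sum_congr rfl hw
  have hT : ∑ y ∈ latticeBall k N, gridWeight a N y * φ (gridPoint M y) =
      (a : ℝ) ^ N * ∑ y ∈ latticeBall k N,
        Real.exp (-(l * ∑ i, (y i : ℝ) ^ 2)) * φ (gridPoint M y) := by
    rw [Finset.mul_sum]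
    exact Finset.sum_congr rfl fun y hy => by rw [hw y hy, mul_assoc]
  have haN : (0 : ℝ) ≤ (a : ℝ) ^ N := by positivity
  rw [hW, hT]
  constructor
  · calc _ = (a : ℝ) ^ N * _ := by rw [mul_left_comm]
      _ ≤ _ := mul_le_mul_of_nonneg_left hb.1 haN
  · calc _ ≤ (a : ℝ) ^ N * _ := mul_le_mul_of_nonneg_left hb.2 haN
      _ = _ := by rw [mul_left_comm]

/-- A number of bits that suffices for all integers in a run. -/
def gridBits (k n : ℕ) : ℕ := 2 ^ 40 * (n ^ 5 * k)

/-- Here N = kL with L = 2^20 n³, and a = 2^13 n². The crude estimate x ≤ 2^x bounds a^N by 2^(aN),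
whose exponent is 2^33 n⁵k; this accounts for the fifth power in `gridBits`. -/
theorem bitBound_gridBits {k n M N a : ℕ} (hk : 0 < k) (hn : 0 < n) (hM : M = 64 * n)
    (hN : N = 256 * (n * k) * (M * M)) (ha : a = 2 * (M * M)) :
    (latticeBall k N).card ≤ (2 ^ 24 * n ^ 3) ^ k ∧ N = 2 ^ 20 * (n ^ 3 * k) ∧
      BitBound k (gridBits k n) n M N a := by
  have hN' : N = 2 ^ 20 * (n ^ 3 * k) := by rw [hN, hM]; ring
  have ha' : a = 2 ^ 13 * n ^ 2 := by rw [ha, hM]; ring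
  have h3 : 0 < n ^ 3 := by positivity
  have hcard : (latticeBall k N).card ≤ (2 ^ 24 * n ^ 3) ^ k := by
    have h := card_latticeBall_le k (L := 2 ^ 20 * n ^ 3) (by positivity)
    have e : k * (2 ^ 20 * n ^ 3) = N := by rw [hN']; ring
    rw [e] at h
    refine h.trans (Nat.pow_le_pow_left ?_ k)
    omega
  refine ⟨hcard, hN', ?_⟩
  have hnk : n ≤ n ^ 5 * k := (Nat.le_self_pow (by norm_num) n).trans (Nat.le_mul_of_pos_right _ hk)
  have h2k : n ^ 2 ≤ n ^ 5 * k :=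
    (Nat.pow_le_pow_right hn (by norm_num)).trans (Nat.le_mul_of_pos_right _ hk)
  have h3k : n ^ 3 * k ≤ n ^ 5 * k :=
    Nat.mul_le_mul_right k (Nat.pow_le_pow_right hn (by norm_num))
  have hkk : k ≤ n ^ 5 * k := Nat.le_mul_of_pos_left k (by positivity)
  have hlt : gridBits k n < 2 ^ gridBits k n := Nat.lt_two_pow_self
  have h3k' : 0 < n ^ 3 * k := by positivity
  refine ⟨by omega, by rw [ha']; exact Nat.mul_pos (by norm_num) (by positivity), ?_, ?_, ?_, ?_, ?_, ?_⟩
  · calc (latticeBall k N).card * a ^ N ≤ (2 ^ 24 * n ^ 3) ^ k * a ^ N := by gcongr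
      _ ≤ (2 ^ (2 ^ 24 * n ^ 3)) ^ k * (2 ^ a) ^ N := by
        gcongr
        · exact Nat.lt_two_pow_self.le
        · exact Nat.lt_two_pow_self.le
      _ = 2 ^ (2 ^ 24 * (n ^ 3 * k) + 2 ^ 33 * (n ^ 5 * k)) := by
        rw [← pow_mul, ← pow_mul, ← pow_add, hN', ha']
        congr 1
        ring
      _ < 2 ^ gridBits k n := by
        apply Nat.pow_lt_pow_right (by norm_num)
        unfold gridBits
        omega
  all_goals refine lt_of_lt_of_le (b := gridBits k n) ?_ hlt.le; unfold gridBits; omega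

theorem stepBound_gridBits_le {k n : ℕ} (hk : 0 < k) (hn : 0 < n) :
    stepBound k (gridBits k n) ≤ 2 ^ 64 * (n ^ 5 * k ^ 2) ∧
      spaceBound k (gridBits k n) ≤ 2 ^ 65 * (n ^ 5 * k ^ 2) := by
  have h1 : n ^ 5 * k ≤ n ^ 5 * k ^ 2 :=
    Nat.mul_le_mul_left _ (Nat.le_self_pow (by norm_num) k)
  have h2 : k ≤ k ^ 2 := Nat.le_self_pow (by norm_num) k
  have h3 : k ^ 2 ≤ n ^ 5 * k ^ 2 := Nat.le_mul_of_pos_left _ (by positivity)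
  have e1 : stepBound k (gridBits k n) =
      3000000 * 2 ^ 40 * (n ^ 5 * k) + 11 * k + k ^ 2 + 2 ^ 40 * (n ^ 5 * k ^ 2) := by
    unfold stepBound gridBits; ring
  have e2 : (11 + k) * (12 + k + gridBits k n) = 132 + 23 * k + k ^ 2 +
      11 * 2 ^ 40 * (n ^ 5 * k) + 2 ^ 40 * (n ^ 5 * k ^ 2) := by
    unfold gridBits; ring
  constructor
  · rw [e1]; omega
  · rw [spaceBound, e1, e2]; omega

/-- Everything is expressed in powers of m through 2 ≤ m, n ≤ m² and k ≤ m^k; the exponents add up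
to 105 + 33k ≤ 138k. -/
theorem time_le_pow {k n : ℕ} (hk : 0 < k) {m : ℝ} (hm : 2 ≤ m) (hnm : (n : ℝ) ≤ m ^ 2)
    {t c : ℕ} (hn : 0 < n) (hc : c ≤ (2 ^ 24 * n ^ 3) ^ k)
    (ht : t ≤ ((4 * (2 ^ 20 * (n ^ 3 * k)) + 7 * k + 12) * c + 5) * (2 ^ 64 * (n ^ 5 * k ^ 2))) :
    (t : ℝ) ≤ m ^ (138 * k) := by
  have h3k : k ≤ n ^ 3 * k := Nat.le_mul_of_pos_left k (by positivity)
  have hX : 1 ≤ (2 ^ 24 * n ^ 3) ^ k := Nat.one_le_pow _ _ (by positivity)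
  have h1 : t ≤ 2 ^ 89 * n ^ 8 * k ^ 3 * (2 ^ 24 * n ^ 3) ^ k := by
    refine ht.trans ?_
    have h : (4 * (2 ^ 20 * (n ^ 3 * k)) + 7 * k + 12) * c + 5 ≤
        2 ^ 25 * (n ^ 3 * k) * (2 ^ 24 * n ^ 3) ^ k := by
      calc _ ≤ (4 * (2 ^ 20 * (n ^ 3 * k)) + 7 * k + 12) * (2 ^ 24 * n ^ 3) ^ k +
            5 * (2 ^ 24 * n ^ 3) ^ k := by gcongr; omega
        _ = (4 * (2 ^ 20 * (n ^ 3 * k)) + 7 * k + 17) * (2 ^ 24 * n ^ 3) ^ k := by ring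
        _ ≤ _ := by gcongr; omega
    calc _ ≤ 2 ^ 25 * (n ^ 3 * k) * (2 ^ 24 * n ^ 3) ^ k * (2 ^ 64 * (n ^ 5 * k ^ 2)) := by gcongr
      _ = _ := by ring
  have hm0 : 0 ≤ m := by linarith
  have hm1 : 1 ≤ m := by linarith
  have hkm : (k : ℝ) ≤ m ^ k := by
    calc (k : ℝ) ≤ 2 ^ k := by exact_mod_cast Nat.lt_two_pow_self.le
      _ ≤ m ^ k := by gcongr
  have h1' : (t : ℝ) ≤ 2 ^ 89 * (n : ℝ) ^ 8 * (k : ℝ) ^ 3 * (2 ^ 24 * (n : ℝ) ^ 3) ^ k := by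
    exact_mod_cast h1
  calc (t : ℝ) ≤ 2 ^ 89 * (n : ℝ) ^ 8 * (k : ℝ) ^ 3 * (2 ^ 24 * (n : ℝ) ^ 3) ^ k := h1'
    _ ≤ m ^ 89 * (m ^ 2) ^ 8 * (m ^ k) ^ 3 * (m ^ 24 * (m ^ 2) ^ 3) ^ k := by gcongr
    _ = m ^ (105 + 33 * k) := by ring
    _ ≤ m ^ (138 * k) := pow_le_pow_right₀ hm1 (by omega)

theorem gridPoint_injective {k M : ℕ} (hM : 0 < M) :
    Function.Injective (gridPoint M : (Fin k → ℤ) → Fin k → ℝ) := by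
  intro y z h
  ext i
  have := congrFun h i
  simp only [gridPoint] at this
  rw [div_left_inj' (by positivity)] at this
  exact_mod_cast this

/-- The factor 4n/(4n + 1) cancels the possible excess 1 + 1/(4n); what remains on the other side is
(4n - 1)/(4n + 1), and (1 + 1/n)(4n - 1)/(4n + 1) ≥ 1. -/
theorem isFactorApprox_of_bounds {n : ℕ} (hn : 0 < n) {ε E W T : ℝ} (hε : 1 / (n : ℝ) ≤ ε)
    (hE : 0 ≤ E) (hW : 0 < W) (h1 : (1 - 1 / (4 * n)) * E * W ≤ T)
    (h2 : T ≤ (1 + 1 / (4 * n)) * E * W) :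
    IsFactorApprox (1 + ε) (4 * n / ((4 * n + 1) * W) * T) E := by
  have hn1 : (1 : ℝ) ≤ n := by exact_mod_cast hn
  have hκ : 0 ≤ 4 * n / ((4 * n + 1) * W) := by positivity
  constructor
  · calc _ ≤ 4 * n / ((4 * n + 1) * W) * ((1 + 1 / (4 * n)) * E * W) :=
          mul_le_mul_of_nonneg_left h2 hκ
      _ = E := by field_simp
  · have h3 : (4 * n - 1) / (4 * n + 1) * E ≤ 4 * n / ((4 * n + 1) * W) * T := by
      calc _ = 4 * n / ((4 * n + 1) * W) * ((1 - 1 / (4 * n)) * E * W) := by field_simp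
        _ ≤ _ := mul_le_mul_of_nonneg_left h1 hκ
    have h4 : 0 ≤ (4 * (n : ℝ) - 1) / (4 * n + 1) * E := by
      apply mul_nonneg _ hE
      apply div_nonneg <;> linarith
    have h5 : 1 ≤ (1 + 1 / (n : ℝ)) * ((4 * n - 1) / (4 * n + 1)) := by
      rw [show (1 + 1 / (n : ℝ)) * ((4 * n - 1) / (4 * n + 1)) =
        (n + 1) * (4 * n - 1) / (n * (4 * n + 1)) by field_simp, le_div_iff₀ (by positivity)]
      nlinarith
    calc E ≤ (1 + 1 / (n : ℝ)) * ((4 * n - 1) / (4 * n + 1)) * E := le_mul_of_one_le_left hE h5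
      _ = (1 + 1 / (n : ℝ)) * ((4 * n - 1) / (4 * n + 1) * E) := by ring
      _ ≤ (1 + ε) * (4 * n / ((4 * n + 1) * W) * T) := by
        apply mul_le_mul (by linarith) h3 h4
        have : 0 < 1 / (n : ℝ) := by positivity
        linarith

theorem gridWeight_pos {k a N : ℕ} (ha : 2 ≤ a) (y : Fin k → ℤ) : 0 < gridWeight a N y := by
  have h1 : 0 < a - 1 := by omega
  have h2 : 0 < a := by omega
  rw [gridWeight]
  exact_mod_cast Nat.mul_pos (Nat.pow_pos h1) (Nat.pow_pos h2)

theorem theorem2p1 :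
    ∃ (P : OracleRAM.Prog) (C : ℕ), ∀ (ε : ℝ) (k : ℕ), 0 < ε → 0 < k →
      ∃ (S : Finset (Fin k → ℝ)) (w : (Fin k → ℝ) → ℝ),
        (∀ x ∈ S, 0 < w x) ∧
        ∀ φ : Seminorm ℝ (Fin k → ℝ),
          ∃ (σ : OracleRAM.State) (qs : List (Fin k → ℝ)) (time space : ℕ),
            OracleRAM.Exec (fun x => φ x) P (OracleRAM.initial k ⌈1 / ε⌉₊) σ qs time space ∧
            (time : ℝ) ≤ (max 2 (1 / ε)) ^ (C * k) ∧
            (space : ℝ) ≤ C * ((k : ℝ) + 1 / ε) ^ C ∧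
            (∀ x, x ∈ qs ↔ x ∈ S) ∧
            σ.output = ∑ x ∈ S, w x * φ x ∧
            MeasureTheory.Integrable (fun x => φ x) (stdNormal k) ∧
            IsFactorApprox (1 + ε) σ.output (∫ x, φ x ∂(stdNormal k)) := by
  refine ⟨gridProgram, 2 ^ 65, fun ε k hε hk => ?_⟩
  have hε' : 0 < 1 / ε := by positivity
  set n := ⌈1 / ε⌉₊ with hn_def
  have hn : 0 < n := Nat.ceil_pos.2 hε'
  have hn0 : (0 : ℝ) < n := by exact_mod_cast hn
  obtain ⟨M, hM⟩ : ∃ M, M = 64 * n := ⟨_, rfl⟩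
  obtain ⟨N, hN⟩ : ∃ N, N = 256 * (n * k) * (M * M) := ⟨_, rfl⟩
  obtain ⟨a, ha⟩ : ∃ a, a = 2 * (M * M) := ⟨_, rfl⟩
  have hM0 : 0 < M := by omega
  have ha2 : 2 ≤ a := by
    have := Nat.mul_pos hM0 hM0
    omega
  obtain ⟨hcard, hN', hB⟩ := bitBound_gridBits hk hn hM hN ha
  obtain ⟨hstep, hspace⟩ := stepBound_gridBits_le hk hn
  have hWpos : (0 : ℝ) < (∑ y ∈ latticeBall k N, gridWeight a N y : ℤ) := by
    have : 0 < ∑ y ∈ latticeBall k N, gridWeight a N y :=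
      Finset.sum_pos (fun y _ => gridWeight_pos ha2 y) ⟨0, mem_latticeBall.2 (by simp)⟩
    exact_mod_cast this
  set W : ℝ := ((∑ y ∈ latticeBall k N, gridWeight a N y : ℤ) : ℝ) with hW
  -- Rounding Mx recovers the lattice point from the grid point and defines a positive weight on all
  -- of ℝ^k.
  refine ⟨(latticeBall k N).image (gridPoint M), fun x => 4 * n / ((4 * n + 1) * W) *
    gridWeight a N (fun i => round (M * x i)), fun x _ => ?_, fun φ => ?_⟩
  · have : (0 : ℝ) < gridWeight a N (fun i => round (M * x i)) := by
      exact_mod_cast gridWeight_pos ha2 _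
    positivity
  obtain ⟨σ, qs, t, s, hexec, ht, hs, hqs, hout⟩ :=
    reach_gridProgram (φ := fun x => φ x) hM hN ha hB
  have hceil : (n : ℝ) < 1 / ε + 1 := Nat.ceil_lt_add_one hε'.le
  refine ⟨σ, qs, t, s, hexec, ?_, ?_, hqs, ?_, integrable_seminorm_stdNormal φ, ?_⟩
  · have hm : 2 ≤ max 2 (1 / ε) := le_max_left _ _
    -- With m = max 2 (1/ε), n < m + 1 ≤ m² because m ≥ 2.
    have hnm : (n : ℝ) ≤ max 2 (1 / ε) ^ 2 := by
      have := le_max_right 2 (1 / ε)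
      nlinarith
    refine (time_le_pow hk hm hnm hn hcard (ht.trans ?_)).trans
      (pow_le_pow_right₀ (by linarith) (Nat.mul_le_mul_right k (by norm_num)))
    rw [← hN']
    gcongr
  · have hk1 : (1 : ℝ) ≤ k := by exact_mod_cast hk
    have hny : (n : ℝ) ≤ k + 1 / ε := by linarith
    have hky : (k : ℝ) ≤ k + 1 / ε := by linarith
    have hy1 : 1 ≤ k + 1 / ε := by linarith
    have h1 : (s : ℝ) ≤ 2 ^ 65 * ((n : ℝ) ^ 5 * (k : ℝ) ^ 2) := by exact_mod_cast hs.trans hspace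
    calc (s : ℝ) ≤ 2 ^ 65 * ((n : ℝ) ^ 5 * (k : ℝ) ^ 2) := h1
      _ ≤ 2 ^ 65 * ((k + 1 / ε) ^ 5 * (k + 1 / ε) ^ 2) := by gcongr
      _ = 2 ^ 65 * (k + 1 / ε) ^ 7 := by ring
      _ ≤ 2 ^ 65 * (k + 1 / ε) ^ (2 ^ 65) :=
        mul_le_mul_of_nonneg_left (pow_le_pow_right₀ hy1 (by norm_num)) (by positivity)
      _ = _ := by rw [Nat.cast_pow, Nat.cast_ofNat]
  · rw [hout, Finset.sum_image fun y _ z _ h => gridPoint_injective hM0 h, Finset.mul_sum]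
    refine Finset.sum_congr rfl fun y _ => ?_
    have e : (fun i => round (M * gridPoint M y i)) = y := by
      ext i
      rw [gridPoint, mul_div_cancel₀ _ (by positivity), round_intCast]
    beta_reduce
    rw [e]
    ring
  · rw [hout]
    obtain ⟨h1, h2⟩ := gridSum_bounds hk hn hM hN ha φ
    refine isFactorApprox_of_bounds hn ?_ (integral_nonneg fun x => apply_nonneg φ x) hWpos h1 h2
    rw [one_div_le hn0 hε]
    exact Nat.le_ceil _
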